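/- For a poset $P=(X,\prec)$ with $n$ elements let $\mathcal E(P)$ be the set of linear extensions of $P$, i.e. of bijections $f:X\to[n]$ with $f(x)<f(y)$ whenever $x\prec y$, and let $e(P)=|\mathcal E(P)|$. For a permutation $\sigma\in S_n$ let $P_\sigma$ be the poset on $[n]$ with $i\prec j$ if and only if $i<j$ and $\sigma(i)<\sigma(j)$, let $\overline\sigma=(\sigma(n),\ldots,\sigma(1))$, and let $$\eta(\sigma)=e(P_\sigma)\,e(P_{\overline\sigma})-n!\in\mathbb Z .$$ Then $\eta(\sigma)\ge 0$ for all $n\ge 0$ and all $\sigma\in S_n$, and the function $\eta:\bigsqcup_{n\ge 0} S_n\to\mathbb N$ is in $\#\mathsf P$. (Permutations are given as binary words, by their one-line notation with entries in unary, so that the length of the word is polynomial in $n$; $\eta$ is extended by $0$ to the words that do not encode a permutation. A function $F:\{0,1\}^*\to\mathbb N$ is in $\#\mathsf P$ if there are a polynomial $p$ and a relation $R\subseteq\{0,1\}^*\times\{0,1\}^*$, decidable by a Turing machine in polynomial time, such that $F(x)=|\{y : |y|\le p(|x|),\ (x,y)\in R\}|$ for all $x$.) Moreover, there are injections $\beta_\sigma:S_n\to\mathcal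 E(P_\sigma)\times\mathcal E(P_{\overline\sigma})$, one for each $n\ge 0$ and each $\sigma\in S_n$, such that: (1) the map $(\sigma,\tau)\mapsto\beta_\sigma(\tau)$ is computable in polynomial time; (2) it is decidable in polynomial time, given $\sigma$ and $(f,g)$, whether $f\in\mathcal E(P_\sigma)$, $g\in\mathcal E(P_{\overline\sigma})$ and $(f,g)\notin\beta_\sigma(S_n)$; (3) $\eta(\sigma)$ is the number of pairs $(f,g)\in\mathcal E(P_\sigma)\times\mathcal E(P_{\overline\sigma})$ with $(f,g)\notin\beta_\sigma(S_n)$. -/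

import Mathlib

/-! ### Posets and linear extensions -/

/-- The set `E(P)` of linear extensions of a poset `P = (X, ≺)` with `n` elements: the bijections
`f : X → [n]` with `f x < f y` whenever `x ≺ y`. -/
def linExts {X : Type} (P : PartialOrder X) (n : ℕ) : Set (X ≃ Fin n) :=
  {f | ∀ x y : X, P.lt x y → f x < f y}

/-- The number `e(P)` of linear extensions. -/
noncomputable def numLinExts {X : Type} (P : PartialOrder X) (n : ℕ) : ℕ :=
  (linExts P n).ncard

/-- The permutation poset `P_σ` on `[n]`: `i ≺ j` iff `i < j` and `σ i < σ j`. -/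
abbrev permPoset {n : ℕ} (σ : Equiv.Perm (Fin n)) : PartialOrder (Fin n) where
  le i j := i ≤ j ∧ σ i ≤ σ j
  lt i j := i < j ∧ σ i < σ j
  le_refl i := ⟨le_refl i, le_refl (σ i)⟩
  le_trans _ _ _ h h' := ⟨h.1.trans h'.1, h.2.trans h'.2⟩
  le_antisymm _ _ h h' := le_antisymm h.1 h'.1
  lt_iff_le_not_ge i j := by
    constructor
    · rintro ⟨h, h'⟩
      exact ⟨⟨h.le, h'.le⟩, fun k => absurd k.1 (not_le.2 h)⟩
    · rintro ⟨⟨h, h'⟩, k⟩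
      have hne : i ≠ j := by
        rintro rfl
        exact k ⟨le_refl _, le_refl _⟩
      exact ⟨lt_of_le_of_ne h hne, lt_of_le_of_ne h' fun e => hne (σ.injective e)⟩

/-- The reversed permutation `(σ(n), …, σ(1))`. -/
def reversal {n : ℕ} (σ : Equiv.Perm (Fin n)) : Equiv.Perm (Fin n) :=
  Fin.revPerm.trans σ

/-- `η(σ) = e(P_σ) e(P_σ̄) - n!`, as an integer. -/
noncomputable def eta {n : ℕ} (σ : Equiv.Perm (Fin n)) : ℤ :=
  (numLinExts (permPoset σ) n : ℤ) * (numLinExts (permPoset (reversal σ)) n : ℤ)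
    - (n.factorial : ℤ)

/-! ### Polynomial time and the class #P

Polynomial time is polynomial time on Turing machines in the sense of Mathlib
(`Turing.TM2ComputableInPolyTime`); the bound is a polynomial in the length of the input word. -/

/-- The word over `Bool ⊕ Bool` that presents a pair of binary words to a machine: the letters of
the first word marked by `inl`, followed by the letters of the second word marked by `inr`. -/
def pairCode : List Bool × List Bool → List (Bool ⊕ Bool) :=
  (Computability.encodingProd (Computability.encodingList Bool)
    (Computability.encodingList Bool)).encode

/-- A binary relation on binary words is decidable in polynomial time. -/
def PolyTimeRel (R : List Bool → List Bool → Prop) : Prop :=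
  ∃ V : List Bool × List Bool → Bool,
    Nonempty (Turing.TM2ComputableInPolyTime pairCode Computability.encodeBool V) ∧
      ∀ x y, V (x, y) = true ↔ R x y

/-- The class #P: `F x` is the number of witnesses `y` of length at most `p(|x|)` that stand in a
relation, decidable in polynomial time, to `x`. -/
def InSharpP (F : List Bool → ℕ) : Prop :=
  ∃ (p : Polynomial ℕ) (R : List Bool → List Bool → Prop), PolyTimeRel R ∧
    ∀ x, F x = {y : List Bool | y.length ≤ p.eval x.length ∧ R x y}.ncard

/-! ### Permutations as binary words -/

/-- A list of numbers as a binary word: the number `k` becomes `k` times `true`, then `false`. -/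
def listCode (l : List ℕ) : List Bool :=
  l.flatMap fun k => List.replicate k true ++ [false]

/-- A permutation as a binary word: its one-line notation (with values `0, …, n - 1`), the entries
written in unary. The word has length `n (n + 1) / 2`. -/
def permCode {n : ℕ} (σ : Equiv.Perm (Fin n)) : List Bool :=
  listCode (List.ofFn fun i => (σ i : ℕ))

/-- `permCode` on permutations of all sizes. -/
def allPermCode (s : Σ n : ℕ, Equiv.Perm (Fin n)) : List Bool :=
  permCode s.2

/-- A pair of permutations of the same size as a binary word, by concatenation. -/
def permPairCode {n : ℕ} (f g : Equiv.Perm (Fin n)) : List Bool :=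
  permCode f ++ permCode g

/-- `η` as a function on all binary words: `η(σ)` at the code of a permutation `σ` (of any size),
and `0` at words that are not codes of permutations. -/
noncomputable def etaWord : List Bool → ℕ :=
  Function.extend allPermCode (fun s => (eta s.2).toNat) 0

/-! ### The codes are faithful -/

theorem listCode_cons (a : ℕ) (l : List ℕ) :
    listCode (a :: l) = List.replicate a true ++ false :: listCode l := by
  simp [listCode]

theorem replicate_append_false_inj : ∀ (a b : ℕ) (u v : List Bool),
    List.replicate a true ++ false :: u = List.replicate b true ++ false :: v → a = b ∧ u = v
  | 0, 0, _, _, h => by simpa using h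
  | 0, _ + 1, _, _, h => by simp [List.replicate_succ] at h
  | _ + 1, 0, _, _, h => by simp [List.replicate_succ] at h
  | a + 1, b + 1, u, v, h => by
      have h' := replicate_append_false_inj a b u v (by simpa [List.replicate_succ] using h)
      exact ⟨by rw [h'.1], h'.2⟩

theorem listCode_injective : Function.Injective listCode := by
  intro l
  induction l with
  | nil =>
    intro m h
    cases m with
    | nil => rfl
    | cons b m => simp [listCode] at h
  | cons a l ih =>
    intro m h
    cases m with
    | nil => simp [listCode] at h
    | cons b m =>
      rw [listCode_cons, listCode_cons] at h
      obtain ⟨h1, h2⟩ := replicate_append_false_inj _ _ _ _ h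
      rw [h1, ih h2]

theorem ofFn_perm_inj {n : ℕ} {σ τ : Equiv.Perm (Fin n)}
    (h : List.ofFn (fun i => (σ i : ℕ)) = List.ofFn fun i => (τ i : ℕ)) : σ = τ := by
  have h' := List.ofFn_injective h
  ext i
  exact congrFun h' i

theorem allPermCode_injective : Function.Injective allPermCode := by
  rintro ⟨n, σ⟩ ⟨m, τ⟩ h
  have h' := listCode_injective h
  have hn : n = m := by simpa using congrArg List.length h'
  subst hn
  have e : σ = τ := ofFn_perm_inj h'
  rw [e]

theorem permPairCode_injective {n m : ℕ} {f g : Equiv.Perm (Fin n)} {f' g' : Equiv.Perm (Fin m)}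
    (h : permPairCode f g = permPairCode f' g') :
    (⟨n, f, g⟩ : Σ n : ℕ, Equiv.Perm (Fin n) × Equiv.Perm (Fin n)) = ⟨m, f', g'⟩ := by
  have h' : listCode (List.ofFn (fun i => (f i : ℕ)) ++ List.ofFn fun i => (g i : ℕ)) =
      listCode (List.ofFn (fun i => (f' i : ℕ)) ++ List.ofFn fun i => (g' i : ℕ)) := by
    simpa [listCode, permPairCode, permCode] using h
  have h2 := listCode_injective h'
  have hn : n = m := by
    have := congrArg List.length h2
    simp at this
    omega
  subst hn
  obtain ⟨h3, h4⟩ := List.append_inj h2 (by simp)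
  rw [ofFn_perm_inj h3, ofFn_perm_inj h4]

theorem etaWord_permCode {n : ℕ} (σ : Equiv.Perm (Fin n)) :
    etaWord (permCode σ) = (eta σ).toNat :=
  allPermCode_injective.extend_apply (fun s => (eta s.2).toNat) 0 ⟨n, σ⟩

/-! ### Canonical placements -/

/-! Draw `τ` as the set of points `(τ⁻¹ p, p)` and regard the values of `σ` as elements to be put on
these points, the value `v` having the position `σ⁻¹ v`. A placement yields two functions of the
index `i`: the height and the abscissa of the point that carries `σ i`. The heights form a linear
extension of `P_σ`, and the abscissae, read backwards, one of the reversed poset, as soon as (a) no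
value lies below and to the left of a smaller one, and (b) whenever one element lies above and to
the left of another, it has the larger position. Whatever the placement, `τ` takes abscissae to
heights, so the pair of functions determines `τ` (`permOfPair_exts`). Hence any rule that chooses
such a placement for each `τ` is an injection, and `η` counts the complement of its range. A pair
`(f, g)` lies in the range iff the rule, applied to the only possible `τ`, returns `f`
(`mem_range_pairOfPerm`).

The rule `can` is recursive: the largest value goes to the highest corner such that, in the
canonical placement of the rest, no element to the right of that corner has a larger position.
Property (a) holds because corners are maximal points (`can_linear`). For (b), the elements to the
right of the last one are controlled by the choice of the corner; those above it are the heart of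
the matter (`loc_valid`). They are controlled by a monotonicity statement (`LevelMono`, proved in
`levelMono`) about the hole that is left when one of `k + 1` points stays empty. When the hole moves
from a corner `a` to a lower corner `b`, lower bounds for positions persist, and one large position
to the right of `a` forces all positions above `b` to be large. Since the corner before the chosen
one was rejected because of one large position, all positions above the chosen one are large. The
monotonicity is proved by induction on `k`: the last element first goes to a place `restart`, then
descends to its new canonical corner, and in both moves the other elements undergo slides of the
lower level (`restart_spec`, `slideMono_succ`).

Evaluated literally, the recursion branches over all corners at every level. The search keeps a
single placement instead and performs the slides one after the other. Every slide moves the hole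
down and thus raises the sum of the heights of the elements concerned. The weighted sum `potential`
pays for all steps (`searchSlides`), and a number of steps of order `n ^ 4` suffices
(`search_reaches`).

The rest turns this into polynomial time on Turing machines. Structured stack programs are simulated
by `TM2` machines (`Run.simulate`), arrays of numbers are kept in unary on stacks (`compile_spec`),
and two array programs compute the injection (`pairProg_spec`) and decide the complement of its
range (`relProg_spec`). The witnesses counted by `etaWord` are the codes of the pairs outside the
range. -/

/-- A corner of a finite set of points `(g p, p)`: no other point of the set is above it in both
coordinates. -/
def Corner (g : ℕ → ℕ) (S : Finset ℕ) (s : ℕ) : Prop :=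
  s ∈ S ∧ ∀ q ∈ S, s < q → g q < g s

open Classical in
/-- The highest corner that is not excluded. -/
noncomputable def firstGood (g : ℕ → ℕ) (S : Finset ℕ) (bad : ℕ → Prop) : ℕ :=
  (S.filter fun s => Corner g S s ∧ ¬ bad s).sup id

/-- The canonical placement of the elements `0, …, k - 1` on a set of `k` points: the last element
is put at the highest corner with which the canonical placement of the others is compatible. -/
noncomputable def can (g π : ℕ → ℕ) : ℕ → Finset ℕ → ℕ → ℕ
  | 0, _ => fun _ => 0
  | k + 1, S =>
    let t := firstGood g S fun s => ∃ j < k, g s < g (can g π k (S.erase s) j) ∧ π k < π j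
    fun j => if j = k then t else can g π k (S.erase t) j

/-- Element `k` would be misplaced at the corner `s`. -/
def Bad (g π : ℕ → ℕ) (k : ℕ) (S : Finset ℕ) (s : ℕ) : Prop :=
  ∃ j < k, g s < g (can g π k (S.erase s) j) ∧ π k < π j

/-- The place of the last element. -/
noncomputable def loc (g π : ℕ → ℕ) (k : ℕ) (S : Finset ℕ) : ℕ := firstGood g S (Bad g π k S)

/-- All elements placed above height `h` have position at least `c`. -/
def AllAbove (g π : ℕ → ℕ) (c k : ℕ) (D : Finset ℕ) (h : ℕ) : Prop :=
  ∀ j < k, h < can g π k D j → c ≤ π j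

/-- Some element placed to the right of `γ` has position at least `c`. -/
def SomeRight (g π : ℕ → ℕ) (c k : ℕ) (D : Finset ℕ) (γ : ℕ) : Prop :=
  ∃ j < k, γ < g (can g π k D j) ∧ c ≤ π j

section Canonical

variable {g π : ℕ → ℕ}

theorem can_last (k : ℕ) (S : Finset ℕ) : can g π (k + 1) S k = loc g π k S := by
  simp [can, loc]; rfl

theorem can_of_lt {k j : ℕ} (h : j < k) (S : Finset ℕ) :
    can g π (k + 1) S j = can g π k (S.erase (loc g π k S)) j := by
  simp [can, loc, h.ne]; rfl

/-- Strict comparison of positions becomes the threshold `π k + 1`. Statements on `SomeRight` for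
all thresholds thus include statements on badness. -/
theorem bad_iff {k s : ℕ} {S : Finset ℕ} :
    Bad g π k S s ↔ SomeRight g π (π k + 1) k (S.erase s) (g s) := Iff.rfl

theorem Corner.mono {S S' : Finset ℕ} {s : ℕ} (h : Corner g S s) (hS : S' ⊆ S) (hs : s ∈ S') :
    Corner g S' s := ⟨hs, fun q hq => h.2 q (hS hq)⟩

theorem exists_maxg {S : Finset ℕ} (hS : S.Nonempty) : ∃ s ∈ S, ∀ q ∈ S, g q ≤ g s :=
  S.exists_max_image g hS

theorem exists_max {S : Finset ℕ} (hS : S.Nonempty) : ∃ s ∈ S, ∀ q ∈ S, q ≤ s :=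
  S.exists_max_image id hS

theorem Corner.lt_of_g_lt {S : Finset ℕ} {a b : ℕ} (ha : Corner g S a) (hb : b ∈ S)
    (h : g a < g b) : b < a := by
  by_contra hn
  rcases (not_lt.1 hn).lt_or_eq with h' | h'
  · exact absurd (ha.2 b hb h') (by omega)
  · subst h'; omega

/-- The rightmost point is always a good corner: neither a point nor an element lies to the right of
it. -/
theorem exists_good {k : ℕ} {S : Finset ℕ} (hS : S.card = k + 1) (hg : Function.Injective g)
    (hmem : ∀ s ∈ S, ∀ j < k, can g π k (S.erase s) j ∈ S) :
    ∃ s, Corner g S s ∧ ¬ Bad g π k S s := by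
  obtain ⟨s, hs, hm⟩ := exists_maxg (g := g) (S := S) (Finset.card_pos.1 (by omega))
  refine ⟨s, ⟨hs, fun q hq h => lt_of_le_of_ne (hm q hq) fun e => h.ne' (hg e)⟩, ?_⟩
  rintro ⟨j, hj, h, -⟩
  exact absurd (hm _ (hmem s hs j hj)) (by omega)

/-- A good corner makes the filtered set nonempty, so that its supremum is attained and is not the
default value `0`. -/
theorem loc_spec_aux {k : ℕ} {S : Finset ℕ} (h : ∃ s, Corner g S s ∧ ¬ Bad g π k S s) :
    Corner g S (loc g π k S) ∧ ¬ Bad g π k S (loc g π k S) ∧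
      ∀ s, Corner g S s → loc g π k S < s → Bad g π k S s := by
  classical
  obtain ⟨s, hs⟩ := h
  have hne : (S.filter fun s => Corner g S s ∧ ¬ Bad g π k S s).Nonempty :=
    ⟨s, Finset.mem_filter.2 ⟨hs.1.1, hs⟩⟩
  have hl : loc g π k S = (S.filter fun s => Corner g S s ∧ ¬ Bad g π k S s).sup id := by
    unfold loc firstGood; congr!
  obtain ⟨t, ht, e⟩ := Finset.exists_mem_eq_sup _ hne id
  rw [hl]
  have ht' := (Finset.mem_filter.1 ht).2
  rw [e]
  refine ⟨ht'.1, ht'.2, fun s hs hlt => ?_⟩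
  by_contra hb
  have := Finset.le_sup (f := id) (Finset.mem_filter.2 ⟨hs.1, hs, hb⟩ :
    s ∈ S.filter fun s => Corner g S s ∧ ¬ Bad g π k S s)
  rw [e] at this
  simp only [id] at this hlt
  omega

/-- The existence of a good corner in `S` needs the smaller placements to stay inside `S`, so this
is proved by induction through `loc_spec_aux`; only afterwards is `loc_spec` available without side
conditions. -/
theorem can_mem (hg : Function.Injective g) : ∀ {k : ℕ} {S : Finset ℕ}, S.card = k →
    ∀ j < k, can g π k S j ∈ S := by
  intro k
  induction k with
  | zero => intro S _ j hj; omega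
  | succ k ih =>
    intro S hS j hj
    have h1 : ∀ s ∈ S, ∀ j < k, can g π k (S.erase s) j ∈ S := fun s hs j hj =>
      Finset.mem_of_mem_erase (ih (by rw [Finset.card_erase_of_mem hs]; omega) j hj)
    have h2 := loc_spec_aux (exists_good hS hg h1)
    rcases Nat.lt_succ_iff_lt_or_eq.1 hj with h | rfl
    · rw [can_of_lt h]; exact h1 _ h2.1.1 j h
    · rw [can_last]; exact h2.1.1

theorem loc_spec (hg : Function.Injective g) {k : ℕ} {S : Finset ℕ} (hS : S.card = k + 1) :
    Corner g S (loc g π k S) ∧ ¬ Bad g π k S (loc g π k S) ∧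
      ∀ s, Corner g S s → loc g π k S < s → Bad g π k S s :=
  loc_spec_aux (exists_good hS hg fun s hs j hj => Finset.mem_of_mem_erase
    (can_mem hg (by rw [Finset.card_erase_of_mem hs]; omega) j hj))

theorem card_erase_eq {k s : ℕ} {S : Finset ℕ} (hS : S.card = k + 1) (hs : s ∈ S) :
    (S.erase s).card = k := by
  rw [Finset.card_erase_of_mem hs]; omega

theorem can_surj (hg : Function.Injective g) : ∀ {k : ℕ} {S : Finset ℕ}, S.card = k →
    ∀ q ∈ S, ∃ j < k, can g π k S j = q := by
  intro k
  induction k with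
  | zero => intro S hS q hq; rw [Finset.card_eq_zero] at hS; simp [hS] at hq
  | succ k ih =>
    intro S hS q hq
    by_cases h : q = loc g π k S
    · exact ⟨k, by omega, by rw [can_last, h]⟩
    · obtain ⟨j, hj, e⟩ := ih (card_erase_eq hS (loc_spec (π := π) hg hS).1.1) q
        (Finset.mem_erase.2 ⟨h, hq⟩)
      exact ⟨j, by omega, by rw [can_of_lt hj, e]⟩

/-! ### Bounds for positions, split off the last element -/

theorem allAbove_succ {c k h : ℕ} {D : Finset ℕ} : AllAbove g π c (k + 1) D h ↔
    AllAbove g π c k (D.erase (loc g π k D)) h ∧ (h < loc g π k D → c ≤ π k) := by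
  constructor
  · intro H
    refine ⟨fun j hj h' => H j (by omega) (by rwa [can_of_lt hj]), fun h' => H k (by omega) ?_⟩
    rwa [can_last]
  · rintro ⟨H1, H2⟩ j hj h'
    rcases Nat.lt_succ_iff_lt_or_eq.1 hj with h | rfl
    · rw [can_of_lt h] at h'; exact H1 j h h'
    · rw [can_last] at h'; exact H2 h'

theorem someRight_succ {c k γ : ℕ} {D : Finset ℕ} : SomeRight g π c (k + 1) D γ ↔
    SomeRight g π c k (D.erase (loc g π k D)) γ ∨ (γ < g (loc g π k D) ∧ c ≤ π k) := by
  constructor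
  · rintro ⟨j, hj, h', hc⟩
    rcases Nat.lt_succ_iff_lt_or_eq.1 hj with h | rfl
    · rw [can_of_lt h] at h'; exact Or.inl ⟨j, h, h', hc⟩
    · rw [can_last] at h'; exact Or.inr ⟨h', hc⟩
  · rintro (⟨j, hj, h', hc⟩ | ⟨h', hc⟩)
    · exact ⟨j, by omega, by rwa [can_of_lt hj], hc⟩
    · exact ⟨k, by omega, by rwa [can_last], hc⟩

theorem AllAbove.mono {c k D} {h h' : ℕ} (H : AllAbove g π c k D h) (hh : h ≤ h') :
    AllAbove g π c k D h' := fun j hj hlt => H j hj (by omega)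

theorem SomeRight.mono {c k D} {γ γ' : ℕ} (H : SomeRight g π c k D γ) (hh : γ' ≤ γ) :
    SomeRight g π c k D γ' := by
  obtain ⟨j, hj, h1, h2⟩ := H; exact ⟨j, hj, by omega, h2⟩

theorem SomeRight.anti {c c' k D} {γ : ℕ} (H : SomeRight g π c k D γ) (hc : c' ≤ c) :
    SomeRight g π c' k D γ := by
  obtain ⟨j, hj, h1, h2⟩ := H; exact ⟨j, hj, h1, hc.trans h2⟩

/-! ### Adjacent corners -/

/-- `b` is the corner following `a`. -/
def NextCorner (g : ℕ → ℕ) (S : Finset ℕ) (a b : ℕ) : Prop :=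
  Corner g S a ∧ b ∈ S ∧ g a < g b ∧ ∀ q ∈ S, g a < g q → q ≤ b

theorem NextCorner.lt {S : Finset ℕ} {a b : ℕ}
    (h : NextCorner g S a b) : b < a := h.1.lt_of_g_lt h.2.1 h.2.2.1

theorem NextCorner.corner {S : Finset ℕ} {a b : ℕ}
    (h : NextCorner g S a b) : Corner g S b := by
  refine ⟨h.2.1, fun q hq hlt => ?_⟩
  by_contra hn
  have := h.2.2.2 q hq (by have := h.2.2.1; omega)
  omega

/-- Take the highest point to the right of `a`. -/
theorem exists_nextCorner {S : Finset ℕ} {a q : ℕ} (ha : Corner g S a) (hq : q ∈ S)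
    (h : g a < g q) : ∃ b, NextCorner g S a b := by
  obtain ⟨b, hb, hm⟩ := exists_max (S := S.filter fun q => g a < g q)
    ⟨q, Finset.mem_filter.2 ⟨hq, h⟩⟩
  rw [Finset.mem_filter] at hb
  exact ⟨b, ha, hb.1, hb.2, fun q hq h => hm q (Finset.mem_filter.2 ⟨hq, h⟩)⟩

/-- Take the rightmost point above `b`. -/
theorem exists_prevCorner (hg : Function.Injective g) {S : Finset ℕ} {b q : ℕ}
    (hb : Corner g S b) (hq : q ∈ S) (h : b < q) : ∃ a, NextCorner g S a b := by
  obtain ⟨a, ha, hm⟩ := exists_maxg (g := g) (S := S.filter fun q => b < q)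
    ⟨q, Finset.mem_filter.2 ⟨hq, h⟩⟩
  rw [Finset.mem_filter] at ha
  refine ⟨a, ⟨ha.1, fun q hq h' => lt_of_le_of_ne (hm q (Finset.mem_filter.2 ⟨hq, by omega⟩))
    fun e => h'.ne' (hg e)⟩, hb.1, hb.2 a ha.1 ha.2, fun q hq h' => ?_⟩
  by_contra hn
  have := hm q (Finset.mem_filter.2 ⟨hq, by omega⟩)
  omega

/-! ### Monotonicity under a moving hole -/

/-- Monotonicity of the canonical placements of `k` elements when the hole of a set of `k + 1`
points moves to a later corner. -/
def SlideMono (g π : ℕ → ℕ) (k : ℕ) (S : Finset ℕ) (a b : ℕ) : Prop := ∀ c,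
  (∀ h, (a ≤ h ∨ h < b) → AllAbove g π c k (S.erase a) h → AllAbove g π c k (S.erase b) h) ∧
  (∀ γ, (g b ≤ γ ∨ γ < g a) → SomeRight g π c k (S.erase a) γ →
    SomeRight g π c k (S.erase b) γ) ∧
  (∀ γ, g a ≤ γ → (∀ q ∈ S, γ < g q → q ≤ b) → SomeRight g π c k (S.erase a) γ →
    AllAbove g π c k (S.erase b) b)

/-- All slides of level `k` are monotone. -/
def LevelMono (g π : ℕ → ℕ) (k : ℕ) : Prop :=
  ∀ S a b, S.card = k + 1 → Corner g S a → Corner g S b → b < a → SlideMono g π k S a b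

/-- Slides between adjacent corners compose. The first two clauses are transitive, because an
intermediate corner lies between `a` and `b` in both coordinates. In the third, the first step only
transports `SomeRight`, and the remaining slide converts it into `AllAbove`. -/
theorem SlideMono.chain (hg : Function.Injective g) {k : ℕ}
    (H : ∀ S a b, S.card = k + 1 → NextCorner g S a b → SlideMono g π k S a b) :
    LevelMono g π k := by
  intro S a b hS
  induction hd : a - b using Nat.strong_induction_on generalizing a with
  | _ d ih =>
    intro ha hb hlt
    obtain ⟨s, hs⟩ := exists_nextCorner ha hb.1 (hb.2 a ha.1 hlt)
    have hsb : b ≤ s := hs.2.2.2 b hb.1 (hb.2 a ha.1 hlt)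
    have hsa := hs.lt
    rcases hsb.eq_or_lt with rfl | hsb
    · exact H S a b hS hs
    have I := ih (s - b) (by omega) s rfl hs.corner hb hsb
    have J := H S a s hS hs
    have gs := hb.2 s hs.2.1 hsb
    intro c
    refine ⟨fun h hh A => (I c).1 h ?_ ((J c).1 h ?_ A),
      fun γ hh A => (I c).2.1 γ ?_ ((J c).2.1 γ ?_ A), fun γ h1 h2 A => ?_⟩
    · omega
    · omega
    · have := hs.2.2.1; omega
    · omega
    -- No point to the right of `γ` is higher than `b`, whereas `s` is; hence `s` is not to the
    -- right of `γ`.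
    · have h3 : g s ≤ γ := by
        by_contra hn
        have := h2 s hs.2.1 (by omega)
        omega
      exact (I c).2.2 γ h3 h2 ((J c).2.1 γ (Or.inl h3) A)

/-- An element above the chosen corner means that some corner `a` precedes the chosen one. It is
higher and was rejected: with the last element at `a`, some element to the right of `a` has a
position beyond `π k`. The third clause for the slide from `a` to the chosen corner turns this
single witness into a bound for everything above the chosen corner. -/
theorem loc_valid (hg : Function.Injective g) {k : ℕ} (H : LevelMono g π k) {S : Finset ℕ}
    (hS : S.card = k + 1) {j : ℕ} (hj : j < k)
    (h : loc g π k S < can g π (k + 1) S j) : π k ≤ π j := by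
  obtain ⟨h1, h2, h3⟩ := loc_spec (π := π) hg hS
  have hm := can_mem (π := π) hg hS j (by omega)
  obtain ⟨a, ha⟩ := exists_prevCorner hg h1 hm h
  have hb := h3 a ha.1 (ha.lt)
  rw [bad_iff] at hb
  have := (H S a _ hS ha.1 h1 (ha.lt) (π k + 1)).2.2 (g a) le_rfl ha.2.2.2 hb j hj
    (by rwa [can_of_lt hj] at h)
  omega

theorem loc_valid' (hg : Function.Injective g) {k : ℕ} {S : Finset ℕ}
    (hS : S.card = k + 1) {j : ℕ} (hj : j < k)
    (h : g (loc g π k S) < g (can g π (k + 1) S j)) : π j ≤ π k := by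
  obtain ⟨h1, h2, h3⟩ := loc_spec (π := π) hg hS
  by_contra hn
  exact h2 ⟨j, hj, by rwa [can_of_lt hj] at h, by omega⟩

/-- While the last element descends from `r` to its canonical place, the others undergo a slide of
level `k` inside `S`. Monotonicity preserves the bound except at heights between the two places,
where the position of the last element takes over. -/
theorem advance_above (hg : Function.Injective g) {k : ℕ} (H : LevelMono g π k) {S : Finset ℕ}
    (hS : S.card = k + 1) {r c h : ℕ} (hr : Corner g S r) (hle : loc g π k S ≤ r)
    (A : AllAbove g π c k (S.erase r) h) (B : h < r → c ≤ π k) : AllAbove g π c (k + 1) S h := by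
  rw [allAbove_succ]
  rcases hle.eq_or_lt with e | hlt
  · rw [e]; exact ⟨A, B⟩
  have M := (H S r _ hS hr (loc_spec hg hS).1 hlt c).1
  refine ⟨?_, fun h' => B (by omega)⟩
  by_cases h1 : r ≤ h ∨ h < loc g π k S
  · exact M h h1 A
  -- Here `loc g π k S ≤ h < r`: the last element was above `h`, so `c ≤ π k`, and `loc_valid` gives
  -- `π k ≤ π j`.
  · intro j hj h2
    exact (B (by omega)).trans (loc_valid hg H hS hj (by rw [can_of_lt hj]; omega))

/-- The possible places of the last element relative to a slide. -/
theorem loc_cases (hg : Function.Injective g) {k : ℕ} {S : Finset ℕ} {a b : ℕ}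
    (hS : S.card = k + 2) (hab : NextCorner g S a b) :
    loc g π k (S.erase a) = b ∨
    (Corner g (S.erase b) (loc g π k (S.erase a)) ∧ Corner g S (loc g π k (S.erase a)) ∧
      (a < loc g π k (S.erase a) ∨
      (loc g π k (S.erase a) < b ∧ g b < g (loc g π k (S.erase a))))) ∨
    (b < loc g π k (S.erase a) ∧ loc g π k (S.erase a) < a ∧ g (loc g π k (S.erase a)) < g a) := by
  have hD : (S.erase a).card = k + 1 := card_erase_eq hS hab.1.1
  have ht := (loc_spec (π := π) hg hD).1
  set t := loc g π k (S.erase a)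
  have htS := Finset.mem_of_mem_erase ht.1
  have hta := Finset.ne_of_mem_erase ht.1
  have hba := hab.lt
  have hbD : b ∈ S.erase a := Finset.mem_erase.2 ⟨by omega, hab.2.1⟩
  -- Filling the hole `a` can spoil the corner `t` only if `a` lies above and to the right of `t`.
  have key : ∀ {S' : Finset ℕ}, (∀ q ∈ S', q ∈ S) → (t < a → g a < g t) → t ∈ S' →
      Corner g S' t := by
    intro S' h1 h2 h3
    refine ⟨h3, fun q hq hlt => ?_⟩
    by_cases hqa : q = a
    · subst hqa; exact h2 hlt
    · exact ht.2 q (Finset.mem_erase.2 ⟨hqa, h1 q hq⟩) hlt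
  rcases lt_trichotomy t b with h | h | h
  · have h1 := ht.2 b hbD h
    have h2 := hab.2.2.1
    refine Or.inr (Or.inl ⟨key (fun q => Finset.mem_of_mem_erase) (fun _ => by omega)
      (Finset.mem_erase.2 ⟨by omega, htS⟩), key (fun q => id) (fun _ => by omega) htS,
      Or.inr ⟨h, h1⟩⟩)
  · exact Or.inl h
  · rcases lt_or_gt_of_ne hta with h' | h'
    · refine Or.inr (Or.inr ⟨h, h', ?_⟩)
      by_contra hn
      rcases (not_lt.1 hn).eq_or_lt with e | e
      · exact hta (hg e.symm)
      · have := hab.2.2.2 t htS e; omega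
    · exact Or.inr (Or.inl ⟨key (fun q => Finset.mem_of_mem_erase) (fun _ => by omega)
      (Finset.mem_erase.2 ⟨by omega, htS⟩), key (fun q => id) (fun _ => by omega) htS,
      Or.inl h'⟩)

open Classical in
/-- The place of the last element from which it advances after a slide. -/
noncomputable def restart (g π : ℕ → ℕ) (k : ℕ) (S : Finset ℕ) (a b : ℕ) : ℕ :=
  if loc g π k (S.erase a) = b ∨ (loc g π k (S.erase a) < a ∧ g (loc g π k (S.erase a)) < g a)
  then a else loc g π k (S.erase a)

theorem restart_cases (hg : Function.Injective g) {k : ℕ} {S : Finset ℕ} {a b : ℕ}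
    (hS : S.card = k + 2) (hab : NextCorner g S a b) :
    (loc g π k (S.erase a) = b ∧ restart g π k S a b = a) ∨
    ((Corner g (S.erase b) (loc g π k (S.erase a)) ∧ Corner g S (loc g π k (S.erase a)) ∧
      (a < loc g π k (S.erase a) ∨
      (loc g π k (S.erase a) < b ∧ g b < g (loc g π k (S.erase a))))) ∧
      restart g π k S a b = loc g π k (S.erase a)) ∨
    ((b < loc g π k (S.erase a) ∧ loc g π k (S.erase a) < a ∧
      g (loc g π k (S.erase a)) < g a) ∧ restart g π k S a b = a) := by
  have h1 := hab.2.2.1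
  have h2 := hab.lt
  rcases loc_cases (π := π) hg hS hab with h | h | h
  · exact Or.inl ⟨h, by simp [restart, h]⟩
  · refine Or.inr (Or.inl ⟨h, ?_⟩)
    rw [restart, if_neg]
    rintro (h' | ⟨h', h''⟩)
    · rw [h'] at h; omega
    · omega
  · exact Or.inr (Or.inr ⟨h, by rw [restart, if_pos (Or.inr h.2)]⟩)

/-- Corners of a set with a hole at `a` are corners with a hole at `b`, away from `a` and `b`. -/
theorem Corner.transfer (hg : Function.Injective g) {S : Finset ℕ} {a b s : ℕ}
    (hab : NextCorner g S a b) (hs : Corner g (S.erase b) s) (h : a < s ∨ (s < b ∧ g b < g s)) :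
    Corner g (S.erase a) s ∧ NextCorner g (S.erase s) a b := by
  have hba := hab.lt
  have h1 := hab.2.2.1
  have hsS := Finset.mem_of_mem_erase hs.1
  have hsa : s ≠ a := by omega
  have hsb : s ≠ b := by omega
  refine ⟨⟨Finset.mem_erase.2 ⟨hsa, hsS⟩, fun q hq hlt => ?_⟩, ?_⟩
  · by_cases hqb : q = b
    · subst hqb; omega
    · exact hs.2 q (Finset.mem_erase.2 ⟨hqb, Finset.mem_of_mem_erase hq⟩) hlt
  · exact ⟨hab.1.mono (Finset.erase_subset _ _) (Finset.mem_erase.2 ⟨hsa.symm, hab.1.1⟩),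
      Finset.mem_erase.2 ⟨hsb.symm, hab.2.1⟩, h1, fun q hq =>
        hab.2.2.2 q (Finset.mem_of_mem_erase hq)⟩

/-- The canonical place cannot be above the restart, because every corner above the restart is bad.
A corner away from the slide was bad before, being above the old place of the last element, and
stays bad by the second clause of `LevelMono`. For the remaining corners, badness is inherited from
that of `b` before the slide. -/
theorem restart_spec (hg : Function.Injective g) {k : ℕ} (H : LevelMono g π k) {S : Finset ℕ}
    {a b : ℕ} (hS : S.card = k + 2) (hab : NextCorner g S a b) :
    Corner g (S.erase b) (restart g π k S a b) ∧
      loc g π k (S.erase b) ≤ restart g π k S a b := by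
  have hD : (S.erase a).card = k + 1 := card_erase_eq hS hab.1.1
  have hD' : (S.erase b).card = k + 1 := card_erase_eq hS hab.2.1
  have ht := loc_spec (π := π) hg hD
  have ht' := loc_spec (π := π) hg hD'
  have hba := hab.lt
  have h1 := hab.2.2.1
  have ca : Corner g (S.erase b) a := hab.1.mono (Finset.erase_subset _ _)
    (Finset.mem_erase.2 ⟨by omega, hab.1.1⟩)
  have cb : Corner g (S.erase a) b := hab.corner.mono (Finset.erase_subset _ _)
    (Finset.mem_erase.2 ⟨by omega, hab.2.1⟩)
  -- a bad corner away from the slide stays bad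
  have key : ∀ s, Corner g (S.erase b) s → loc g π k (S.erase a) < s →
      (a < s ∨ (s < b ∧ g b < g s)) → Bad g π k (S.erase b) s := by
    intro s hs hlt h
    obtain ⟨c1, c2⟩ := hs.transfer hg hab h
    have hb := ht.2.2 s c1 hlt
    rw [bad_iff] at hb ⊢
    have hsS : (S.erase s).card = k + 1 := card_erase_eq hS (Finset.mem_of_mem_erase hs.1)
    have := (H _ a b hsS c2.1 c2.corner hba (π k + 1)).2.1 (g s)
    rw [Finset.erase_right_comm, Finset.erase_right_comm (a := s) (b := b)] at this
    refine this ?_ hb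
    rcases h with h | h
    · have : g s < g a := by
        by_contra hn
        rcases (not_lt.1 hn).eq_or_lt with e | e
        · have := hg e; omega
        · have := hab.2.2.2 s (Finset.mem_of_mem_erase hs.1) e; omega
      exact Or.inr this
    · exact Or.inl h.2.le
  have main : ∀ s, Corner g (S.erase b) s → restart g π k S a b < s → Bad g π k (S.erase b) s := by
    intro s hs hlt
    rcases restart_cases (π := π) hg hS hab with ⟨h, e⟩ | ⟨h, e⟩ | ⟨h, e⟩
    · rw [e] at hlt
      exact key s hs (by omega) (Or.inl hlt)
    · rw [e] at hlt
      by_cases h2 : a < s ∨ (s < b ∧ g b < g s)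
      · exact key s hs hlt h2
      push Not at h2
      have htb : loc g π k (S.erase a) < b := by omega
      -- `b` was bad
      have hb := ht.2.2 b cb htb
      rw [bad_iff, Finset.erase_right_comm] at hb
      have hsb := Finset.ne_of_mem_erase hs.1
      rcases h2.1.eq_or_lt with rfl | hsa
      · rw [bad_iff]; exact hb.mono (by omega)
      have h3 : g a < g s := hs.2 a ca.1 hsa
      have h4 : s < b := lt_of_le_of_ne (hab.2.2.2 s (Finset.mem_of_mem_erase hs.1) h3) hsb
      -- The points left by last element `b` and hole `a` are also those left by last element `a`
      -- and hole `b`. Sliding from `a` to `s` inside `S.erase b` carries the badness of `b` over to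
      -- `s`, which is not to the right of `b`.
      have := (H _ a s hD' ca hs hsa (π k + 1)).2.1 (g b) (Or.inl (h2.2 h4)) hb
      rw [bad_iff]
      exact this.mono (h2.2 h4)
    · rw [e] at hlt
      exact key s hs (by omega) (Or.inl hlt)
  constructor
  · rcases restart_cases (π := π) hg hS hab with ⟨h, e⟩ | ⟨h, e⟩ | ⟨h, e⟩
    · rw [e]; exact ca
    · rw [e]; exact h.1
    · rw [e]; exact ca
  · by_contra hn
    exact ht'.2.1 (main _ ht'.1 (by omega))

/-- The slide consists of two moves of the first `k` elements: one while the last element changes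
from its old place to the restart (none at all if the old place is `b`), and one that accompanies
its descent from the restart to the new place. Each clause is followed through both moves. Wherever
monotonicity leaves a gap, the last element fills it, since `loc_valid` and `loc_valid'` compare its
position with those around it. -/
theorem slideMono_succ (hg : Function.Injective g) {k : ℕ} (H : LevelMono g π k) {S : Finset ℕ}
    {a b : ℕ} (hS : S.card = k + 2) (hab : NextCorner g S a b) : SlideMono g π (k + 1) S a b := by
  have hD : (S.erase a).card = k + 1 := card_erase_eq hS hab.1.1
  have hD' : (S.erase b).card = k + 1 := card_erase_eq hS hab.2.1
  have ht := loc_spec (π := π) hg hD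
  have ht' := loc_spec (π := π) hg hD'
  have hr := restart_spec hg H hS hab
  have hba := hab.lt
  have h1 := hab.2.2.1
  have ca : Corner g (S.erase b) a := hab.1.mono (Finset.erase_subset _ _)
    (Finset.mem_erase.2 ⟨by omega, hab.1.1⟩)
  have cb : Corner g (S.erase a) b := hab.corner.mono (Finset.erase_subset _ _)
    (Finset.mem_erase.2 ⟨by omega, hab.2.1⟩)
  have grt : g (restart g π k S a b) ≤ g (loc g π k (S.erase b)) := by
    rcases hr.2.eq_or_lt with e | e
    · rw [e]
    · exact (ht'.1.2 _ hr.1.1 e).le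
  have tS := Finset.mem_of_mem_erase ht.1.1
  -- the slide of the remaining elements up to the restart
  have sl : (loc g π k (S.erase a) = b → (S.erase a).erase (loc g π k (S.erase a)) =
      (S.erase b).erase (restart g π k S a b)) ∧
      (restart g π k S a b = loc g π k (S.erase a) → loc g π k (S.erase a) ≠ b →
        NextCorner g (S.erase (loc g π k (S.erase a))) a b) := by
    rcases restart_cases (π := π) hg hS hab with ⟨h, e⟩ | ⟨h, e⟩ | ⟨h, e⟩
    · exact ⟨fun _ => by rw [h, e, Finset.erase_right_comm], fun _ h' => absurd h h'⟩
    · exact ⟨fun h' => by rw [h'] at h; omega, fun _ _ => (h.1.transfer hg hab h.2.2).2⟩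
    · exact ⟨fun h' => by omega, fun h' => by omega⟩
  have val : ∀ j < k, ∀ p, can g π k ((S.erase a).erase (loc g π k (S.erase a))) j = p →
      loc g π k (S.erase a) < p → π k ≤ π j := fun j hj p hp h =>
    loc_valid hg H hD hj (by rw [can_of_lt hj, hp]; exact h)
  have val2 : ∀ c γ, SomeRight g π c k ((S.erase a).erase (loc g π k (S.erase a))) γ →
      g (loc g π k (S.erase a)) ≤ γ → c ≤ π k := by
    rintro c γ ⟨j, hj, h2, h3⟩ h4
    exact h3.trans (loc_valid' hg hD hj (by rw [can_of_lt hj]; omega))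
  intro c
  refine ⟨fun h hh A => ?_, fun γ hh A => ?_, fun γ hγ hq A => ?_⟩
  · rw [allAbove_succ] at A
    refine advance_above hg H hD' hr.1 hr.2 ?_ ?_
    all_goals rcases restart_cases (π := π) hg hS hab with ⟨h, e⟩ | ⟨h, e⟩ | ⟨h, e⟩
    · rw [← sl.1 h]; exact A.1
    · have n := sl.2 e (by omega)
      have := (H _ a b (card_erase_eq hS tS) n.1 n.corner hba c).1
      rw [Finset.erase_right_comm, Finset.erase_right_comm (a := loc g π k (S.erase a)) (b := b)]
        at this
      rw [e]
      exact this _ hh A.1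
    · have := (H _ (loc g π k (S.erase a)) b hD ht.1 cb h.1 c).1
      rw [e, Finset.erase_right_comm]
      exact this _ (by omega) A.1
    · intro; exact A.2 (by omega)
    · intro; exact A.2 (by omega)
    · intro; exact A.2 (by omega)
  · rw [someRight_succ] at A ⊢
    have lower : SomeRight g π c k ((S.erase a).erase (loc g π k (S.erase a))) γ →
        (g (loc g π k (S.erase b)) ≤ γ ∨ γ < g (restart g π k S a b)) →
        (restart g π k S a b = a → loc g π k (S.erase a) ≠ b → g b ≤ γ ∨
          γ < g (loc g π k (S.erase a))) →
        SomeRight g π c k ((S.erase b).erase (loc g π k (S.erase b))) γ := by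
      intro A h2 h3
      have step1 : SomeRight g π c k ((S.erase b).erase (restart g π k S a b)) γ := by
        rcases restart_cases (π := π) hg hS hab with ⟨h, e⟩ | ⟨h, e⟩ | ⟨h, e⟩
        · rw [← sl.1 h]; exact A
        · have n := sl.2 e (by omega)
          have := (H _ a b (card_erase_eq hS tS) n.1 n.corner hba c).2.1
          rw [Finset.erase_right_comm,
            Finset.erase_right_comm (a := loc g π k (S.erase a)) (b := b)] at this
          rw [e]
          exact this _ hh A
        · have := (H _ (loc g π k (S.erase a)) b hD ht.1 cb h.1 c).2.1
          rw [e, Finset.erase_right_comm]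
          exact this _ (h3 e (by omega)) A
      rcases hr.2.eq_or_lt with e | e
      · rw [e]; exact step1
      · exact (H _ _ _ hD' hr.1 ht'.1 e c).2.1 γ h2 step1
    -- If the last element was to the right of `γ`, then so is its restart, by the assumption on
    -- `γ`, and the descent leads further to the right.
    by_cases hz : γ < g (loc g π k (S.erase a))
    · have hrγ : γ < g (restart g π k S a b) := by
        rcases restart_cases (π := π) hg hS hab with ⟨h, e⟩ | ⟨h, e⟩ | ⟨h, e⟩
        · rw [h] at hz; rw [e]; omega
        · rw [e]; exact hz
        · rw [e]; omega
      rcases A with A | A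
      · exact Or.inl (lower A (Or.inr hrγ) fun _ _ => Or.inr hz)
      · exact Or.inr ⟨by omega, A.2⟩
    · have A' : SomeRight g π c k ((S.erase a).erase (loc g π k (S.erase a))) γ := by
        rcases A with A | A
        · exact A
        · exact absurd A.1 hz
      -- The witness is one of the first `k` elements. If the last element has meanwhile passed `γ`,
      -- it is itself a witness, as its position is at least that of the old one.
      by_cases h2 : γ < g (loc g π k (S.erase b))
      · exact Or.inr ⟨h2, val2 c γ A' (by omega)⟩
      · refine Or.inl (lower A' (Or.inl (by omega)) fun e _ => Or.inl ?_)
        rw [e] at grt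
        omega
  -- A witness to the right of `γ` is one to the right of `a`, so only `γ = g a` has to be
  -- considered.
  · have A := A.mono hγ
    rw [someRight_succ] at A
    rcases restart_cases (π := π) hg hS hab with ⟨h, e⟩ | ⟨h, e⟩ | ⟨h, e⟩
    · have hset := sl.1 h
      rw [e] at hset hr
      rw [hset] at A
      -- The last element came from `b`. If it ends at `a`, the others have not moved, and those
      -- above `b` had positions at least `π k` by the validity of the old placement.
      by_cases hta : loc g π k (S.erase b) = a
      · have hk : c ≤ π k := by
          rcases A with A | A
          · obtain ⟨j, hj, h2, h3⟩ := A
            exact h3.trans (loc_valid' hg hD' hj (by rw [can_of_lt hj, hta]; exact h2))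
          · exact A.2
        rw [allAbove_succ]
        refine ⟨?_, fun _ => hk⟩
        rw [hta, ← hset]
        intro j hj h2
        exact hk.trans (val j hj _ rfl (lt_of_eq_of_lt h h2))
      -- The last element did not stay at `a`, so `a` is bad: even if the last element was the given
      -- witness, one of the others is a witness to the right of `a`. The third clause then applies
      -- to the slide from `a` to the following corner of `S.erase b`, which lies below `b`.
      · have hlt : loc g π k (S.erase b) < a := by have := hr.2; omega
        have A' : SomeRight g π c k ((S.erase b).erase a) (g a) := by
          rcases A with A | A
          · exact A
          · have hb := ht'.2.2 a ca hlt
            rw [bad_iff] at hb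
            exact hb.anti (by omega)
        obtain ⟨s, hs⟩ : ∃ s, NextCorner g (S.erase b) a s := by
          obtain ⟨j, hj, h2, -⟩ := A'
          exact exists_nextCorner ca (Finset.mem_of_mem_erase
            (can_mem hg (card_erase_eq hD' ca.1) j hj)) h2
        have hsb : s < b := lt_of_le_of_ne (hab.2.2.2 s (Finset.mem_of_mem_erase hs.2.1) hs.2.2.1)
          (Finset.ne_of_mem_erase hs.2.1)
        have hts : loc g π k (S.erase b) ≤ s :=
          hs.2.2.2 _ ht'.1.1 (ht'.1.2 a ca.1 hlt)
        have B := ((H _ a s hD' ca hs.corner (hs.lt) c).2.2 (g a) le_rfl hs.2.2.2 A').mono hsb.le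
        refine advance_above hg H hD' hs.corner hts B ?_
        intro; omega
    · have htb : loc g π k (S.erase a) ≠ b := by
        intro h'; rw [h'] at h; omega
      have n := sl.2 e htb
      have M := (H _ a b (card_erase_eq hS tS) n.1 n.corner hba c).2.2 (g a) le_rfl n.2.2.2
      rw [Finset.erase_right_comm,
        Finset.erase_right_comm (a := loc g π k (S.erase a)) (b := b)] at M
      rw [e] at hr
      rcases h.2.2 with h2 | h2
      · have g2 : g (loc g π k (S.erase a)) < g a := by
          by_contra hn
          rcases (not_lt.1 hn).eq_or_lt with e' | e'
          · have := hg e'; omega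
          · have := hab.2.2.2 _ tS e'; omega
        have A' : SomeRight g π c k ((S.erase a).erase (loc g π k (S.erase a))) (g a) := by
          rcases A with A | A
          · exact A
          · omega
        exact advance_above hg H hD' hr.1 hr.2 (M A') fun _ => val2 c _ A' g2.le
      · rcases A with A | A
        · exact advance_above hg H hD' hr.1 hr.2 (M A) fun _ => by omega
        -- The last element is the witness and its new place is below `b`, so `loc_valid` for the
        -- new placement bounds every position above `b`.
        · intro j hj h3
          rcases Nat.lt_succ_iff_lt_or_eq.1 hj with hj | rfl
          · exact A.2.trans (loc_valid hg H hD' hj (by omega))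
          · exact A.2
    · have A' : SomeRight g π c k ((S.erase a).erase (loc g π k (S.erase a))) (g a) := by
        rcases A with A | A
        · exact A
        · omega
      have hk : c ≤ π k := val2 c _ A' h.2.2.le
      have M := (H _ (loc g π k (S.erase a)) b hD ht.1 cb h.1 c).2.2 (g a) h.2.2.le
        (fun q hq h' => hab.2.2.2 q (Finset.mem_of_mem_erase hq) h') A'
      rw [Finset.erase_right_comm] at M
      rw [e] at hr
      exact advance_above hg H hD' hr.1 hr.2 M fun _ => hk

theorem levelMono (hg : Function.Injective g) : ∀ k, LevelMono g π k := by
  intro k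
  induction k with
  | zero =>
    intro S a b _ _ _ _ c
    refine ⟨fun h _ _ j hj => by omega, fun γ _ h => ?_, fun γ _ _ h j hj => by omega⟩
    obtain ⟨j, hj, -⟩ := h
    omega
  | succ k ih => exact SlideMono.chain hg fun S a b hS hab => slideMono_succ hg ih hS hab

/-! ### The two properties of the canonical placement -/

/-- In the canonical placement, an element placed up and to the left of another has the larger
position. -/
theorem can_valid (hg : Function.Injective g) : ∀ {k : ℕ} {S : Finset ℕ}, S.card = k →
    ∀ i < k, ∀ j < k, can g π k S j < can g π k S i → g (can g π k S i) < g (can g π k S j) →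
      π j ≤ π i := by
  intro k
  induction k with
  | zero => intro S _ i hi; omega
  | succ k ih =>
    intro S hS i hi j hj h1 h2
    have hl := (loc_spec (π := π) hg hS).1
    rcases Nat.lt_succ_iff_lt_or_eq.1 hi with hi | rfl
    · rcases Nat.lt_succ_iff_lt_or_eq.1 hj with hj | rfl
      · rw [can_of_lt hi, can_of_lt hj] at h1 h2
        exact ih (card_erase_eq hS hl.1) i hi j hj h1 h2
      · rw [can_last] at h1
        exact loc_valid hg (levelMono hg _) hS hi h1
    · rcases Nat.lt_succ_iff_lt_or_eq.1 hj with hj | rfl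
      · rw [can_last] at h2
        exact loc_valid' hg hS hj h2
      · omega

/-- In the canonical placement, no element is below and to the left of an earlier one. -/
theorem can_linear (hg : Function.Injective g) : ∀ {k : ℕ} {S : Finset ℕ}, S.card = k →
    ∀ i < k, ∀ j < i, can g π k S i < can g π k S j → g (can g π k S j) < g (can g π k S i) := by
  intro k
  induction k with
  | zero => intro S _ i hi; omega
  | succ k ih =>
    intro S hS i hi j hj h1
    have hl := (loc_spec (π := π) hg hS).1
    rcases Nat.lt_succ_iff_lt_or_eq.1 hi with hi | rfl
    · rw [can_of_lt hi, can_of_lt (by omega)] at h1 ⊢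
      exact ih (card_erase_eq hS hl.1) i hi j hj h1
    · rw [can_last] at h1 ⊢
      exact hl.2 _ (can_mem hg hS j (by omega)) h1

theorem can_inj (hg : Function.Injective g) : ∀ {k : ℕ} {S : Finset ℕ}, S.card = k →
    ∀ i < k, ∀ j < i, can g π k S i ≠ can g π k S j := by
  intro k
  induction k with
  | zero => intro S _ i hi; omega
  | succ k ih =>
    intro S hS i hi j hj
    have hl := (loc_spec (π := π) hg hS).1
    have hc := card_erase_eq hS hl.1
    rw [can_of_lt (j := j) (by omega)]
    rcases Nat.lt_succ_iff_lt_or_eq.1 hi with hi | rfl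
    · rw [can_of_lt hi]
      exact ih hc i hi j hj
    · rw [can_last]
      exact (Finset.ne_of_mem_erase (can_mem hg hc j hj)).symm

end Canonical

/-! ### Computing the canonical placement by local moves -/

/-- The state of the search: the places of the elements, one frame per level, the current level,
the current hole and the mode. -/
structure Search where
  /-- the places of the elements -/
  pl : ℕ → ℕ
  /-- the place at which the last element of a level restarts -/
  fa : ℕ → ℕ
  /-- the corner to which the hole of a level moves -/
  fb : ℕ → ℕ
  /-- what a level waits for: `0` for the hole, `1` for a better place of its last element -/
  fk : ℕ → ℕ
  /-- the current level -/
  m : ℕ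
  /-- the current hole -/
  h : ℕ
  /-- the mode -/
  md : ℕ

/-- The highest place among the first `m` elements to the right of `h`. -/
def nextPlace (g pl : ℕ → ℕ) (m h : ℕ) : ℕ :=
  ((Finset.range m).filter fun j => g h < g (pl j)).sup pl

/-- The last of the first `m` elements is misplaced. -/
def Misplaced (g π pl : ℕ → ℕ) (m : ℕ) : Prop :=
  ∃ y < m - 1, π (m - 1) < π y ∧ g (pl (m - 1)) < g (pl y)

open Classical in
/-- One step of the search. -/
noncomputable def searchStep (n : ℕ) (g π : ℕ → ℕ) (c : Search) : Search :=
  if n < c.m then c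
  else if c.md = 0 then
    let b := nextPlace g c.pl c.m c.h
    let t := c.pl (c.m - 1)
    let q := t = b ∨ (t < c.h ∧ g t < g c.h)
    { c with
      fa := Function.update c.fa c.m (if q then c.h else t)
      fb := Function.update c.fb c.m b
      fk := Function.update c.fk c.m 0
      h := if q then t else c.h
      md := 1 }
  else if c.md = 1 then
    if c.h = c.fb c.m then
      { c with pl := Function.update c.pl (c.m - 1) (c.fa c.m), md := 2 }
    else { c with m := c.m - 1, md := 0 }
  else
    if Misplaced g π c.pl c.m then
      { c with
        fk := Function.update c.fk c.m 1
        h := c.pl (c.m - 1)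
        m := c.m - 1
        md := 0 }
    else
      { c with
        pl := if c.fk (c.m + 1) = 1 then Function.update c.pl c.m (c.fb c.m) else c.pl
        h := c.fb c.m
        m := c.m + 1
        md := if c.fk (c.m + 1) = 0 then 1 else 2 }

/-- The start of the search. -/
def searchStart : Search := ⟨id, 0, 0, fun _ => 2, 1, 0, 2⟩

/-- A potential that increases with every slide. -/
def potential (k : ℕ) (pl : ℕ → ℕ) : ℕ := ∑ i ∈ Finset.range (k + 1), ∑ j ∈ Finset.range i, pl j

theorem potential_congr {k : ℕ} {p q : ℕ → ℕ} (h : ∀ j < k, p j = q j) :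
    potential k p = potential k q := by
  refine Finset.sum_congr rfl fun i hi => Finset.sum_congr rfl fun j hj => h j ?_
  rw [Finset.mem_range] at hi hj
  omega

theorem potential_succ (k : ℕ) (p : ℕ → ℕ) :
    potential (k + 1) p = potential k p + ∑ j ∈ Finset.range (k + 1), p j :=
  Finset.sum_range_succ _ _

section Search

variable {g π : ℕ → ℕ} {n : ℕ}

/-- The elements fill `S`, so the sum of their heights depends on `S` alone. A slide from `a` to `b`
raises it by `a - b`, which is what makes `potential` grow. -/
theorem sum_can (hg : Function.Injective g) {k : ℕ} {S : Finset ℕ} (hS : S.card = k) :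
    ∑ j ∈ Finset.range k, can g π k S j = ∑ p ∈ S, p := by
  refine Finset.sum_bij (fun j _ => can g π k S j) (fun j hj => can_mem hg hS j (by simpa using hj))
    (fun i hi j hj e => ?_) (fun q hq => ?_) fun _ _ => rfl
  · rw [Finset.mem_range] at hi hj
    rcases lt_trichotomy i j with h | h | h
    · exact absurd e.symm (can_inj hg hS j hj i h)
    · exact h
    · exact absurd e (can_inj hg hS i hi j h)
  · obtain ⟨j, hj, e⟩ := can_surj (π := π) hg hS q hq
    exact ⟨j, by simpa using hj, e⟩

/-- All points other than the hole are occupied; the next corner can therefore be read off from the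
places, and the search need not store the set. -/
theorem nextPlace_eq (hg : Function.Injective g) {k : ℕ} {S : Finset ℕ} {a b : ℕ} {pl : ℕ → ℕ}
    (hS : S.card = k + 1) (hab : NextCorner g S a b)
    (hpl : ∀ j < k, pl j = can g π k (S.erase a) j) : nextPlace g pl k a = b := by
  have hc := card_erase_eq hS hab.1.1
  apply le_antisymm
  · refine Finset.sup_le fun j hj => ?_
    rw [Finset.mem_filter, Finset.mem_range] at hj
    refine hab.2.2.2 _ ?_ hj.2
    rw [hpl j hj.1]
    exact Finset.mem_of_mem_erase (can_mem hg hc j hj.1)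
  · obtain ⟨j, hj, e⟩ := can_surj (π := π) hg hc b
      (Finset.mem_erase.2 ⟨(hab.lt).ne, hab.2.1⟩)
    have : pl j = b := by rw [hpl j hj, e]
    rw [← this]
    refine Finset.le_sup (f := pl) ?_
    rw [Finset.mem_filter, Finset.mem_range, this]
    exact ⟨hj, hab.2.2.1⟩

/-- `c'` differs from `c` only below the level `k`. -/
def SameAbove (k : ℕ) (c c' : Search) : Prop :=
  (∀ j, k ≤ j → c'.pl j = c.pl j) ∧
    ∀ j, k < j → c'.fa j = c.fa j ∧ c'.fb j = c.fb j ∧ c'.fk j = c.fk j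

/-- The search carries out all slides of level `k`. -/
def SearchSlides (n : ℕ) (g π : ℕ → ℕ) (k : ℕ) : Prop :=
  ∀ (S : Finset ℕ) (a b : ℕ) (c : Search), S.card = k + 1 → NextCorner g S a b → k ≤ n →
    c.md = 0 → c.m = k → c.h = a → (∀ j < k, c.pl j = can g π k (S.erase a) j) →
    ∃ i c', (searchStep n g π)^[i] c = c' ∧ c'.md = 2 ∧ c'.m = k ∧ c'.fb k = b ∧
      (∀ j < k, c'.pl j = can g π k (S.erase b) j) ∧ SameAbove k c c' ∧
      i + 2 + 4 * potential k c.pl ≤ 4 * potential k c'.pl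

/-- With the others in their canonical places, the test for a misplaced last element is the test for
a bad corner. -/
theorem not_misplaced (hg : Function.Injective g) {k : ℕ} {S : Finset ℕ} {pl : ℕ → ℕ}
    (hS : S.card = k) (hpl : ∀ j < k, pl j = can g π k S j) : ¬ Misplaced g π pl k := by
  rintro ⟨y, hy, h1, h2⟩
  obtain ⟨k, rfl⟩ : ∃ l, k = l + 1 := ⟨k - 1, by omega⟩
  simp only [Nat.add_sub_cancel] at hy h1 h2
  rw [hpl k (by omega), hpl y (by omega), can_last] at h2
  exact absurd (loc_valid' hg hS hy h2) (by omega)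

/-- A slide of level `k`, followed by the return to level `k + 1`. -/
theorem SearchSlides.return (hg : Function.Injective g) {k : ℕ} (H : SearchSlides n g π k)
    {X : Finset ℕ} {r s : ℕ} {c : Search} (hX : X.card = k + 1) (hrs : NextCorner g X r s)
    (hk : k + 1 ≤ n) (h0 : c.md = 0) (hm : c.m = k) (hh : c.h = r)
    (hpl : ∀ j < k, c.pl j = can g π k (X.erase r) j) :
    ∃ i c', (searchStep n g π)^[i] c = c' ∧ c'.h = s ∧
      c'.md = (if c.fk (k + 1) = 0 then 1 else 2) ∧ c'.m = k + 1 ∧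
      (∀ j < k, c'.pl j = can g π k (X.erase s) j) ∧
      (c'.pl k = if c.fk (k + 1) = 1 then s else c.pl k) ∧
      SameAbove (k + 1) c c' ∧
      c'.fa (k + 1) = c.fa (k + 1) ∧ c'.fb (k + 1) = c.fb (k + 1) ∧
      c'.fk (k + 1) = c.fk (k + 1) ∧
      i + 1 + 4 * potential k c.pl ≤ 4 * potential k c'.pl := by
  obtain ⟨i, c', e, h1, h2, h3, h4, h5, h6⟩ := H X r s c hX hrs (by omega) h0 hm hh hpl
  refine ⟨i + 1, searchStep n g π c', by rw [Function.iterate_succ_apply', e], ?_⟩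
  -- After the slide the whole level is canonical, so the test in mode `2` passes and the search
  -- ascends.
  have hnm : ¬ Misplaced g π c'.pl c'.m := by
    rw [h2]; exact not_misplaced hg (card_erase_eq hX hrs.2.1) h4
  have f := h5.2 (k + 1) (by omega)
  have hstep : searchStep n g π c' = { c' with
        pl := if c'.fk (c'.m + 1) = 1 then Function.update c'.pl c'.m (c'.fb c'.m) else c'.pl
        h := c'.fb c'.m
        m := c'.m + 1
        md := if c'.fk (c'.m + 1) = 0 then 1 else 2 } := by
    unfold searchStep
    rw [if_neg (by omega), if_neg (by omega), if_neg (by omega), if_neg hnm]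
  rw [hstep]
  simp only [h2, h3, f.2.2]
  have hpl' : ∀ j, j ≠ k → (if c.fk (k + 1) = 1 then Function.update c'.pl k s else c'.pl) j
      = c'.pl j := by
    intro j hj
    split_ifs
    · rw [Function.update_of_ne (by omega)]
    · rfl
  refine ⟨trivial, trivial, trivial, fun j hj => ?_, ?_, ⟨fun j hj => ?_, fun j hj => ?_⟩,
    f.1, f.2.1, trivial, ?_⟩
  · exact (hpl' j hj.ne).trans (h4 j hj)
  · split_ifs
    · simp
    · exact h5.1 k le_rfl
  · exact (hpl' j (by omega)).trans (h5.1 j (by omega))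
  · exact h5.2 j (by omega)
  · rw [potential_congr fun j hj => hpl' j hj.ne]; omega

/-- Moving the hole to a later corner, the last element being kept apart. -/
theorem SearchSlides.chain (hg : Function.Injective g) {k : ℕ} (H : SearchSlides n g π k)
    {X : Finset ℕ} (hX : X.card = k + 1) (hk : k + 1 ≤ n) {b : ℕ} (hb : Corner g X b) :
    ∀ (r : ℕ) (c : Search), Corner g X r → b ≤ r → c.md = 1 → c.m = k + 1 → c.h = r →
      c.fb (k + 1) = b → c.fk (k + 1) = 0 →
      (∀ j < k, c.pl j = can g π k (X.erase r) j) →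
      ∃ i c', (searchStep n g π)^[i] c = c' ∧ c'.md = 1 ∧ c'.m = k + 1 ∧ c'.h = b ∧
        c'.fb (k + 1) = b ∧ c'.fa (k + 1) = c.fa (k + 1) ∧
        (∀ j < k, c'.pl j = can g π k (X.erase b) j) ∧ SameAbove (k + 1) c c' ∧
        i + 4 * potential k c.pl ≤ 4 * potential k c'.pl := by
  intro r
  induction r using Nat.strong_induction_on with
  | _ r ih =>
    intro c hr hle h1 hm hh hfb hfk hpl
    rcases hle.eq_or_lt with rfl | hlt
    · exact ⟨0, c, rfl, h1, hm, hh, hfb, rfl, hpl, ⟨fun _ _ => rfl, fun _ _ => ⟨rfl, rfl, rfl⟩⟩,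
        by omega⟩
    obtain ⟨s, hs⟩ := exists_nextCorner hr hb.1 (hb.2 r hr.1 hlt)
    have hbs : b ≤ s := hs.2.2.2 b hb.1 (hb.2 r hr.1 hlt)
    have hstep : searchStep n g π c = { c with m := c.m - 1, md := 0 } := by
      unfold searchStep
      rw [if_neg (by omega), if_neg (by omega), if_pos h1, if_neg (by rw [hm]; omega)]
    obtain ⟨i, c', e, e1, e2, e3, e4, e5, e6, e7, e8, e9, e10⟩ :=
      H.return hg (c := { c with m := c.m - 1, md := 0 }) hX hs hk rfl (by simp [hm]) hh hpl
    simp only [hfk] at e2 e5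
    obtain ⟨i', c'', f, f1, f2, f3, f4, f5, f6, f7, f8⟩ :=
      ih s (hs.lt) c' hs.corner hbs e2 e3 e1 (e8.trans hfb) (e9.trans hfk) e4
    refine ⟨i' + (i + 1), c'', ?_, f1, f2, f3, f4, f5.trans e7, f6,
      ⟨fun j hj => (f7.1 j hj).trans (e6.1 j hj), fun j hj => ?_⟩, ?_⟩
    · rw [Function.iterate_add_apply, Function.iterate_succ_apply, hstep, e, f]
    · obtain ⟨a1, a2, a3⟩ := f7.2 j hj
      obtain ⟨b1, b2, b3⟩ := e6.2 j hj
      exact ⟨a1.trans b1, a2.trans b2, a3.trans b3⟩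
    · have e10 : i + 1 + 4 * potential k c.pl ≤ 4 * potential k c'.pl := e10
      omega

/-- Moving the last element to its canonical place. -/
theorem SearchSlides.settle (hg : Function.Injective g) {k : ℕ} (H : SearchSlides n g π k)
    {X : Finset ℕ} (hX : X.card = k + 1) (hk : k + 1 ≤ n) :
    ∀ (r : ℕ) (c : Search), Corner g X r → loc g π k X ≤ r → c.md = 2 → c.m = k + 1 →
      c.pl k = r → (∀ j < k, c.pl j = can g π k (X.erase r) j) →
      ∃ i c', (searchStep n g π)^[i] c = c' ∧ c'.md = 2 ∧ c'.m = k + 1 ∧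
        c'.fb (k + 1) = c.fb (k + 1) ∧
        (∀ j < k + 1, c'.pl j = can g π (k + 1) X j) ∧ SameAbove (k + 1) c c' ∧
        i + 4 * potential k c.pl ≤ 4 * potential k c'.pl := by
  intro r
  induction r using Nat.strong_induction_on with
  | _ r ih =>
    intro c hr hle h2 hm hplk hpl
    obtain ⟨l1, l2, l3⟩ := loc_spec (π := π) hg hX
    rcases hle.eq_or_lt with e | hlt
    · refine ⟨0, c, rfl, h2, hm, rfl, fun j hj => ?_,
        ⟨fun _ _ => rfl, fun _ _ => ⟨rfl, rfl, rfl⟩⟩, by omega⟩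
      rcases Nat.lt_succ_iff_lt_or_eq.1 hj with hj | rfl
      · rw [can_of_lt hj, hpl j hj, e]
      · rw [can_last, hplk, e]
    obtain ⟨s, hs⟩ := exists_nextCorner hr l1.1 (l1.2 r hr.1 hlt)
    have hbs : loc g π k X ≤ s := hs.2.2.2 _ l1.1 (l1.2 r hr.1 hlt)
    -- A corner strictly above the canonical one is bad, and the witness for this is found among the
    -- current places, since they are canonical for the hole `r`.
    have hmis : Misplaced g π c.pl c.m := by
      obtain ⟨j, hj, a1, a2⟩ := l3 r hr hlt
      refine ⟨j, by omega, ?_⟩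
      rw [hm, Nat.add_sub_cancel, hplk, hpl j hj]
      exact ⟨a2, a1⟩
    have hstep : searchStep n g π c = { c with
        fk := Function.update c.fk c.m 1
        h := c.pl (c.m - 1)
        m := c.m - 1
        md := 0 } := by
      unfold searchStep
      rw [if_neg (by omega), if_neg (by omega), if_neg (by omega), if_pos hmis]
    obtain ⟨i, c', e, e1, e2, e3, e4, e5, e6, e7, e8, e9, e10⟩ :=
      H.return hg (c := { c with
        fk := Function.update c.fk c.m 1
        h := c.pl (c.m - 1)
        m := c.m - 1
        md := 0 }) hX hs hk rfl (by simp [hm]) (by simp [hm, hplk]) hpl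
    have hfk1 : Function.update c.fk c.m 1 (k + 1) = 1 := by simp [hm]
    simp only [hfk1] at e2 e5
    obtain ⟨i', c'', f, f1, f2, f3, f4, f5, f6⟩ :=
      ih s (hs.lt) c' hs.corner hbs e2 e3 e5 e4
    refine ⟨i' + (i + 1), c'', ?_, f1, f2, f3.trans e8, f4,
      ⟨fun j hj => (f5.1 j hj).trans (e6.1 j hj), fun j hj => ?_⟩, ?_⟩
    · rw [Function.iterate_add_apply, Function.iterate_succ_apply, hstep, e, f]
    · obtain ⟨a1, a2, a3⟩ := f5.2 j hj
      obtain ⟨b1, b2, b3⟩ := e6.2 j hj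
      refine ⟨a1.trans b1, a2.trans b2, a3.trans (b3.trans ?_)⟩
      simp only
      rw [Function.update_of_ne (by omega)]
    · have e10 : i + 1 + 4 * potential k c.pl ≤ 4 * potential k c'.pl := e10
      omega

/-- The search imitates the proof of `slideMono_succ`: it slides the lower level until the hole
reaches `b`, puts the last element at its restart, and lets it descend as long as it is misplaced.
At level `0` there is nothing to do, as one point has no two corners. -/
theorem searchSlides (hg : Function.Injective g) : ∀ k, SearchSlides n g π k := by
  intro k
  induction k with
  | zero =>
    intro S a b c hS hab
    have := hab.lt
    have := Finset.card_le_one.1 hS.le a hab.1.1 b hab.2.1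
    omega
  | succ k H =>
    intro S a b c hS hab hk h0 hm hh hpl
    have hD : (S.erase a).card = k + 1 := card_erase_eq hS hab.1.1
    have hD' : (S.erase b).card = k + 1 := card_erase_eq hS hab.2.1
    have hr := restart_spec hg (levelMono (π := π) hg k) hS hab
    have ht := loc_spec (π := π) hg hD
    have hba := hab.lt
    have hnext : nextPlace g c.pl c.m c.h = b := by
      rw [hm, hh]; exact nextPlace_eq hg hS hab hpl
    have hplk : c.pl (c.m - 1) = loc g π k (S.erase a) := by
      rw [hm, Nat.add_sub_cancel, hpl k (by omega), can_last]
    have hpl' : ∀ j < k, c.pl j = can g π k ((S.erase a).erase (loc g π k (S.erase a))) j :=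
      fun j hj => by rw [hpl j (by omega), can_of_lt hj]
    set t := loc g π k (S.erase a) with htdef
    have htS := Finset.mem_of_mem_erase ht.1.1
    classical
    obtain ⟨h', hh'⟩ : ∃ h', h' = if t = b ∨ (t < a ∧ g t < g a) then t else a := ⟨_, rfl⟩
    have hstep : searchStep n g π c = { c with
        fa := Function.update c.fa c.m (restart g π k S a b)
        fb := Function.update c.fb c.m b
        fk := Function.update c.fk c.m 0
        h := h'
        md := 1 } := by
      unfold searchStep
      rw [if_neg (by omega), if_pos h0]
      rw [hh] at hnext
      simp only [hh, hnext, hplk, hh', restart]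
      rw [← htdef]
    set c1 : Search := { c with
        fa := Function.update c.fa c.m (restart g π k S a b)
        fb := Function.update c.fb c.m b
        fk := Function.update c.fk c.m 0
        h := h'
        md := 1 } with hc1
    -- `X` is the set inside which the first `k` elements move: `S.erase t` if the last element
    -- waits apart at `t`, and otherwise `S.erase a`, with the old place `t` as the hole. The last
    -- equation says that, once the hole of `X` is at `b`, the others occupy what the last element
    -- leaves free at its restart.
    obtain ⟨X, hX, X1, X2, X3, X4, X5⟩ : ∃ X : Finset ℕ, X.card = k + 1 ∧ Corner g X h' ∧
        Corner g X b ∧ b ≤ h' ∧ X.erase h' = (S.erase a).erase t ∧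
        X.erase b = (S.erase b).erase (restart g π k S a b) := by
      rcases restart_cases (π := π) hg hS hab with ⟨h, e⟩ | ⟨h, e⟩ | ⟨h, e⟩
      · rw [← htdef] at h
        rw [if_pos (Or.inl h)] at hh'
        refine ⟨S.erase a, hD, ?_, ?_, by omega, by rw [hh'], by rw [e, Finset.erase_right_comm]⟩
        · rw [hh']; exact ht.1
        · rw [← h]; exact ht.1
      · rw [← htdef] at h e
        rw [if_neg] at hh'
        · have c2 := (h.1.transfer hg hab h.2.2).2
          rw [hh', e]
          exact ⟨S.erase t, card_erase_eq hS htS, c2.1, c2.corner, hba.le,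
            Finset.erase_right_comm, Finset.erase_right_comm⟩
        · rintro (h' | ⟨h', h''⟩)
          · rw [h'] at h; omega
          · have := h.2.2; have := hab.2.2.1; omega
      · rw [← htdef] at h
        rw [if_pos (Or.inr h.2)] at hh'
        refine ⟨S.erase a, hD, ?_, ?_, by omega, by rw [hh'], by rw [e, Finset.erase_right_comm]⟩
        · rw [hh']; exact ht.1
        · exact hab.corner.mono (Finset.erase_subset _ _) (Finset.mem_erase.2 ⟨by omega, hab.2.1⟩)
    obtain ⟨i, c2, e, e1, e2, e3, e4, e5, e6, e7, e8⟩ := H.chain hg hX hk X2 h' c1 X1 X3 rfl hm rfl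
      (by simp [hc1, hm]) (by simp [hc1, hm]) (by rw [X4]; exact hpl')
    have hstep2 : searchStep n g π c2 =
        { c2 with pl := Function.update c2.pl (c2.m - 1) (c2.fa c2.m), md := 2 } := by
      unfold searchStep
      rw [if_neg (by omega), if_neg (by omega), if_pos e1, if_pos (by rw [e2, e4, e3])]
    have hfa : c2.fa c2.m = restart g π k S a b := by rw [e2, e5]; simp [hc1, hm]
    set c3 : Search :=
      { c2 with pl := Function.update c2.pl (c2.m - 1) (c2.fa c2.m), md := 2 } with hc3
    have c3pl : ∀ j < k, c3.pl j = c2.pl j := fun j hj => by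
      simp only [hc3]; rw [Function.update_of_ne (by omega)]
    obtain ⟨i', c4, f, f1, f2, f3, f4, f5, f6⟩ := H.settle hg hD' hk (restart g π k S a b) c3
      hr.1 hr.2 rfl e2 (by simp [hc3, e2, ← hfa]) (fun j hj => by
        rw [c3pl j hj, e6 j hj, X5])
    refine ⟨i' + 1 + (i + 1), c4, ?_, f1, f2, f3.trans e4, f4, ⟨fun j hj => ?_, fun j hj => ?_⟩, ?_⟩
    · rw [Function.iterate_add_apply, Function.iterate_succ_apply _ i, hstep, e,
        Function.iterate_succ_apply, hstep2, f]
    · rw [f5.1 j hj]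
      simp only [hc3]
      rw [Function.update_of_ne (by omega), e7.1 j hj]
    · obtain ⟨a1, a2, a3⟩ := f5.2 j hj
      obtain ⟨b1, b2, b3⟩ := e7.2 j hj
      refine ⟨a1.trans (b1.trans ?_), a2.trans (b2.trans ?_), a3.trans (b3.trans ?_)⟩
      all_goals
        simp only [hc1]
        rw [Function.update_of_ne (by omega)]
    -- The sum belonging to this level rises by `a - b ≥ 1`, which is worth four steps. Two pay for
    -- opening the slide and for installing the restart. Two are kept in reserve for the level
    -- above, which needs one step to call the slide and one to return from it.
    · have s1 : ∑ j ∈ Finset.range (k + 1), c.pl j = ∑ p ∈ S.erase a, p := by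
        rw [← sum_can (π := π) hg hD]
        exact Finset.sum_congr rfl fun j hj => hpl j (by simpa using hj)
      have s2 : ∑ j ∈ Finset.range (k + 1), c4.pl j = ∑ p ∈ S.erase b, p := by
        rw [← sum_can (π := π) hg hD']
        exact Finset.sum_congr rfl fun j hj => f4 j (by simpa using hj)
      have s3 := Finset.add_sum_erase S (fun p => p) hab.1.1
      have s4 := Finset.add_sum_erase S (fun p => p) hab.2.1
      rw [potential_succ, potential_succ, s1, s2]
      rw [potential_congr c3pl] at f6
      have e8 : i + 4 * potential k c.pl ≤ 4 * potential k c2.pl := e8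
      omega

theorem potential_le {k : ℕ} {pl : ℕ → ℕ} {B : ℕ} (h : ∀ j < k, pl j ≤ B) :
    potential k pl ≤ (k + 1) * (k * B) := by
  calc potential k pl ≤ ∑ i ∈ Finset.range (k + 1), k * B := by
        refine Finset.sum_le_sum fun i hi => ?_
        rw [Finset.mem_range] at hi
        calc ∑ j ∈ Finset.range i, pl j ≤ ∑ j ∈ Finset.range i, B := by
              refine Finset.sum_le_sum fun j hj => h j ?_
              rw [Finset.mem_range] at hj; omega
          _ = i * B := by simp
          _ ≤ k * B := Nat.mul_le_mul_right _ (by omega)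
    _ = _ := by simp

/-- A new element enters at `k`, the highest point of `range (k + 1)` and hence a corner not below
its canonical place, while the others are canonical on `range k`; it only has to settle. The value
`2` of `fk` marks levels that wait for nothing, so that the search proceeds to the next element.
Each element costs at most four times the final potential, plus one step. -/
theorem search_reaches (hg : Function.Injective g) (k : ℕ) (hk : k ≤ n) :
    ∃ i c, (searchStep n g π)^[i] searchStart = c ∧ c.md = 2 ∧ c.m = k + 1 ∧
      (∀ j < k, c.pl j = can g π k (Finset.range k) j) ∧ (∀ j ≥ k, c.pl j = j) ∧
      (∀ j > k + 1, c.fk j = 2) ∧ i ≤ k * (4 * ((n + 1) * (n * n)) + 1) := by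
  induction k with
  | zero =>
    refine ⟨0, searchStart, rfl, rfl, rfl, fun j hj => by omega, fun j _ => rfl, fun _ _ => rfl,
      by omega⟩
  | succ k ih =>
    obtain ⟨i, c, e, h1, h2, h3, h4, h5, h6⟩ := ih (by omega)
    have hX : (Finset.range (k + 1)).card = k + 1 := by simp
    have hc : Corner g (Finset.range (k + 1)) k :=
      ⟨by simp, fun q hq h => by rw [Finset.mem_range] at hq; omega⟩
    have hl : loc g π k (Finset.range (k + 1)) ∈ Finset.range (k + 1) :=
      (loc_spec (π := π) hg hX).1.1
    rw [Finset.mem_range] at hl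
    have her : (Finset.range (k + 1)).erase k = Finset.range k := by
      rw [Finset.range_add_one, Finset.erase_insert (by simp)]
    obtain ⟨i', c', f, f1, f2, f3, f4, f5, f6⟩ :=
      (searchSlides (π := π) hg k).settle hg hX hk k c hc
      (by omega) h1 h2 (h4 k le_rfl) (by rw [her]; exact h3)
    have hnm : ¬ Misplaced g π c'.pl c'.m := by
      rw [f2]; exact not_misplaced hg hX f4
    have hfk : c'.fk (c'.m + 1) = 2 := by
      rw [f2, (f5.2 (k + 1 + 1) (by omega)).2.2]; exact h5 _ (by omega)
    have hstep : searchStep n g π c' = { c' with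
        h := c'.fb c'.m
        m := c'.m + 1
        md := 2 } := by
      unfold searchStep
      rw [if_neg (by omega), if_neg (by omega), if_neg (by omega), if_neg hnm, hfk]
      rfl
    refine ⟨1 + (i' + i), _, rfl, ?_⟩
    rw [Function.iterate_add_apply, Function.iterate_add_apply, e, f, Function.iterate_one, hstep]
    refine ⟨rfl, by simp [f2], f4, fun j hj => ?_, fun j hj => ?_, ?_⟩
    · exact (f5.1 j hj).trans (h4 j (by omega))
    · exact (f5.2 j (by omega)).2.2.trans (h5 j (by omega))
    · have hb : potential k c'.pl ≤ (k + 1) * (k * n) := potential_le fun j hj => by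
        rw [f4 j (by omega)]
        have := can_mem (π := π) hg hX j (by omega)
        rw [Finset.mem_range] at this
        omega
      have hb' : (k + 1) * (k * n) ≤ (n + 1) * (n * n) :=
        Nat.mul_le_mul (by omega) (Nat.mul_le_mul_right _ (by omega))
      rw [Nat.succ_mul]
      omega

theorem searchStep_done {c : Search} (h : n < c.m) : searchStep n g π c = c := by
  unfold searchStep; rw [if_pos h]

/-- The search stands still once the level exceeds `n`, so it may be run for any sufficiently large
number of steps that is fixed in advance. -/
theorem search_result (hg : Function.Injective g) {i : ℕ}
    (hi : n * (4 * ((n + 1) * (n * n)) + 1) ≤ i) :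
    ∀ j < n, ((searchStep n g π)^[i] searchStart).pl j = can g π n (Finset.range n) j := by
  obtain ⟨i', c, e, h1, h2, h3, h4, h5, h6⟩ := search_reaches (π := π) hg n le_rfl
  obtain ⟨d, rfl⟩ := Nat.exists_eq_add_of_le (h6.trans hi)
  rw [add_comm, Function.iterate_add_apply, e,
    Function.iterate_fixed (searchStep_done (by omega))]
  exact h3

end Search

/-! ### Structured programs on stacks -/

/-- Structured programs working on a family of stacks. -/
inductive StackProg {K : Type} (Γ : K → Type) : Type
  | skip : StackProg Γ
  | push (k : K) (a : Γ k) : StackProg Γ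
  | seq (c d : StackProg Γ) : StackProg Γ
  | case (k : K) (c : Option (Γ k) → StackProg Γ) : StackProg Γ
  | loop (k : K) (p : Option (Γ k) → Bool) (c : Option (Γ k) → StackProg Γ) : StackProg Γ

namespace StackProg

open Turing Function

variable {K : Type} [DecidableEq K] {Γ : K → Type}

/-- The program `c` transforms the stacks `S` into `S'` in time `t`. -/
inductive Run : StackProg Γ → (∀ k, List (Γ k)) → (∀ k, List (Γ k)) → ℕ → Prop
  | skip (S) : Run skip S S 0
  | push (k a S) : Run (push k a) S (update S k (a :: S k)) 0
  | seq {c d S S' S'' t t'} : Run c S S' t → Run d S' S'' t' → Run (seq c d) S S'' (t + t')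
  | case {k c S S' t} : Run (c (S k).head?) (update S k (S k).tail) S' t →
      Run (case k c) S S' (t + 1)
  | loop_done {k p c S} : p (S k).head? = false →
      Run (loop k p c) S (update S k (S k).tail) 1
  | loop_go {k p c S S' S'' t t'} : p (S k).head? = true →
      Run (c (S k).head?) (update S k (S k).tail) S' t → Run (loop k p c) S' S'' t' →
      Run (loop k p c) S S'' (t + 2 + t')

/-- The labels of the machine of a program. -/
def Lab : StackProg Γ → Type
  | skip => Empty
  | push _ _ => Empty
  | seq c d => Lab c ⊕ Lab d
  | case k c => Σ o : Option (Γ k), Option (Lab (c o))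
  | loop k _ c => Option (Σ o : Option (Γ k), Option (Lab (c o)))

/-- The machine of a program has finitely many labels. -/
@[reducible]
noncomputable def labFintype [∀ k, Fintype (Γ k)] : (c : StackProg Γ) → Fintype (Lab c)
  | skip => inferInstanceAs (Fintype Empty)
  | push _ _ => inferInstanceAs (Fintype Empty)
  | seq c d => @instFintypeSum _ _ (labFintype c) (labFintype d)
  | case k c =>
    haveI (o : Option (Γ k)) : Fintype (Lab (c o)) := labFintype (c o)
    inferInstanceAs (Fintype (Σ o : Option (Γ k), Option (Lab (c o))))
  | loop k _ c =>
    haveI (o : Option (Γ k)) : Fintype (Lab (c o)) := labFintype (c o)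
    inferInstanceAs (Fintype (Option (Σ o : Option (Γ k), Option (Lab (c o)))))

/-- The statement that starts a program and goes on with `q`. -/
def start {Λ : Type} : (c : StackProg Γ) → (Lab c → Λ) →
    TM2.Stmt Γ Λ (∀ k, Option (Γ k)) → TM2.Stmt Γ Λ (∀ k, Option (Γ k))
  | skip, _, q => q
  | push k a, _, q => TM2.Stmt.push k (fun _ => a) q
  | seq c d, e, q => start c (fun l => e (Sum.inl l)) (start d (fun l => e (Sum.inr l)) q)
  | case k _, e, _ => TM2.Stmt.pop k (fun v o => update v k o)
      (TM2.Stmt.goto fun v => e ⟨v k, none⟩)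
  | loop _ _ _, e, _ => TM2.Stmt.goto fun _ => e none

/-- The statements at the labels of a program. -/
def table {Λ : Type} : (c : StackProg Γ) → (Lab c → Λ) →
    TM2.Stmt Γ Λ (∀ k, Option (Γ k)) → Lab c → TM2.Stmt Γ Λ (∀ k, Option (Γ k))
  | skip, _, _ => fun l => nomatch l
  | push _ _, _, _ => fun l => nomatch l
  | seq c d, e, q => fun l => match l with
    | Sum.inl l => table c (fun l => e (Sum.inl l)) (start d (fun l => e (Sum.inr l)) q) l
    | Sum.inr l => table d (fun l => e (Sum.inr l)) q l
  | case _ c, e, q => fun l => match l with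
    | ⟨o, none⟩ => start (c o) (fun l => e ⟨o, some l⟩) q
    | ⟨o, some l⟩ => table (c o) (fun l => e ⟨o, some l⟩) q l
  | loop k p c, e, q => fun l => match l with
    | none => TM2.Stmt.pop k (fun v o => update v k o)
        (TM2.Stmt.branch (fun v => p (v k)) (TM2.Stmt.goto fun v => e (some ⟨v k, none⟩)) q)
    | some ⟨o, none⟩ => start (c o) (fun l => e (some ⟨o, some l⟩)) (TM2.Stmt.goto fun _ => e none)
    | some ⟨o, some l⟩ =>
        table (c o) (fun l => e (some ⟨o, some l⟩)) (TM2.Stmt.goto fun _ => e none) l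

section Equations

variable {Λ : Type} {k : K} {p : Option (Γ k) → Bool} {c : Option (Γ k) → StackProg Γ}
  {q : TM2.Stmt Γ Λ (∀ k, Option (Γ k))} {o : Option (Γ k)} {l : Lab (c o)}

theorem table_case_none {e : Lab (case k c) → Λ} :
    table (case k c) e q (⟨o, none⟩ : Σ o : Option (Γ k), Option (Lab (c o))) =
      start (c o) (fun l => e ⟨o, some l⟩) q := by
  rw [table]

theorem table_case_some {e : Lab (case k c) → Λ} :
    table (case k c) e q (⟨o, some l⟩ : Σ o : Option (Γ k), Option (Lab (c o))) =
      table (c o) (fun l => e ⟨o, some l⟩) q l := by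
  rw [table]

theorem table_loop_none {e : Lab (loop k p c) → Λ} :
    table (loop k p c) e q (none : Option (Σ o : Option (Γ k), Option (Lab (c o)))) =
      TM2.Stmt.pop k (fun v o => update v k o)
        (TM2.Stmt.branch (fun v => p (v k)) (TM2.Stmt.goto fun v => e (some ⟨v k, none⟩)) q) := by
  rw [table]

theorem table_loop_some_none {e : Lab (loop k p c) → Λ} :
    table (loop k p c) e q (some ⟨o, none⟩ : Option (Σ o : Option (Γ k), Option (Lab (c o)))) =
      start (c o) (fun l => e (some ⟨o, some l⟩)) (TM2.Stmt.goto fun _ => e none) := by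
  rw [table]

theorem table_loop_some_some {e : Lab (loop k p c) → Λ} :
    table (loop k p c) e q (some ⟨o, some l⟩ : Option (Σ o : Option (Γ k), Option (Lab (c o)))) =
      table (c o) (fun l => e (some ⟨o, some l⟩)) (TM2.Stmt.goto fun _ => e none) l := by
  rw [table]

end Equations

/-- The continuation `q` is arbitrary so that programs can be composed. A step of the machine runs
up to the next jump: pushes are free, a `case` costs one jump, and a round of a `loop` costs two
besides its body. The local memory only carries the letters just popped, so its final value `v'`
does not matter. -/
theorem Run.simulate {Λ : Type} {M : Λ → TM2.Stmt Γ Λ (∀ k, Option (Γ k))} {c : StackProg Γ}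
    {S S' : ∀ k, List (Γ k)} {t : ℕ} (h : Run c S S' t) :
    ∀ (e : Lab c → Λ) (q : TM2.Stmt Γ Λ (∀ k, Option (Γ k))), (∀ l, M (e l) = table c e q l) →
      ∀ v, ∃ v', (flip bind (TM2.step M))^[t] (some (TM2.stepAux (start c e q) v S)) =
        some (TM2.stepAux q v' S') := by
  induction h with
  | skip S => intro e q _ v; exact ⟨v, rfl⟩
  | push k a S => intro e q _ v; exact ⟨v, rfl⟩
  | @seq c d S S' S'' t t' _ _ ih1 ih2 =>
    intro e q hM v
    obtain ⟨v1, h1⟩ := ih1 (fun l => e (Sum.inl l)) (start d (fun l => e (Sum.inr l)) q)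
      (fun l => hM (Sum.inl l)) v
    obtain ⟨v2, h2⟩ := ih2 (fun l => e (Sum.inr l)) q (fun l => hM (Sum.inr l)) v1
    refine ⟨v2, ?_⟩
    rw [add_comm, iterate_add_apply]
    simp only [start]
    rw [h1, h2]
  | @case k c S S' t _ ih =>
    intro e q hM v
    have h0 : ∀ o, M (e ⟨o, none⟩) = start (c o) (fun l => e ⟨o, some l⟩) q :=
      fun o => (hM _).trans table_case_none
    obtain ⟨v1, h1⟩ := ih (fun l => e ⟨_, some l⟩) q (fun l => (hM _).trans table_case_some)
      (update v k (S k).head?)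
    refine ⟨v1, ?_⟩
    rw [iterate_succ_apply, ← h1]
    refine congrArg _ (congrArg some ?_)
    have h2 : update v k (S k).head? k = (S k).head? := update_self ..
    have h3 := h0 (update v k (S k).head? k)
    rw [h2] at h3
    rw [← h3]
    change TM2.stepAux (M (e ⟨update v k (S k).head? k, none⟩)) _ _ = _
    rw [h2]
  | @loop_done k p c S hp =>
    intro e q hM v
    refine ⟨update v k (S k).head?, ?_⟩
    change some (TM2.stepAux (M (e none)) v S) = _
    rw [(hM _).trans table_loop_none]
    simp [TM2.stepAux, hp]
  | @loop_go k p c S S' S'' t t' hp _ _ ih1 ih2 =>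
    intro e q hM v
    have h0 : ∀ o, M (e (some ⟨o, none⟩)) = start (c o) (fun l => e (some ⟨o, some l⟩))
        (TM2.Stmt.goto fun _ => e none) := fun o => (hM _).trans table_loop_some_none
    obtain ⟨v1, h1⟩ := ih1 (fun l => e (some ⟨_, some l⟩)) (TM2.Stmt.goto fun _ => e none)
      (fun l => (hM _).trans table_loop_some_some) (update v k (S k).head?)
    obtain ⟨v2, h2⟩ := ih2 e q hM v1
    refine ⟨v2, ?_⟩
    rw [add_comm, iterate_add_apply, iterate_add_apply, ← h2]
    refine congrArg _ ?_
    refine Eq.trans (congrArg _ ?_) h1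
    have h3 := h0 (update v k (S k).head? k)
    have h4 : update v k (S k).head? k = (S k).head? := update_self ..
    rw [h4] at h3
    rw [← h3]
    change some (TM2.stepAux (M (e none)) v S) >>= TM2.step M = _
    rw [(hM _).trans table_loop_none]
    simp only [TM2.stepAux, h4, hp, cond_true]
    change some (TM2.stepAux (M (e (some ⟨update v k (S k).head? k, none⟩))) _ _) = _
    rw [h4]

theorem initial_stacks (kin k : K) (s : List (Γ kin)) :
    (dite (k = kin) (fun h => (by rw [h]; exact s : List (Γ k))) fun _ => []) =
      update (fun _ => []) kin s k := by
  by_cases h : k = kin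
  · subst h
    simp
  · simp [h]

/-- The machine of a program. -/
noncomputable def machine [Fintype K] [∀ k, Fintype (Γ k)] (c : StackProg Γ) (kin kout : K) :
    FinTM2 where
  K := K
  k₀ := kin
  k₁ := kout
  Γ := Γ
  Λ := Option (Lab c)
  main := none
  ΛFin := @instFintypeOption _ (labFintype c)
  σ := ∀ k, Option (Γ k)
  initialState := fun _ => none
  m := fun l => match l with
    | none => start c some (TM2.Stmt.load (fun _ _ => none) TM2.Stmt.halt)
    | some l => table c some (TM2.Stmt.load (fun _ _ => none) TM2.Stmt.halt) l

/-- The extra step leads from the initial label into the program. The final `load` resets the local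
memory, because the prescribed halting configuration has the initial one. -/
theorem polyTime_of_run [Fintype K] [∀ k, Fintype (Γ k)] (c : StackProg Γ) (kin kout : K)
    {α β αΓ βΓ : Type} {ea : α → List αΓ} {eb : β → List βΓ} {f : α → β}
    (hin : Γ kin ≃ αΓ) (hout : Γ kout ≃ βΓ) (p : Polynomial ℕ)
    (h : ∀ a, ∃ t ≤ p.eval (ea a).length,
      Run c (update (fun _ => []) kin ((ea a).map hin.symm))
        (update (fun _ => []) kout ((eb (f a)).map hout.symm)) t) :
    Nonempty (TM2ComputableInPolyTime ea eb f) := by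
  refine ⟨{ tm := machine c kin kout, inputAlphabet := hin, outputAlphabet := hout,
            time := p + 1, outputsFun := fun a => ?_ }⟩
  choose t ht hr using h
  refine ⟨⟨t a + 1, ?_⟩, by simpa using ht a⟩
  have e1 : initList (machine c kin kout) ((ea a).map hin.symm) =
      ⟨some none, fun _ => none, update (fun _ => []) kin ((ea a).map hin.symm)⟩ := by
    unfold initList
    congr 1
    funext k
    exact initial_stacks kin k _
  have e2 : haltList (machine c kin kout) ((eb (f a)).map hout.symm) =
      ⟨none, fun _ => none, update (fun _ => []) kout ((eb (f a)).map hout.symm)⟩ := by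
    unfold haltList
    congr 1
    funext k
    exact initial_stacks kout k _
  obtain ⟨v', hv⟩ := (hr a).simulate (M := (machine c kin kout).m) some
    (TM2.Stmt.load (fun _ _ => none) TM2.Stmt.halt) (fun l => rfl) fun _ => none
  have e3 : (flip bind (machine c kin kout).step)^[t a + 1]
      (some (initList (machine c kin kout) ((ea a).map hin.symm))) =
      some (haltList (machine c kin kout) ((eb (f a)).map hout.symm)) := by
    rw [e1, e2, iterate_succ_apply]
    exact hv
  exact e3

end StackProg

namespace StackProg

open Function

/-! ### Binary stacks beside an input stack -/

/-- The alphabets: `A` on the input stack, binary on all others. -/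
@[reducible]
def alphabet (A X : Type) : Option X → Type
  | none => A
  | some _ => Bool

instance {A X : Type} [Fintype A] : ∀ k, Fintype (alphabet A X k)
  | none => inferInstanceAs (Fintype A)
  | some _ => inferInstanceAs (Fintype Bool)

variable {A X : Type} [DecidableEq X]

/-- The contents of the stacks. -/
def conts (w : List A) (B : X → List Bool) : ∀ k, List (alphabet A X k)
  | none => w
  | some x => B x

theorem update_conts_some (w : List A) (B : X → List Bool) (x : X) (l : List Bool) :
    update (conts w B) (some x) l = conts w (update B x l) := by
  funext k
  cases k with
  | none => simp [conts]
  | some y =>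
    by_cases h : y = x
    · subst h; simp [conts]
    · simp [conts, h]

theorem update_conts_none (w w' : List A) (B : X → List Bool) :
    update (conts w B) none w' = conts w' B := by
  funext k
  cases k with
  | none => simp [conts]
  | some y => simp [conts]

/-- The program `c` changes the binary stacks from `B` to `B'` in time at most `T`. -/
def Ex (c : StackProg (alphabet A X)) (B B' : X → List Bool) (T : ℕ) : Prop :=
  ∀ w, ∃ t ≤ T, Run c (conts w B) (conts w B') t

/-- Push on a binary stack. -/
def pushB (x : X) (b : Bool) : StackProg (alphabet A X) := push (some x) b

/-- Pop from a binary stack and branch. -/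
def caseB (x : X) (c : Option Bool → StackProg (alphabet A X)) : StackProg (alphabet A X) :=
  case (some x) c

/-- Repeat as long as `true` is popped from a binary stack. -/
def loopT (x : X) (c : StackProg (alphabet A X)) : StackProg (alphabet A X) :=
  loop (some x) (fun o => decide (o = some true)) fun _ => c

/-- Empty a binary stack onto another one. -/
def pour (x y : X) : StackProg (alphabet A X) :=
  loop (some x) (fun o : Option Bool => o.isSome) fun o => match o with
    | some b => pushB y b
    | none => skip

variable {c d : StackProg (alphabet A X)} {B B' B'' : X → List Bool} {T T' : ℕ} {x y : X}

theorem Ex.mono (h : Ex c B B' T) (hT : T ≤ T') : Ex c B B' T' := fun w => by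
  obtain ⟨t, ht, hr⟩ := h w
  exact ⟨t, ht.trans hT, hr⟩

theorem Ex.skip : Ex (skip : StackProg (alphabet A X)) B B 0 := fun _ => ⟨0, le_rfl, Run.skip _⟩

theorem Ex.push (x : X) (b : Bool) :
    Ex (pushB x b : StackProg (alphabet A X)) B (update B x (b :: B x)) 0 := fun w => by
  refine ⟨0, le_rfl, ?_⟩
  rw [← update_conts_some]
  exact Run.push (Γ := alphabet A X) (some x) b (conts w B)

theorem Ex.seq (h : Ex c B B' T) (h' : Ex d B' B'' T') : Ex (seq c d) B B'' (T + T') := fun w => by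
  obtain ⟨t, ht, hr⟩ := h w
  obtain ⟨t', ht', hr'⟩ := h' w
  exact ⟨t + t', by omega, hr.seq hr'⟩

theorem Ex.case {c : Option Bool → StackProg (alphabet A X)}
    (h : Ex (c (B x).head?) (update B x (B x).tail) B' T) : Ex (caseB x c) B B' (T + 1) :=
  fun w => by
    obtain ⟨t, ht, hr⟩ := h w
    rw [← update_conts_some] at hr
    exact ⟨t + 1, by omega, Run.case (Γ := alphabet A X) (k := some x) hr⟩

theorem Ex.loop_done (h : (B x).head? ≠ some true) :
    Ex (loopT x c) B (update B x (B x).tail) 1 := fun w => by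
  refine ⟨1, le_rfl, ?_⟩
  rw [← update_conts_some]
  exact Run.loop_done (Γ := alphabet A X) (k := some x) (S := conts w B) (decide_eq_false h)

theorem Ex.loop_go {s : List Bool} (h : B x = true :: s) (h1 : Ex c (update B x s) B' T)
    (h2 : Ex (loopT x c) B' B'' T') : Ex (loopT x c) B B'' (T + 2 + T') := fun w => by
  obtain ⟨t, ht, hr⟩ := h1 w
  obtain ⟨t', ht', hr'⟩ := h2 w
  rw [← update_conts_some] at hr
  have e : s = (conts w B (some x)).tail := by simp [conts, h]
  rw [e] at hr
  refine ⟨t + 2 + t', by omega, Run.loop_go (Γ := alphabet A X) (k := some x) ?_ hr hr'⟩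
  simp [conts, h]

theorem Ex.pour (hxy : x ≠ y) : Ex (pour x y : StackProg (alphabet A X)) B
    (update (update B x []) y ((B x).reverse ++ B y)) (2 * (B x).length + 1) := fun w => by
  induction hs : B x generalizing B with
  | nil =>
    refine ⟨1, by simp, ?_⟩
    have e : update (update B x []) y (([] : List Bool).reverse ++ B y) = update B x [] := by
      simp only [List.reverse_nil, List.nil_append]
      funext z
      by_cases hz : z = y
      · subst hz; simp [hxy.symm]
      · simp [hz]
    rw [e, ← update_conts_some]
    have := Run.loop_done (Γ := alphabet A X) (k := some x) (S := conts w B)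
      (p := fun o : Option Bool => o.isSome) (c := fun o => match o with
        | some b => pushB y b
        | none => StackProg.skip) (by simp [conts, hs])
    have h2 : (conts w B (some x)).tail = [] := by simp [conts, hs]
    rw [h2] at this
    exact this
  | cons b s ih =>
    have h1 : update (update B x s) y (b :: B y) x = s := by simp [hxy]
    obtain ⟨t, ht, hr⟩ := ih h1
    refine ⟨0 + 2 + t, by simp at ht ⊢; omega, ?_⟩
    have e : update (update (update (update B x s) y (b :: B y)) x []) y
        (s.reverse ++ update (update B x s) y (b :: B y) y) =
        update (update B x []) y ((b :: s).reverse ++ B y) := by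
      funext z
      by_cases hz : z = y
      · subst hz; simp
      · by_cases hz' : z = x
        · subst hz'; simp [hz]
        · simp [hz, hz']
    rw [e] at hr
    refine Run.loop_go (Γ := alphabet A X) (k := some x) (S := conts w B)
      (S' := conts w (update (update B x s) y (b :: B y))) (by simp [conts, hs]) ?_ hr
    have h2 : (conts w B (some x)).head? = some b := by simp [conts, hs]
    have h3 : (conts w B (some x)).tail = s := by simp [conts, hs]
    rw [h2, h3, update_conts_some, ← update_conts_some _ _ y]
    have := Run.push (Γ := alphabet A X) (some y) b (conts w (update B x s))
    have h4 : conts w (update B x s) (some y) = B y := by simp [conts, hxy.symm]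
    rw [h4] at this
    exact this

end StackProg

/-! ### Unary numbers on stacks -/

namespace StackProg

open Function

variable {A X : Type} [DecidableEq X] {B : X → List Bool} {x y z : X} {k : ℕ} {r : List Bool}

theorem replicate_append_cons (k : ℕ) (l : List Bool) :
    List.replicate k true ++ true :: l = List.replicate (k + 1) true ++ l := by
  induction k with
  | zero => rfl
  | succ k ih => rw [List.replicate_succ, List.cons_append, ih]; rfl

/-- The loop ends by popping the letter that stops it; the separator behind a unary number is
therefore consumed too, and `r.tail` remains. -/
theorem Ex.drain (hx : B x = List.replicate k true ++ r) (hr : r.head? ≠ some true) :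
    Ex (loopT x .skip : StackProg (alphabet A X)) B (update B x r.tail) (2 * k + 1) := by
  induction k generalizing B with
  | zero =>
    have hx' : B x = r := by simpa using hx
    have := Ex.loop_done (A := A) (B := B) (x := x) (c := StackProg.skip) (by rw [hx']; exact hr)
    rwa [hx'] at this
  | succ k ih =>
    have h := ih (B := update B x (List.replicate k true ++ r)) (by simp)
    rw [update_idem] at h
    exact (Ex.loop_go (by rw [hx]; rfl) Ex.skip h).mono (by omega)

theorem Ex.move (hxy : x ≠ y) (hx : B x = List.replicate k true ++ r)
    (hr : r.head? ≠ some true) :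
    Ex (loopT x (pushB y true) : StackProg (alphabet A X)) B
      (update (update B x r.tail) y (List.replicate k true ++ B y)) (2 * k + 1) := by
  induction k generalizing B with
  | zero =>
    have hx' : B x = r := by simpa using hx
    have := Ex.loop_done (A := A) (B := B) (x := x) (c := pushB y true) (by rw [hx']; exact hr)
    rw [hx'] at this
    have e : update (update B x r.tail) y (List.replicate 0 true ++ B y) = update B x r.tail := by
      funext w
      by_cases hw : w = y
      · subst hw; simp [hxy.symm]
      · simp [hw]
    rwa [e]
  | succ k ih =>
    set B1 := update B x (List.replicate k true ++ r)
    have h := ih (B := update B1 y (true :: B1 y)) (by simp [B1, hxy])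
    have e : update (update (update B1 y (true :: B1 y)) x r.tail) y
        (List.replicate k true ++ update B1 y (true :: B1 y) y) =
        update (update B x r.tail) y (List.replicate (k + 1) true ++ B y) := by
      funext w
      by_cases hw : w = y
      · subst hw; simp [B1, hxy.symm, replicate_append_cons]
      · by_cases hw' : w = x
        · subst hw'; simp [hw]
        · simp [hw, hw', B1]
    rw [e] at h
    exact (Ex.loop_go (by rw [hx]; rfl) (Ex.push y true) h).mono (by omega)

theorem Ex.move₂ (hxy : x ≠ y) (hxz : x ≠ z) (hyz : y ≠ z) (hx : B x = List.replicate k true ++ r)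
    (hr : r.head? ≠ some true) :
    Ex (loopT x (.seq (pushB y true) (pushB z true)) : StackProg (alphabet A X)) B
      (update (update (update B x r.tail) y (List.replicate k true ++ B y)) z
        (List.replicate k true ++ B z)) (2 * k + 1) := by
  induction k generalizing B with
  | zero =>
    have hx' : B x = r := by simpa using hx
    have := Ex.loop_done (A := A) (B := B) (x := x) (c := StackProg.seq (pushB y true) (pushB z true))
      (by rw [hx']; exact hr)
    rw [hx'] at this
    have e : update (update (update B x r.tail) y (List.replicate 0 true ++ B y)) z
        (List.replicate 0 true ++ B z) = update B x r.tail := by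
      funext w
      by_cases hw : w = z
      · subst hw; simp [hxz.symm]
      · by_cases hw' : w = y
        · subst hw'; simp [hw, hxy.symm]
        · simp [hw, hw']
    rwa [e]
  | succ k ih =>
    set B1 := update B x (List.replicate k true ++ r)
    set B2 := update B1 y (true :: B1 y) with hB2
    have h := ih (B := update B2 z (true :: B2 z)) (by simp [B1, B2, hxy, hxz])
    have e : update (update (update (update B2 z (true :: B2 z)) x r.tail) y
        (List.replicate k true ++ update B2 z (true :: B2 z) y)) z
        (List.replicate k true ++ update B2 z (true :: B2 z) z) =
        update (update (update B x r.tail) y (List.replicate (k + 1) true ++ B y)) z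
          (List.replicate (k + 1) true ++ B z) := by
      funext w
      by_cases hw : w = z
      · subst hw; simp [B1, B2, hxz.symm, hyz.symm, replicate_append_cons]
      · by_cases hw' : w = y
        · subst hw'; simp [B1, B2, hw, hxy.symm, replicate_append_cons]
        · by_cases hw'' : w = x
          · subst hw''; simp [hw, hw']
          · simp [hw, hw', hw'', B1, B2]
    rw [e] at h
    exact (Ex.loop_go (by rw [hx]; rfl) ((Ex.push y true).seq (Ex.push z true)) h).mono (by omega)

end StackProg

/-! ### Programs on arrays of numbers -/

/-- Programs on arrays of natural numbers. The entry `0` of an array serves as a variable; `rep`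
repeats a program a number of times that is fixed beforehand. -/
inductive ArrProg (V : Type) : Type
  | skip : ArrProg V
  | seq (c d : ArrProg V) : ArrProg V
  | zero (a : V) : ArrProg V
  | inc (a : V) : ArrProg V
  | read (a b i : V) : ArrProg V
  | write (a i b : V) : ArrProg V
  | ifLe (a b : V) (c d : ArrProg V) : ArrProg V
  | rep (c : ArrProg V) : ArrProg V

/-- Auxiliary stacks for the implementation of programs on arrays. -/
inductive AuxStack : Type
  | t1 | t2 | t3 | t4 | ctr | nst | out
  deriving DecidableEq

instance : Fintype AuxStack :=
  ⟨{.t1, .t2, .t3, .t4, .ctr, .nst, .out}, fun x => by cases x <;> simp⟩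

namespace ArrProg

open Function StackProg AuxStack

variable {V : Type} [DecidableEq V]

/-- The semantics of a program, `N` being the number of repetitions. -/
def eval (N : ℕ) : ArrProg V → (V → ℕ → ℕ) → V → ℕ → ℕ
  | skip, S => S
  | seq c d, S => eval N d (eval N c S)
  | zero a, S => update S a (update (S a) 0 0)
  | inc a, S => update S a (update (S a) 0 (S a 0 + 1))
  | read a b i, S => update S a (update (S a) 0 (S b (S i 0)))
  | write a i b, S => update S a (update (S a) (S i 0) (S b 0))
  | ifLe a b c d, S => if S a 0 ≤ S b 0 then eval N c S else eval N d S
  | rep c, S => (eval N c)^[N] S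

variable {A : Type}

/-- Copy the variable `a` to a stack, in unary. -/
def fetch (a : V) (t : AuxStack) : StackProg (alphabet A (V ⊕ AuxStack)) :=
  .seq (loopT (.inl a) (.seq (pushB (.inr t1) true) (pushB (.inr t) true)))
    (.seq (pushB (.inl a) false) (loopT (.inr t1) (pushB (.inl a) true)))

/-- Move a unary number from a stack to the head of an array. -/
def store (t : AuxStack) (a : V) : StackProg (alphabet A (V ⊕ AuxStack)) :=
  .seq (loopT (.inl a) .skip) (.seq (pushB (.inl a) false) (loopT (.inr t) (pushB (.inl a) true)))

/-- Move as many entries of an array as `t2` tells to `t3`. -/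
def shift (b : V) : StackProg (alphabet A (V ⊕ AuxStack)) :=
  loopT (.inr t2) (.seq (loopT (.inl b) (pushB (.inr t3) true)) (pushB (.inr t3) false))

/-- Copy the entry of an array whose index is on `t2` to `t4`. -/
def getAt (b : V) : StackProg (alphabet A (V ⊕ AuxStack)) :=
  .seq (shift b) (.seq (fetch b t4) (pour (.inr t3) (.inl b)))

/-- Move the number on `t4` to the place in an array whose index is on `t2`. -/
def setAt (a : V) : StackProg (alphabet A (V ⊕ AuxStack)) :=
  .seq (shift a) (.seq (store t4 a) (pour (.inr t3) (.inl a)))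

/-- Subtract from each other the numbers on `t2` and `t4`. -/
def compare : StackProg (alphabet A (V ⊕ AuxStack)) :=
  loopT (.inr t2) (caseB (.inr t4) fun o => match o with
    | none => pushB (.inr t3) true
    | some _ => .skip)

/-- The implementation of a program. -/
def compile : ArrProg V → StackProg (alphabet A (V ⊕ AuxStack))
  | skip => .skip
  | seq c d => .seq (compile c) (compile d)
  | zero a => store t2 a
  | inc a => .seq (fetch a t2) (.seq (pushB (.inr t2) true) (store t2 a))
  | read a b i => .seq (fetch i t2) (.seq (getAt b) (store t4 a))
  | write a i b => .seq (fetch b t4) (.seq (fetch i t2) (setAt a))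
  | ifLe a b c d => .seq (fetch a t2) (.seq (fetch b t4) (.seq compare
      (.seq (loopT (.inr t4) .skip) (caseB (.inr t3) fun o => match o with
        | none => compile c
        | some _ => .seq (loopT (.inr t3) .skip) (compile d)))))
  | rep c => .seq (pushB (.inr ctr) false) (.seq (loopT (.inr nst) (pushB (.inr t1) true))
      (.seq (loopT (.inr t1) (.seq (pushB (.inr nst) true) (pushB (.inr ctr) true)))
        (loopT (.inr ctr) (compile c))))

/-- The contents of the stacks that hold the arrays `M`. -/
def hold (M : V → List ℕ) (u : AuxStack → List Bool) : V ⊕ AuxStack → List Bool :=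
  Sum.elim (fun a => listCode (M a)) u

@[simp]
theorem hold_inl (M : V → List ℕ) (u : AuxStack → List Bool) (a : V) :
    hold M u (.inl a) = listCode (M a) := rfl

@[simp]
theorem hold_inr (M : V → List ℕ) (u : AuxStack → List Bool) (t : AuxStack) :
    hold M u (.inr t) = u t := rfl

theorem update_hold_inr (M : V → List ℕ) (u : AuxStack → List Bool) (t : AuxStack)
    (s : List Bool) : update (hold M u) (.inr t) s = hold M (update u t s) :=
  Sum.update_elim_inr

theorem update_hold_inl (M : V → List ℕ) (u : AuxStack → List Bool) (a : V)
    (l : List ℕ) : update (hold M u) (.inl a) (listCode l) = hold (update M a l) u := by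
  unfold hold
  rw [Sum.update_elim_inl]
  congr 1
  funext b
  by_cases h : b = a
  · subst h; simp
  · simp [h]

/-- An empty list behaves like one that starts with `0`, since popping from an empty stack also ends
a loop. Arrays may thus be read as continued by zeros. -/
theorem listCode_split (l : List ℕ) : ∃ r, listCode l = List.replicate (l.headD 0) true ++ r ∧
    r.head? ≠ some true ∧ r.tail = listCode l.tail := by
  cases l with
  | nil => exact ⟨[], by simp [listCode], by simp, by simp [listCode]⟩
  | cons a l => exact ⟨false :: listCode l, by rw [listCode_cons]; rfl, by simp, rfl⟩

theorem listCode_cons' (a : ℕ) (l : List ℕ) :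
    List.replicate a true ++ false :: listCode l = listCode (a :: l) := (listCode_cons a l).symm

theorem listCode_append (l m : List ℕ) : listCode (l ++ m) = listCode l ++ listCode m := by
  simp [listCode]

variable {M : V → List ℕ} {u : AuxStack → List Bool} {a b : V} {t : AuxStack} {k : ℕ}

/-- Reading destroys a unary number, so it is moved to two stacks at once and one copy is moved
back. Afterwards the list has an explicit head even if it was empty. -/
theorem fetch_spec (h1 : u t1 = []) (h2 : u t = []) (ht : t ≠ t1) :
    Ex (fetch a t : StackProg (alphabet A (V ⊕ AuxStack))) (hold M u)
      (hold (update M a ((M a).headD 0 :: (M a).tail))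
        (update u t (List.replicate ((M a).headD 0) true))) (4 * (M a).headD 0 + 2) := by
  obtain ⟨r, e1, e2, e3⟩ := listCode_split (M a)
  have s1 := Ex.move₂ (A := A) (B := hold M u) (x := Sum.inl a) (y := Sum.inr t1) (z := Sum.inr t)
    (by simp) (by simp) (by simpa using ht.symm) e1 e2
  have s2 := Ex.push (A := A) (B := update (update (update (hold M u) (Sum.inl a) r.tail)
    (Sum.inr t1) (List.replicate ((M a).headD 0) true ++ hold M u (Sum.inr t1))) (Sum.inr t)
        (List.replicate ((M a).headD 0) true ++ hold M u (Sum.inr t))) (Sum.inl a) false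
  have s3 := Ex.move (A := A) (B := update (update (update (update (hold M u) (Sum.inl a) r.tail)
    (Sum.inr t1) (List.replicate ((M a).headD 0) true ++ hold M u (Sum.inr t1))) (Sum.inr t)
        (List.replicate ((M a).headD 0) true ++ hold M u (Sum.inr t))) (Sum.inl a)
        (false :: r.tail)) (x := Sum.inr t1) (y := Sum.inl a) (k := (M a).headD 0) (r := [])
    (by simp) (by simp [ht.symm, h1]) (by simp)
  have s2' : Ex (pushB (Sum.inl a) false : StackProg (alphabet A (V ⊕ AuxStack))) _ _ 0 := s2
  refine ((s1.seq (s2.seq ?_)).mono (by omega : _ + (0 + (2 * (M a).headD 0 + 1)) ≤ _))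
  convert s3 using 1
  · simp
  · rw [← update_hold_inl, ← update_hold_inr]
    funext w
    rcases w with b | s
    · by_cases hb : b = a
      · subst hb; simp [e3, listCode_cons']
      · simp [hb]
    · by_cases hs : s = t
      · subst hs; simp [ht, h2]
      · by_cases hs' : s = t1
        · subst hs'; simp [hs, h1]
        · simp [hs, hs']

theorem store_spec (h : u t = List.replicate k true) :
    Ex (store t a : StackProg (alphabet A (V ⊕ AuxStack))) (hold M u)
      (hold (update M a (k :: (M a).tail)) (update u t [])) (2 * (M a).headD 0 + 2 * k + 2) := by
  obtain ⟨r, e1, e2, e3⟩ := listCode_split (M a)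
  have s1 := Ex.drain (A := A) (B := hold M u) (x := Sum.inl a) e1 e2
  have s2 := Ex.push (A := A) (B := update (hold M u) (Sum.inl a) r.tail) (Sum.inl a) false
  have s3 := Ex.move (A := A) (B := update (update (hold M u) (Sum.inl a) r.tail) (Sum.inl a)
    (false :: update (hold M u) (Sum.inl a) r.tail (Sum.inl a)))
    (x := Sum.inr t) (y := Sum.inl a) (k := k) (r := [])
    (by simp) (by simp [h]) (by simp)
  refine ((s1.seq (s2.seq ?_)).mono (by omega : _ + (0 + (2 * k + 1)) ≤ _))
  convert s3 using 1
  rw [← update_hold_inl, ← update_hold_inr]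
  funext w
  rcases w with b | s
  · by_cases hb : b = a
    · subst hb; simp [e3, listCode_cons']
    · simp [hb]
  · by_cases hs : s = t
    · subst hs; simp
    · simp [hs]

end ArrProg

/-! ### Access to the entries of an array -/

namespace ArrProg

open Function StackProg AuxStack

/-- The first `i` entries of a list that is continued by zeros. -/
def padTake : ℕ → List ℕ → List ℕ
  | 0, _ => []
  | i + 1, l => l.headD 0 :: padTake i l.tail

/-- Replace the entry at `i`, continuing the list by zeros if necessary. -/
def putAt (i v : ℕ) (l : List ℕ) : List ℕ := padTake i l ++ v :: (l.drop i).tail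

theorem headD_eq_getD (l : List ℕ) : l.headD 0 = l.getD 0 0 := by cases l <;> simp

theorem getD_tail (l : List ℕ) (j : ℕ) : l.tail.getD j 0 = l.getD (j + 1) 0 := by
  cases l <;> simp

theorem putAt_succ (i v : ℕ) (l : List ℕ) :
    putAt (i + 1) v l = l.headD 0 :: putAt i v l.tail := by
  cases l <;> simp [putAt, padTake]

theorem getD_putAt (i v : ℕ) (l : List ℕ) (j : ℕ) :
    (putAt i v l).getD j 0 = if j = i then v else l.getD j 0 := by
  induction i generalizing l j with
  | zero =>
    cases j with
    | zero => simp [putAt, padTake]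
    | succ j => cases l <;> simp [putAt, padTake]
  | succ i ih =>
    rw [putAt_succ]
    cases j with
    | zero => cases l <;> simp
    | succ j => rw [List.getD_cons_succ, ih, getD_tail]; simp

theorem length_padTake (i : ℕ) (l : List ℕ) : (padTake i l).length = i := by
  induction i generalizing l with
  | zero => rfl
  | succ i ih => simp [padTake, ih]

theorem headD_le {l : List ℕ} {L : ℕ} (h : ∀ x ∈ l, x ≤ L) : l.headD 0 ≤ L := by
  cases l with
  | nil => simp
  | cons a l => exact h a (by simp)

theorem padTake_le {i : ℕ} {l : List ℕ} {L : ℕ} (h : ∀ x ∈ l, x ≤ L) : ∀ x ∈ padTake i l, x ≤ L := by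
  induction i generalizing l with
  | zero => simp [padTake]
  | succ i ih =>
    intro x hx
    rcases List.mem_cons.1 hx with rfl | hx
    · exact headD_le h
    · exact ih (fun y hy => h y (List.mem_of_mem_tail hy)) x hx

theorem putAt_le {i v : ℕ} {l : List ℕ} {L : ℕ} (h : ∀ x ∈ l, x ≤ L) (hv : v ≤ L) :
    ∀ x ∈ putAt i v l, x ≤ L := by
  intro x hx
  rcases List.mem_append.1 hx with hx | hx
  · exact padTake_le h x hx
  rcases List.mem_cons.1 hx with rfl | hx
  · exact hv
  · exact h x (List.mem_of_mem_drop (List.mem_of_mem_tail hx))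

theorem length_putAt (i v : ℕ) (l : List ℕ) : (putAt i v l).length ≤ max l.length (i + 1) := by
  simp only [putAt, List.length_append, length_padTake, List.length_cons, List.length_tail,
    List.length_drop]
  omega

theorem length_listCode {l : List ℕ} {L : ℕ} (h : ∀ x ∈ l, x ≤ L) :
    (listCode l).length ≤ l.length * (L + 1) := by
  induction l with
  | nil => simp [listCode]
  | cons a l ih =>
    rw [listCode_cons]
    have h1 := ih fun x hx => h x (by simp [hx])
    have h2 := h a (by simp)
    simp only [List.length_append, List.length_replicate, List.length_cons]
    rw [Nat.succ_mul]
    omega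

variable {V : Type} [DecidableEq V] {A : Type}
variable {M : V → List ℕ} {u : AuxStack → List Bool} {a b : V} {t : AuxStack} {k L N : ℕ}

/-- The accumulator `p` serves the induction: the entries removed so far lie reversed on `t3`, from
where a single `pour` puts them back in order. -/
theorem shift_spec {p : List ℕ} {i : ℕ} (h2 : u t2 = List.replicate i true)
    (h3 : u t3 = (listCode p).reverse) (hL : ∀ x ∈ M b, x ≤ L) :
    Ex (shift b : StackProg (alphabet A (V ⊕ AuxStack))) (hold M u)
      (hold (update M b ((M b).drop i))
        (update (update u t2 []) t3 (listCode (p ++ padTake i (M b))).reverse))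
      (i * (2 * L + 3) + 1) := by
  induction i generalizing M u p with
  | zero =>
    have := Ex.loop_done (A := A) (B := hold M u) (x := Sum.inr t2)
      (c := .seq (loopT (.inl b) (pushB (.inr t3) true)) (pushB (.inr t3) false)) (by simp [h2])
    rw [update_hold_inr] at this
    have e1 : update M b ((M b).drop 0) = M := by simp
    have e2 : update (update u t2 []) t3 (listCode (p ++ padTake 0 (M b))).reverse =
        update u t2 (hold M u (Sum.inr t2)).tail := by
      funext s
      by_cases hs : s = t3
      · subst hs; simp [padTake, h3]
      · simp [hs, h2]
    rw [e1, e2]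
    exact this.mono (by omega)
  | succ i ih =>
    obtain ⟨r, e1, e2, e3⟩ := listCode_split (M b)
    have s1 := Ex.move (A := A) (B := hold M (update u t2 (List.replicate i true)))
      (x := Sum.inl b) (y := Sum.inr t3) (by simp) e1 e2
    rw [e3, update_hold_inl, update_hold_inr] at s1
    have s2 := s1.seq (Ex.push (Sum.inr t3) false)
    rw [update_hold_inr] at s2
    have s3 := ih (M := update M b (M b).tail) (p := p ++ [(M b).headD 0])
      (u := update (update (update u t2 (List.replicate i true)) t3
        (List.replicate ((M b).headD 0) true ++ u t3)) t3
        (false :: (List.replicate ((M b).headD 0) true ++ u t3))) (by simp)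
      (by simp [h3, listCode]) (fun x hx => by
        rw [update_self] at hx
        exact hL x (List.mem_of_mem_tail hx))
    have hh := headD_le hL
    have h := Ex.loop_go (A := A) (B := hold M u) (x := Sum.inr t2) (s := List.replicate i true)
      (by simp [h2, List.replicate_succ]) (by
        rw [update_hold_inr]
        exact s2.mono (by omega : _ ≤ 2 * L + 1)) s3
    have k1 : update (update M b (M b).tail) b (List.drop i (update M b (M b).tail b)) =
        update M b ((M b).drop (i + 1)) := by simp
    have k2 : update (update (update (update (update u t2 (List.replicate i true)) t3
        (List.replicate ((M b).headD 0) true ++ u t3)) t3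
        (false :: (List.replicate ((M b).headD 0) true ++ u t3))) t2 []) t3
        (listCode (p ++ [(M b).headD 0] ++ padTake i (update M b (M b).tail b))).reverse =
        update (update u t2 []) t3 (listCode (p ++ padTake (i + 1) (M b))).reverse := by
      funext s
      by_cases hs : s = t3
      · subst hs; simp [padTake]
      · by_cases hs' : s = t2
        · subst hs'; simp
        · simp [hs, hs']
    rw [k1, k2] at h
    exact h.mono (by have := Nat.add_one_mul i (2 * L + 3); omega)

theorem restore_spec {p : List ℕ} (h3 : u t3 = (listCode p).reverse) :
    Ex (pour (.inr t3) (.inl b) : StackProg (alphabet A (V ⊕ AuxStack))) (hold M u)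
      (hold (update M b (p ++ M b)) (update u t3 [])) (2 * (listCode p).length + 1) := by
  have := Ex.pour (A := A) (B := hold M u) (x := Sum.inr t3) (y := Sum.inl b) (by simp)
  have e : (hold M u (Sum.inr t3)).reverse ++ hold M u (Sum.inl b) = listCode (p ++ M b) := by
    simp [h3, listCode_append]
  rw [e, update_hold_inr, update_hold_inl] at this
  exact this.mono (by simp [h3])

/-- The lists `M` hold the arrays `S`, with numbers and lengths bounded by `L`. -/
def Holds (L : ℕ) (M : V → List ℕ) (S : V → ℕ → ℕ) : Prop :=
  ∀ a, (∀ i, (M a).getD i 0 = S a i) ∧ (M a).length ≤ L ∧ ∀ x ∈ M a, x ≤ L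

variable {S : V → ℕ → ℕ}

omit [DecidableEq V] in
theorem Holds.headD (h : Holds L M S) (a : V) : (M a).headD 0 = S a 0 := by
  rw [headD_eq_getD, (h a).1]

omit [DecidableEq V] in
theorem Holds.le (h : Holds L M S) (a : V) : S a 0 ≤ L := by
  rw [← h.headD a]; exact headD_le (h a).2.2

omit [DecidableEq V] in
theorem Holds.mono (h : Holds L M S) {L' : ℕ} (hL : L ≤ L') : Holds L' M S := fun a =>
  ⟨(h a).1, (h a).2.1.trans hL, fun x hx => ((h a).2.2 x hx).trans hL⟩

theorem Holds.putAt (h : Holds L M S) {L' i v : ℕ} (hL : L ≤ L') (hi : i < L') (hv : v ≤ L') :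
    Holds L' (update M a (putAt i v (M a))) (update S a (update (S a) i v)) := by
  intro b
  by_cases hb : b = a
  · subst hb
    simp only [update_self]
    refine ⟨fun j => ?_, ?_, putAt_le (fun x hx => ((h b).2.2 x hx).trans (by omega)) hv⟩
    · rw [getD_putAt, (h b).1, update_apply]
    · have := length_putAt i v (M b)
      have := (h b).2.1
      omega
  · simp only [update_of_ne hb]
    exact (h.mono hL) b

omit [DecidableEq V] in
theorem Holds.le' (h : Holds L M S) (a : V) (i : ℕ) : S a i ≤ L := by
  rw [← (h a).1]
  by_cases hi' : i < (M a).length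
  · rw [List.getD_eq_getElem _ _ hi']
    exact (h a).2.2 _ (List.getElem_mem hi')
  · rw [List.getD_eq_default _ _ (by omega)]; omega

/-- Reading an entry may pad the list by zeros, but the list continues to represent the same array.
-/
theorem Holds.refill (h : Holds L M S) {L' i : ℕ} (hL : L ≤ L') (hi : i < L') :
    Holds L' (update M a (ArrProg.putAt i (S a i) (M a))) S := by
  simpa using h.putAt (a := a) hL hi ((h.le' a i).trans hL)

/-- The auxiliary stacks for numbers are empty. -/
def Clean (u : AuxStack → List Bool) : Prop := u t1 = [] ∧ u t2 = [] ∧ u t3 = [] ∧ u t4 = []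

theorem exists_fetch (h : Holds L M S) (hL : 1 ≤ L) (a : V) (h1 : u t1 = []) (h2 : u t = [])
    (ht : t ≠ t1) :
    ∃ M', Ex (fetch a t : StackProg (alphabet A (V ⊕ AuxStack))) (hold M u)
      (hold M' (update u t (List.replicate (S a 0) true))) (4 * L + 2) ∧ Holds L M' S := by
  have s1 := fetch_spec (A := A) (M := M) (a := a) h1 h2 ht
  rw [h.headD a] at s1
  refine ⟨_, s1.mono ?_, ?_⟩
  · have := h.le a
    omega
  · have := h.refill (a := a) le_rfl (i := 0) hL
    simpa [ArrProg.putAt, padTake, h.headD a] using this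

theorem exists_store (h : Holds L M S) (hL : 1 ≤ L) (a : V) (h1 : u t = List.replicate k true)
    (hk : k ≤ L) :
    ∃ M', Ex (store t a : StackProg (alphabet A (V ⊕ AuxStack))) (hold M u)
      (hold M' (update u t [])) (4 * L + 2) ∧ Holds L M' (update S a (update (S a) 0 k)) := by
  refine ⟨_, ((store_spec (A := A) (a := a) h1).mono ?_), ?_⟩
  · have := headD_le (h a).2.2
    omega
  · have := h.putAt (a := a) le_rfl (i := 0) hL hk
    simpa [ArrProg.putAt, padTake] using this

theorem length_padTake_code {l : List ℕ} (h : ∀ x ∈ l, x ≤ L) {i : ℕ} (hi : i ≤ L) :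
    2 * (listCode (padTake i l)).length + 1 ≤ 2 * (L * (L + 1)) + 1 := by
  have h1 := length_listCode (padTake_le h (i := i))
  rw [length_padTake] at h1
  have h2 := Nat.mul_le_mul_right (L + 1) hi
  omega

theorem shift_cost {i : ℕ} (hi : i ≤ L) : i * (2 * L + 3) + 1 ≤ L * (2 * L + 3) + 1 := by
  have := Nat.mul_le_mul_right (2 * L + 3) hi
  omega

theorem headD_drop (l : List ℕ) (i : ℕ) : (l.drop i).headD 0 = l.getD i 0 := by
  rw [headD_eq_getD]
  simp [List.getD]

theorem exists_getAt (h : Holds L M S) (hu : u t1 = [] ∧ u t3 = [] ∧ u t4 = [])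
    (h2 : u t2 = List.replicate k true) (hk : k < L) (b : V) :
    ∃ M', Ex (getAt b : StackProg (alphabet A (V ⊕ AuxStack))) (hold M u)
      (hold M' (update (update u t2 []) t4 (List.replicate (S b k) true)))
      (4 * L * (L + 4) + 4) ∧ Holds L M' S := by
  have s1 := shift_spec (A := A) (M := M) (b := b) (p := []) h2 (by simp [hu, listCode])
    (h b).2.2
  have s2 := fetch_spec (A := A) (M := update M b ((M b).drop k)) (a := b) (t := t4)
    (u := update (update u t2 []) t3 (listCode ([] ++ padTake k (M b))).reverse)
    (by simp [hu]) (by simp [hu]) (by simp)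
  have s3 := restore_spec (A := A) (b := b) (p := padTake k (M b))
    (M := update (update M b ((M b).drop k)) b (((update M b ((M b).drop k)) b).headD 0 ::
      ((update M b ((M b).drop k)) b).tail))
    (u := update (update (update u t2 []) t3 (listCode ([] ++ padTake k (M b))).reverse) t4
      (List.replicate (((update M b ((M b).drop k)) b).headD 0) true)) (by simp)
  have e1 : ((update M b ((M b).drop k)) b).headD 0 = S b k := by
    rw [update_self, headD_drop, (h b).1]
  rw [e1] at s2 s3
  have e2 : update (update (update (update u t2 []) t3 (listCode ([] ++ padTake k (M b))).reverse)
      t4 (List.replicate (S b k) true)) t3 [] =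
      update (update u t2 []) t4 (List.replicate (S b k) true) := by
    funext s
    by_cases hs : s = t3
    · subst hs; simp [hu]
    · by_cases hs' : s = t4
      · subst hs'; simp
      · simp [hs, hs']
  rw [e2] at s3
  refine ⟨_, (s1.seq (s2.seq s3)).mono ?_, ?_⟩
  · have := shift_cost hk.le
    have := length_padTake_code (h b).2.2 hk.le
    have := h.le' b k
    nlinarith
  · have := h.refill (a := b) le_rfl hk
    simpa [ArrProg.putAt] using this

theorem exists_setAt (h : Holds L M S) {v : ℕ} (hu : u t1 = [] ∧ u t3 = [])
    (h2 : u t2 = List.replicate k true) (h4 : u t4 = List.replicate v true) (hv : v ≤ L)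
    (hk : k < L) (a : V) :
    ∃ M', Ex (setAt a : StackProg (alphabet A (V ⊕ AuxStack))) (hold M u)
      (hold M' (update (update u t2 []) t4 []))
      (4 * L * (L + 4) + 4) ∧ Holds L M' (update S a (update (S a) k v)) := by
  have s1 := shift_spec (A := A) (M := M) (b := a) (p := []) h2 (by simp [hu, listCode])
    (h a).2.2
  have s2 := store_spec (A := A) (M := update M a ((M a).drop k)) (a := a) (t := t4) (k := v)
    (u := update (update u t2 []) t3 (listCode ([] ++ padTake k (M a))).reverse)
    (by simp [h4])
  have s3 := restore_spec (A := A) (b := a) (p := padTake k (M a))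
    (M := update (update M a ((M a).drop k)) a (v :: ((update M a ((M a).drop k)) a).tail))
    (u := update (update (update u t2 []) t3 (listCode ([] ++ padTake k (M a))).reverse) t4 [])
      (by simp)
  have e2 : update (update (update (update u t2 []) t3 (listCode ([] ++ padTake k (M a))).reverse)
      t4 []) t3 [] = update (update u t2 []) t4 [] := by
    funext s
    by_cases hs : s = t3
    · subst hs; simp [hu]
    · by_cases hs' : s = t4
      · subst hs'; simp
      · simp [hs, hs']
  rw [e2] at s3
  refine ⟨_, (s1.seq (s2.seq s3)).mono ?_, ?_⟩
  · have := shift_cost hk.le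
    have := length_padTake_code (h a).2.2 hk.le
    have e1 : ((update M a ((M a).drop k)) a).headD 0 = S a k := by
      rw [update_self, headD_drop, (h a).1]
    have := h.le' a k
    rw [e1]
    nlinarith
  · have := h.putAt (a := a) le_rfl hk hv
    simpa [ArrProg.putAt] using this

/-- Both truncated differences appear, on `t4` and on `t3`; when `t3` is empty at the start, its
being empty at the end decides the comparison. -/
theorem compare_spec {p q r : ℕ} (h2 : u t2 = List.replicate p true)
    (h4 : u t4 = List.replicate q true) (h3 : u t3 = List.replicate r true) :
    Ex (compare : StackProg (alphabet A (V ⊕ AuxStack))) (hold M u)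
      (hold M (update (update (update u t2 []) t4 (List.replicate (q - p) true)) t3
        (List.replicate (r + (p - q)) true))) (3 * p + 1) := by
  induction p generalizing u q r with
  | zero =>
    have := Ex.loop_done (A := A) (B := hold M u) (x := Sum.inr t2)
      (c := caseB (.inr t4) fun o => match o with
        | none => pushB (.inr t3) true
        | some _ => .skip) (by simp [h2])
    rw [update_hold_inr] at this
    have e2 : update (update (update u t2 []) t4 (List.replicate (q - 0) true)) t3
        (List.replicate (r + (0 - q)) true) = update u t2 (hold M u (Sum.inr t2)).tail := by
      funext s
      by_cases hs : s = t3
      · subst hs; simp [h3]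
      · by_cases hs' : s = t4
        · subst hs'; simp [h4]
        · simp [hs, hs', h2]
    rw [e2]
    exact this.mono (by omega)
  | succ p ih =>
    rcases q with _ | q
    · have s1 := ih (u := update (update (update u t2 (List.replicate p true)) t4 []) t3
        (List.replicate (r + 1) true)) (q := 0) (r := r + 1) (by simp) (by simp) (by simp)
      have s2 : Ex (caseB (.inr t4) fun o => match o with
          | none => pushB (.inr t3) true
          | some _ => .skip : StackProg (alphabet A (V ⊕ AuxStack)))
          (hold M (update u t2 (List.replicate p true)))
          (hold M (update (update (update u t2 (List.replicate p true)) t4 []) t3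
            (List.replicate (r + 1) true))) (0 + 1) := by
        refine Ex.case ?_
        have := Ex.push (A := A) (B := hold M (update (update u t2 (List.replicate p true)) t4 []))
          (Sum.inr t3) true
        rw [update_hold_inr] at this ⊢
        simpa [h4, h3, List.replicate_succ] using this
      rw [← update_hold_inr (s := List.replicate p true)] at s2
      have : Ex (compare : StackProg (alphabet A (V ⊕ AuxStack))) _ _ _ := Ex.loop_go (A := A)
        (B := hold M u) (x := Sum.inr t2) (s := List.replicate p true)
        (by simp [h2, List.replicate_succ]) s2 s1
      convert this.mono (by omega : _ ≤ 3 * (p + 1) + 1) using 2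
      funext s
      by_cases hs : s = t3
      · subst hs; simp; omega
      · by_cases hs' : s = t4
        · subst hs'; simp
        · by_cases hs'' : s = t2
          · subst hs''; simp
          · simp [hs, hs', hs'']
    · have s1 := ih (u := update (update u t2 (List.replicate p true)) t4
        (List.replicate q true)) (q := q) (r := r) (by simp) (by simp) (by simp [h3])
      have s2 : Ex (caseB (.inr t4) fun o => match o with
          | none => pushB (.inr t3) true
          | some _ => .skip : StackProg (alphabet A (V ⊕ AuxStack)))
          (hold M (update u t2 (List.replicate p true)))
          (hold M (update (update u t2 (List.replicate p true)) t4
            (List.replicate q true))) (0 + 1) := by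
        refine Ex.case ?_
        rw [update_hold_inr]
        simp only [hold_inr, ne_eq, reduceCtorEq, not_false_eq_true, update_of_ne, h4,
          List.replicate_succ, List.head?_cons, List.tail_cons]
        exact Ex.skip
      rw [← update_hold_inr (s := List.replicate p true)] at s2
      have : Ex (compare : StackProg (alphabet A (V ⊕ AuxStack))) _ _ _ := Ex.loop_go (A := A)
        (B := hold M u) (x := Sum.inr t2) (s := List.replicate p true)
        (by simp [h2, List.replicate_succ]) s2 s1
      convert this.mono (by omega : _ ≤ 3 * (p + 1) + 1) using 2
      funext s
      by_cases hs : s = t3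
      · subst hs; simp
      · by_cases hs' : s = t4
        · subst hs'; simp
        · by_cases hs'' : s = t2
          · subst hs''; simp
          · simp [hs, hs', hs'']

end ArrProg

/-! ### Correctness and cost of compiled programs -/

namespace ArrProg

open Function StackProg AuxStack

variable {V : Type} [DecidableEq V] {A : Type}
variable {M : V → List ℕ} {u : AuxStack → List Bool} {a b : V} {t : AuxStack} {k L N : ℕ}
variable {S : V → ℕ → ℕ}

/-- A bound for the number of operations of a program. -/
noncomputable def ops : ArrProg V → Polynomial ℕ
  | skip => 0
  | seq c d => ops c + ops d
  | zero _ => 1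
  | inc _ => 1
  | read _ _ _ => 1
  | write _ _ _ => 1
  | ifLe _ _ c d => 1 + (ops c + ops d)
  | rep c => Polynomial.X * (ops c + 1) + 1

omit [DecidableEq V] in
theorem ops_rep (c : ArrProg V) : (ops (rep c)).eval N = N * ((ops c).eval N + 1) + 1 := by
  simp [ops]

/-- A bound for the time of an operation. -/
def opCost (B N : ℕ) : ℕ := 20 * (B + N + 2) ^ 2

theorem le_opCost (B N : ℕ) : 20 * (B * B + N * N + 2 * (B * N) + 4 * B + 4 * N + 4) = opCost B N := by
  unfold opCost; ring

theorem clean_update {t : AuxStack} (h : u t = []) (l : List Bool) :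
    update (update u t l) t [] = u := by
  rw [update_idem, ← h, update_eq_self]

/-- The implementation of `c` is correct for arrays bounded by `L`, in time `T`. -/
def Implements (N : ℕ) (c : ArrProg V) (T : ℕ) (M : V → List ℕ) (u : AuxStack → List Bool)
    (L' : ℕ) (S : V → ℕ → ℕ) : Prop :=
  ∃ M', Ex (compile c : StackProg (alphabet A (V ⊕ AuxStack))) (hold M u) (hold M' u) T ∧
    Holds L' M' (eval N c S)

theorem compile_zero (h : Holds L M S) (hu : Clean u) (a : V) :
    Implements (A := A) N (zero a) (4 * (L + 1) + 2) M u (L + 1) S := by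
  obtain ⟨M', h1, h2⟩ := exists_store (A := A) (k := 0) (t := t2) (u := u) (h.mono (by omega : L ≤ L + 1))
    (by omega) a (by simp [hu.2.1]) (by omega)
  refine ⟨M', ?_, h2⟩
  rwa [← hu.2.1, update_eq_self] at h1

theorem compile_inc (h : Holds L M S) (hu : Clean u) (a : V) :
    Implements (A := A) N (inc a) (8 * (L + 1) + 4) M u (L + 1) S := by
  obtain ⟨M', h1, h2⟩ := exists_fetch (A := A) (t := t2) (h.mono (by omega : L ≤ L + 1)) (by omega) a
    hu.1 hu.2.1 (by simp)
  obtain ⟨M'', h3, h4⟩ := exists_store (A := A) (k := S a 0 + 1) (t := t2)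
    (u := update (update u t2 (List.replicate (S a 0) true)) t2
      (true :: List.replicate (S a 0) true)) h2
    (by omega) a (by simp [List.replicate_succ]) (by have := h.le a; omega)
  refine ⟨M'', ?_, h4⟩
  have h5 := Ex.push (A := A) (B := hold M' (update u t2 (List.replicate (S a 0) true)))
    (Sum.inr t2) true
  rw [update_hold_inr] at h5
  simp only [hold_inr, update_self] at h5
  rw [update_idem] at h3 h5
  rw [clean_update hu.2.1] at h3
  exact (h1.seq (h5.seq h3)).mono (by omega)

theorem compile_read (h : Holds L M S) (hu : Clean u) (a b i : V) :
    Implements (A := A) N (read a b i) (8 * (L + 1) + 4 + (4 * (L + 1) * (L + 1 + 4) + 4)) M u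
      (L + 1) S := by
  obtain ⟨M1, h1, k1⟩ := exists_fetch (A := A) (t := t2) (h.mono (by omega : L ≤ L + 1)) (by omega) i
    hu.1 hu.2.1 (by simp)
  obtain ⟨M2, h2, k2⟩ := exists_getAt (A := A) (k := S i 0)
    (u := update u t2 (List.replicate (S i 0) true)) k1 (by simp [hu.1, hu.2.2.1, hu.2.2.2])
    (by simp) (by have := h.le i; omega) b
  rw [clean_update hu.2.1] at h2
  obtain ⟨M3, h3, k3⟩ := exists_store (A := A) (k := S b (S i 0)) (t := t4)
    (u := update u t4 (List.replicate (S b (S i 0)) true)) k2 (by omega) a (by simp)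
    (by have := h.le' b (S i 0); omega)
  rw [clean_update hu.2.2.2] at h3
  exact ⟨M3, (h1.seq (h2.seq h3)).mono (by omega), k3⟩

theorem compile_write (h : Holds L M S) (hu : Clean u) (a i b : V) :
    Implements (A := A) N (write a i b) (8 * (L + 1) + 4 + (4 * (L + 1) * (L + 1 + 4) + 4)) M u
      (L + 1) S := by
  obtain ⟨M1, h1, k1⟩ := exists_fetch (A := A) (t := t4) (h.mono (by omega : L ≤ L + 1)) (by omega) b
    hu.1 hu.2.2.2 (by simp)
  obtain ⟨M2, h2, k2⟩ := exists_fetch (A := A) (t := t2)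
    (u := update u t4 (List.replicate (S b 0) true)) k1 (by omega) i
    (by simp [hu.1]) (by simp [hu.2.1]) (by simp)
  obtain ⟨M3, h3, k3⟩ := exists_setAt (A := A) (k := S i 0) (v := S b 0)
    (u := update (update u t4 (List.replicate (S b 0) true)) t2 (List.replicate (S i 0) true)) k2
    (by simp [hu.1, hu.2.2.1]) (by simp) (by simp)
    (by have := h.le b; omega) (by have := h.le i; omega) a
  have e : update (update (update (update u t4 (List.replicate (S b 0) true)) t2
      (List.replicate (S i 0) true)) t2 []) t4 [] = u := by
    funext s
    by_cases hs : s = t4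
    · subst hs; simp [hu.2.2.2]
    · by_cases hs' : s = t2
      · subst hs'; simp [hu.2.1]
      · simp [hs, hs']
  rw [e] at h3
  exact ⟨M3, (h1.seq (h2.seq h3)).mono (by omega), k3⟩

theorem Ex.drain_aux (h : u t = List.replicate k true) :
    Ex (loopT (.inr t) .skip : StackProg (alphabet A (V ⊕ AuxStack))) (hold M u)
      (hold M (update u t [])) (2 * k + 1) := by
  have := Ex.drain (A := A) (B := hold M u) (x := Sum.inr t) (k := k) (r := []) (by simp [h])
    (by simp)
  rwa [update_hold_inr] at this

theorem compile_ifLe (h : Holds L M S) (hu : Clean u) (a b : V) (c d : ArrProg V) {T L' : ℕ}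
    (hc : S a 0 ≤ S b 0 → ∀ M, Holds (L + 1) M S → Implements (A := A) N c T M u L' S)
    (hd : S b 0 < S a 0 → ∀ M, Holds (L + 1) M S → Implements (A := A) N d T M u L' S) :
    Implements (A := A) N (ifLe a b c d) (15 * (L + 1) + 8 + T) M u L' S := by
  obtain ⟨M1, h1, k1⟩ := exists_fetch (A := A) (t := t2) (h.mono (by omega : L ≤ L + 1)) (by omega) a
    hu.1 hu.2.1 (by simp)
  obtain ⟨M2, h2, k2⟩ := exists_fetch (A := A) (t := t4)
    (u := update u t2 (List.replicate (S a 0) true)) k1 (by omega) b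
    (by simp [hu.1]) (by simp [hu.2.2.2]) (by simp)
  have h3 := compare_spec (A := A) (M := M2) (p := S a 0) (q := S b 0) (r := 0)
    (u := update (update u t2 (List.replicate (S a 0) true)) t4 (List.replicate (S b 0) true))
    (by simp) (by simp) (by simp [hu.2.2.1])
  have e1 : update (update (update (update (update u t2 (List.replicate (S a 0) true)) t4
      (List.replicate (S b 0) true)) t2 []) t4 (List.replicate (S b 0 - S a 0) true)) t3
      (List.replicate (0 + (S a 0 - S b 0)) true) =
      update (update u t4 (List.replicate (S b 0 - S a 0) true)) t3
      (List.replicate (S a 0 - S b 0) true) := by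
    funext s
    by_cases hs : s = t4
    · subst hs; simp
    · by_cases hs' : s = t2
      · subst hs'; simp [hu.2.1]
      · by_cases hs'' : s = t3
        · subst hs''; simp
        · simp [hs, hs', hs'']
  rw [e1] at h3
  have h4 := Ex.drain_aux (A := A) (t := t4) (M := M2) (k := S b 0 - S a 0)
    (u := update (update u t4 (List.replicate (S b 0 - S a 0) true)) t3
      (List.replicate (S a 0 - S b 0) true)) (by simp)
  have e2 : update (update (update u t4 (List.replicate (S b 0 - S a 0) true)) t3
      (List.replicate (S a 0 - S b 0) true)) t4 [] =
      update u t3 (List.replicate (S a 0 - S b 0) true) := by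
    funext s
    by_cases hs : s = t4
    · subst hs; simp [hu.2.2.2]
    · by_cases hs'' : s = t3
      · subst hs''; simp
      · simp [hs, hs'']
  rw [e2] at h4
  have hla := h.le a
  have hlb := h.le b
  have key : ∃ M', Ex (caseB (.inr t3) fun o => match o with
        | none => compile c
        | some _ => .seq (loopT (.inr t3) .skip) (compile d) :
        StackProg (alphabet A (V ⊕ AuxStack)))
      (hold M2 (update u t3 (List.replicate (S a 0 - S b 0) true))) (hold M' u)
      (2 * (L + 1) + 1 + T + 1) ∧ Holds L' M' (eval N (ifLe a b c d) S) := by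
    by_cases hab : S a 0 ≤ S b 0
    · obtain ⟨M', h5, k5⟩ := hc hab M2 k2
      refine ⟨M', (Ex.case (T := T) ?_).mono (by omega), by simpa [eval, hab] using k5⟩
      simp only [hold_inr, update_self, Nat.sub_eq_zero_of_le hab, List.replicate_zero,
        List.head?_nil, List.tail_nil]
      rw [update_hold_inr, clean_update hu.2.2.1]
      exact h5
    · obtain ⟨e, he⟩ : ∃ e, S a 0 - S b 0 = e + 1 := ⟨S a 0 - S b 0 - 1, by omega⟩
      obtain ⟨M', h5, k5⟩ := hd (by omega) M2 k2
      refine ⟨M', (Ex.case (T := 2 * (L + 1) + 1 + T) ?_), by simpa [eval, hab] using k5⟩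
      simp only [hold_inr, update_self, he, List.replicate_succ, List.head?_cons, List.tail_cons]
      have h6 := Ex.drain_aux (A := A) (t := t3) (M := M2) (k := e)
        (u := update u t3 (List.replicate e true)) (by simp)
      rw [clean_update hu.2.2.1] at h6
      rw [update_hold_inr, update_idem]
      exact (h6.seq h5).mono (by omega)
  obtain ⟨M', h5, k5⟩ := key
  exact ⟨M', (h1.seq (h2.seq (h3.seq (h4.seq h5)))).mono (by omega), k5⟩

/-- Nested loops share the stack `ctr`: the counters of enclosing loops lie in `r`, and a letter
other than `true` on top of `r` shields them from this loop, which pops that letter when it ends. -/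
theorem compile_iterate (c : ArrProg V) {B T K : ℕ} {r : List Bool}
    (hr : r.head? ≠ some true)
    (hc : ∀ L M S u, Clean u → u nst = List.replicate N true → Holds L M S → L + K ≤ B →
      Implements (A := A) N c T M u (L + K) S) :
    ∀ m L M S u, Clean u → u nst = List.replicate N true →
      u ctr = List.replicate m true ++ r → Holds L M S → L + m * K ≤ B →
      ∃ M', Ex (loopT (.inr ctr) (compile c) : StackProg (alphabet A (V ⊕ AuxStack))) (hold M u)
        (hold M' (update u ctr r.tail)) (m * (T + 2) + 1) ∧
        Holds (L + m * K) M' ((eval N c)^[m] S) := by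
  intro m
  induction m with
  | zero =>
    intro L M S u hu hN h1 h hB
    have h1' : u ctr = r := by simpa using h1
    refine ⟨M, ?_, by simpa using h⟩
    have := Ex.loop_done (A := A) (B := hold M u) (x := Sum.inr ctr) (c := compile c)
      (by rw [hold_inr, h1']; exact hr)
    rw [update_hold_inr, hold_inr, h1'] at this
    exact this.mono (by omega)
  | succ m ih =>
    intro L M S u hu hN h1 h hB
    rw [Nat.add_one_mul] at hB
    obtain ⟨M1, h2, k2⟩ := hc L M S (update u ctr (List.replicate m true ++ r))
      (by simpa [Clean] using hu) (by simpa using hN) h (by omega)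
    obtain ⟨M2, h3, k3⟩ := ih (L + K) M1 (eval N c S)
      (update u ctr (List.replicate m true ++ r))
      (by simpa [Clean] using hu) (by simpa using hN) (by simp) k2 (by omega)
    rw [update_idem] at h3
    refine ⟨M2, ?_, ?_⟩
    · rw [← update_hold_inr] at h2
      refine (Ex.loop_go (A := A) (B := hold M u) (x := Sum.inr ctr)
        (s := List.replicate m true ++ r) (by simp [h1, List.replicate_succ]) h2 h3).mono
        (?_ : T + 2 + (m * (T + 2) + 1) ≤ _)
      rw [Nat.add_one_mul]; omega
    · rw [iterate_succ_apply]
      exact k3.mono (by rw [Nat.add_one_mul]; omega)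

/-- A separator is pushed on `ctr` before the counter. The number `N` is copied by way of `t1`, so
that `nst` is intact again for later loops. -/
theorem compile_rep (c : ArrProg V) {B T K : ℕ} (h : Holds L M S) (hu : Clean u)
    (hN : u nst = List.replicate N true) (hB : L + N * K ≤ B)
    (hc : ∀ L M S u, Clean u → u nst = List.replicate N true → Holds L M S → L + K ≤ B →
      Implements (A := A) N c T M u (L + K) S) :
    Implements (A := A) N (rep c) (4 * N + 3 + N * (T + 2)) M u (L + N * K) S := by
  have h1 := Ex.push (A := A) (B := hold M u) (Sum.inr ctr) false
  have h2 := Ex.move (A := A) (B := update (hold M u) (Sum.inr ctr)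
    (false :: hold M u (Sum.inr ctr))) (x := Sum.inr nst) (y := Sum.inr t1) (k := N) (r := [])
    (by simp) (by simp [hN]) (by simp)
  have h3 := Ex.move₂ (A := A) (B := update (update (update (hold M u) (Sum.inr ctr)
    (false :: hold M u (Sum.inr ctr))) (Sum.inr nst) ([] : List Bool).tail) (Sum.inr t1)
    (List.replicate N true ++ update (hold M u) (Sum.inr ctr)
    (false :: hold M u (Sum.inr ctr)) (Sum.inr t1))) (x := Sum.inr t1) (y := Sum.inr nst)
    (z := Sum.inr ctr) (k := N) (r := [])
    (by simp) (by simp) (by simp) (by simp [hu.1]) (by simp)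
  set v := update u ctr (List.replicate N true ++ false :: u ctr) with hv
  obtain ⟨M', h4, k4⟩ := compile_iterate (A := A) c (r := false :: u ctr) (by simp) hc N L M S v
    (by simpa [Clean, hv] using hu) (by simpa [hv] using hN) (by simp [hv]) h hB
  refine ⟨M', ?_, k4⟩
  have e2 : update v ctr (false :: u ctr).tail = u := by simp [hv]
  rw [e2] at h4
  have h5 := h1.seq (h2.seq (h3.seq (c := _) (d := loopT (.inr ctr) (compile c))
    (B'' := hold M' u) (T' := N * (T + 2) + 1) ?_))
  · exact h5.mono (by omega)
  · convert h4 using 1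
    simp only [update_hold_inr, hold_inr]
    congr 1
    funext s
    cases s <;> simp [hv, hu.1, hN]

/-- The implementation of a program is correct, and its time is polynomial. -/
theorem compile_spec (c : ArrProg V) {B : ℕ} : ∀ L M S u, Clean u →
    u nst = List.replicate N true → Holds L M S → L + (ops c).eval N ≤ B →
    Implements (A := A) N c ((ops c).eval N * opCost B N) M u (L + (ops c).eval N) S := by
  have mono : ∀ {c : ArrProg V} {T T' M u L L' S}, Implements (A := A) N c T M u L S → T ≤ T' →
      L ≤ L' → Implements (A := A) N c T' M u L' S := by
    rintro c T T' M u L L' S ⟨M', h1, h2⟩ hT hL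
    exact ⟨M', h1.mono hT, h2.mono hL⟩
  -- An operation raises the bound for numbers and lengths by at most one. Hence everything stays
  -- below `B`, and the same `opCost B N` pays for each operation.
  have hQ := le_opCost B N
  induction c with
  | skip => exact fun L M S u hu hN h hB => ⟨M, Ex.skip.mono (Nat.zero_le _), h.mono (by omega)⟩
  | seq c d ihc ihd =>
    intro L M S u hu hN h hB
    simp only [ops, Polynomial.eval_add] at hB ⊢
    obtain ⟨M1, h1, k1⟩ := ihc L M S u hu hN h (by omega)
    obtain ⟨M2, h2, k2⟩ := ihd _ M1 _ u hu hN k1 (by omega)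
    exact ⟨M2, (h1.seq h2).mono (by rw [add_mul]), k2.mono (by omega)⟩
  | zero a =>
    intro L M S u hu hN h hB
    simp only [ops, Polynomial.eval_one] at hB ⊢
    exact mono (compile_zero h hu a) (by nlinarith) le_rfl
  | inc a =>
    intro L M S u hu hN h hB
    simp only [ops, Polynomial.eval_one] at hB ⊢
    exact mono (compile_inc h hu a) (by nlinarith) le_rfl
  | read a b i =>
    intro L M S u hu hN h hB
    simp only [ops, Polynomial.eval_one] at hB ⊢
    refine mono (compile_read h hu a b i) ?_ le_rfl
    have : 4 * (L + 1) * (L + 5) ≤ 4 * B * (B + 4) := Nat.mul_le_mul (by omega) (by omega)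
    nlinarith
  | write a i b =>
    intro L M S u hu hN h hB
    simp only [ops, Polynomial.eval_one] at hB ⊢
    refine mono (compile_write h hu a i b) ?_ le_rfl
    have : 4 * (L + 1) * (L + 5) ≤ 4 * B * (B + 4) := Nat.mul_le_mul (by omega) (by omega)
    nlinarith
  | ifLe a b c d ihc ihd =>
    intro L M S u hu hN h hB
    simp only [ops, Polynomial.eval_add, Polynomial.eval_one] at hB ⊢
    refine mono (compile_ifLe h hu a b c d
      (T := ((ops c).eval N + (ops d).eval N) * opCost B N)
      (L' := L + (1 + ((ops c).eval N + (ops d).eval N)))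
      (fun _ M hM => mono (ihc _ M S u hu hN hM (by omega)) ?_ (by omega))
      (fun _ M hM => mono (ihd _ M S u hu hN hM (by omega)) ?_ (by omega))) ?_ le_rfl
    · exact Nat.mul_le_mul_right _ (by omega)
    · exact Nat.mul_le_mul_right _ (by omega)
    · rw [Nat.add_mul 1]
      nlinarith
  | rep c ih =>
    intro L M S u hu hN h hB
    rw [ops_rep] at hB ⊢
    have h1 : N * ((ops c).eval N + 1) = N * (ops c).eval N + N := by ring
    refine mono (compile_rep c h hu hN (B := B) (by omega) ih) ?_ (by omega)
    generalize (ops c).eval N = K at *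
    have e : (N * (K + 1) + 1) * opCost B N =
      N * (K * opCost B N) + N * opCost B N + opCost B N := by ring
    have e2 : N * (K * opCost B N + 2) = N * (K * opCost B N) + 2 * N := by ring
    rw [e, e2]
    have : 6 * N + 3 ≤ opCost B N := by nlinarith
    have := Nat.zero_le (N * opCost B N)
    omega

end ArrProg

/-! ### Loading the input -/

namespace ArrProg

open Function StackProg AuxStack

/-- The numbers that a binary word encodes when a final `false` is added. -/
def entries : List Bool → List ℕ
  | [] => [0]
  | false :: w => 0 :: entries w
  | true :: w => ((entries w).headD 0 + 1) :: (entries w).tail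

theorem entries_ne_nil (w : List Bool) : entries w ≠ [] := by
  rcases w with _ | ⟨_ | _, w⟩ <;> simp [entries]

theorem listCode_nil : listCode [] = [] := rfl

/-- With a final `false`, every word is the code of a list, so that decoding never fails. The words
that are list codes themselves are recognised by a last entry `0`. -/
theorem listCode_entries (w : List Bool) : listCode (entries w) = w ++ [false] := by
  induction w with
  | nil => simp [entries, listCode]
  | cons b w ih =>
    cases b with
    | false => rw [entries, listCode_cons, ih]; rfl
    | true =>
      obtain ⟨a, l, h⟩ := List.exists_cons_of_ne_nil (entries_ne_nil w)
      rw [entries, listCode_cons, h, List.cons_append, ← ih, h, listCode_cons]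
      rfl

theorem entries_listCode (l : List ℕ) : entries (listCode l) = l ++ [0] := by
  apply listCode_injective
  rw [listCode_entries, listCode_append]
  rfl

theorem length_entries (w : List Bool) : (entries w).length = w.count false + 1 := by
  induction w with
  | nil => rfl
  | cons b w ih =>
    cases b with
    | false => simp [entries, ih]
    | true =>
      have := List.length_pos_of_ne_nil (entries_ne_nil w)
      simp [entries, ih]

theorem entries_le (w : List Bool) : ∀ e ∈ entries w, e ≤ w.length := by
  induction w with
  | nil => simp [entries]
  | cons b w ih =>
    cases b with
    | false =>
      intro e he
      rcases List.mem_cons.1 he with rfl | he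
      · omega
      · exact (ih e he).trans (by simp)
    | true =>
      intro e he
      rcases List.mem_cons.1 he with rfl | he
      · have := headD_le ih
        simp only [List.length_cons]
        omega
      · exact (ih e (List.mem_of_mem_tail he)).trans (by simp)

variable {V : Type} [DecidableEq V]

/-- The arrays that present a pair of words: the encoded numbers and how many of them there are. -/
def inputLists (vx vy nx ny : V) (x y : List Bool) (a : V) : List ℕ :=
  if a = vx then entries x else if a = vy then entries y
  else if a = nx then [x.count false] else if a = ny then [y.count false] else []

/-- The auxiliary stacks during the input. -/
def inputAux (p q : List Bool) (r : ℕ) : AuxStack → List Bool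
  | t3 => p
  | t4 => q
  | nst => List.replicate r true
  | _ => []

/-- The stacks during the input. -/
def inputState (nx ny : V) (p q : List Bool) (r i j : ℕ) : V ⊕ AuxStack → List Bool :=
  hold (fun a => if a = nx then [i] else if a = ny then [j] else []) (inputAux p q r)

/-- Distribute the input word. -/
def inputLoop (nx ny : V) : StackProg (alphabet (Bool ⊕ Bool) (V ⊕ AuxStack)) :=
  loop none (fun o : Option (Bool ⊕ Bool) => o.isSome) fun o => match o with
    | some (.inl b) => .seq (pushB (.inr t3) b) (.seq (pushB (.inr nst) true)
        (if b then .skip else pushB (.inl nx) true))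
    | some (.inr b) => .seq (pushB (.inr t4) b) (.seq (pushB (.inr nst) true)
        (if b then .skip else pushB (.inl ny) true))
    | none => .skip

variable {nx ny : V}

theorem push_t3 (b : Bool) (p q : List Bool) (r i j : ℕ) {A : Type} :
    Ex (pushB (.inr t3) b : StackProg (alphabet A (V ⊕ AuxStack)))
      (inputState nx ny p q r i j) (inputState nx ny (b :: p) q r i j) 0 := by
  convert Ex.push (A := A) (B := inputState nx ny p q r i j) (Sum.inr t3) b using 1
  unfold inputState
  rw [update_hold_inr]
  congr 1
  funext s
  cases s <;> simp [inputAux]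

theorem push_t4 (b : Bool) (p q : List Bool) (r i j : ℕ) {A : Type} :
    Ex (pushB (.inr t4) b : StackProg (alphabet A (V ⊕ AuxStack)))
      (inputState nx ny p q r i j) (inputState nx ny p (b :: q) r i j) 0 := by
  convert Ex.push (A := A) (B := inputState nx ny p q r i j) (Sum.inr t4) b using 1
  unfold inputState
  rw [update_hold_inr]
  congr 1
  funext s
  cases s <;> simp [inputAux]

theorem push_nst (p q : List Bool) (r i j : ℕ) {A : Type} :
    Ex (pushB (.inr nst) true : StackProg (alphabet A (V ⊕ AuxStack)))
      (inputState nx ny p q r i j) (inputState nx ny p q (r + 1) i j) 0 := by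
  convert Ex.push (A := A) (B := inputState nx ny p q r i j) (Sum.inr nst) true using 1
  unfold inputState
  rw [update_hold_inr]
  congr 1
  funext s
  cases s <;> simp [inputAux, List.replicate_succ]

theorem push_nx (p q : List Bool) (r i j : ℕ) {A : Type} :
    Ex (pushB (.inl nx) true : StackProg (alphabet A (V ⊕ AuxStack)))
      (inputState nx ny p q r i j) (inputState nx ny p q r (i + 1) j) 0 := by
  convert Ex.push (A := A) (B := inputState nx ny p q r i j) (Sum.inl nx) true using 1
  have : true :: inputState nx ny p q r i j (Sum.inl nx) = listCode [i + 1] := by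
    simp [inputState, listCode, List.replicate_succ]
  rw [this]
  unfold inputState
  rw [update_hold_inl]
  congr 1
  funext s
  by_cases hs : s = nx <;> simp [hs]

theorem push_ny (hn : nx ≠ ny) (p q : List Bool) (r i j : ℕ) {A : Type} :
    Ex (pushB (.inl ny) true : StackProg (alphabet A (V ⊕ AuxStack)))
      (inputState nx ny p q r i j) (inputState nx ny p q r i (j + 1)) 0 := by
  convert Ex.push (A := A) (B := inputState nx ny p q r i j) (Sum.inl ny) true using 1
  have : true :: inputState nx ny p q r i j (Sum.inl ny) = listCode [j + 1] := by
    simp [inputState, listCode, List.replicate_succ, hn.symm]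
  rw [this]
  unfold inputState
  rw [update_hold_inl]
  congr 1
  funext s
  by_cases hs : s = ny
  · simp [hs, hn.symm]
  · simp [hs]

theorem inputLoop_go {a : Bool ⊕ Bool} {w : List (Bool ⊕ Bool)} {B B' : V ⊕ AuxStack → List Bool}
    {T : ℕ} {S'} (h : Ex (A := Bool ⊕ Bool) (match a with
      | .inl b => .seq (pushB (.inr t3) b) (.seq (pushB (.inr nst) true)
          (if b then .skip else pushB (.inl nx) true))
      | .inr b => .seq (pushB (.inr t4) b) (.seq (pushB (.inr nst) true)
          (if b then .skip else pushB (.inl ny) true))) B B' 0)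
    (h' : ∃ t ≤ T, Run (inputLoop nx ny) (conts w B') S' t) :
    ∃ t ≤ T + 2, Run (inputLoop nx ny) (conts (a :: w) B) S' t := by
  obtain ⟨t, ht, hr⟩ := h w
  obtain ⟨t', ht', hr'⟩ := h'
  rw [← update_conts_none (a :: w)] at hr
  refine ⟨t + 2 + t', by omega, Run.loop_go (Γ := alphabet (Bool ⊕ Bool) (V ⊕ AuxStack))
    (k := none) (S := conts (a :: w) B) (by simp [conts]) ?_ hr'⟩
  rcases a with b | b <;> exact hr

theorem step_inl (b : Bool) (p q : List Bool) (r i j : ℕ) {A : Type} :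
    Ex (.seq (pushB (.inr t3) b) (.seq (pushB (.inr nst) true)
        (if b then .skip else pushB (.inl nx) true)) : StackProg (alphabet A (V ⊕ AuxStack)))
      (inputState nx ny p q r i j)
      (inputState nx ny (b :: p) q (r + 1) (i + [b].count false) j) 0 := by
  refine (push_t3 b p q r i j).seq ((push_nst (b :: p) q r i j).seq (T' := 0) ?_)
  cases b
  · exact push_nx (nx := nx) (ny := ny) (false :: p) q (r + 1) i j
  · exact Ex.skip

theorem step_inr (hn : nx ≠ ny) (b : Bool) (p q : List Bool) (r i j : ℕ) {A : Type} :
    Ex (.seq (pushB (.inr t4) b) (.seq (pushB (.inr nst) true)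
        (if b then .skip else pushB (.inl ny) true)) : StackProg (alphabet A (V ⊕ AuxStack)))
      (inputState nx ny p q r i j)
      (inputState nx ny p (b :: q) (r + 1) i (j + [b].count false)) 0 := by
  refine (push_t4 b p q r i j).seq ((push_nst p (b :: q) r i j).seq (T' := 0) ?_)
  cases b
  · exact push_ny hn p (false :: q) (r + 1) i j
  · exact Ex.skip

theorem inputLoop_spec (hn : nx ≠ ny) (x y : List Bool) (p q : List Bool) (r i j : ℕ) :
    ∃ t ≤ 2 * (x.length + y.length) + 1, Run (inputLoop nx ny)
      (conts (x.map Sum.inl ++ y.map Sum.inr) (inputState nx ny p q r i j))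
      (conts [] (inputState nx ny (x.reverse ++ p) (y.reverse ++ q) (r + x.length + y.length)
        (i + x.count false) (j + y.count false))) t := by
  induction x generalizing p r i with
  | cons b x ih =>
    obtain ⟨t, ht, hr⟩ := inputLoop_go (a := Sum.inl b) (step_inl b p q r i j)
      (ih (p := b :: p) (r := r + 1) (i := i + [b].count false))
    refine ⟨t, by simp only [List.length_cons]; omega, ?_⟩
    have e1 : (b :: x).reverse ++ p = x.reverse ++ b :: p := by simp
    have e2 : r + (b :: x).length + y.length = r + 1 + x.length + y.length := by
      rw [List.length_cons]; omega
    have e3 : i + (b :: x).count false = i + [b].count false + x.count false := by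
      rw [List.count_cons, List.count_cons, List.count_nil]; omega
    rw [e1, e2, e3]
    exact hr
  | nil =>
    induction y generalizing q r j with
    | cons b y ih =>
      obtain ⟨t, ht, hr⟩ := inputLoop_go (a := Sum.inr b) (step_inr hn b p q r i j)
        (ih (q := b :: q) (r := r + 1) (j := j + [b].count false))
      refine ⟨t, by simp only [List.length_cons, List.length_nil] at ht ⊢; omega, ?_⟩
      have e1 : (b :: y).reverse ++ q = y.reverse ++ b :: q := by simp
      have e2 : r + ([] : List Bool).length + (b :: y).length =
          r + 1 + ([] : List Bool).length + y.length := by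
        rw [List.length_cons]; omega
      have e3 : j + (b :: y).count false = j + [b].count false + y.count false := by
        rw [List.count_cons, List.count_cons, List.count_nil]; omega
      rw [e1, e2, e3]
      exact hr
    | nil =>
      refine ⟨1, by omega, ?_⟩
      have : Run (inputLoop nx ny) (conts [] (inputState nx ny p q r i j)) _ 1 :=
        Run.loop_done (by simp [conts])
      rw [update_conts_none] at this
      exact this

/-- Load the input. -/
def load (vx vy nx ny : V) : StackProg (alphabet (Bool ⊕ Bool) (V ⊕ AuxStack)) :=
  .seq (pushB (.inl nx) false) (.seq (pushB (.inl ny) false) (.seq (pushB (.inr nst) true)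
    (.seq (pushB (.inr nst) true) (.seq (pushB (.inr nst) true) (.seq (pushB (.inr nst) true)
    (.seq (pushB (.inr nst) true) (.seq (inputLoop nx ny) (.seq (pushB (.inr t3) false)
    (.seq (pushB (.inr t4) false)
    (.seq (pour (.inr t3) (.inl vx)) (pour (.inr t4) (.inl vy))))))))))))

/-- The five letters pushed on `nst` beforehand make the number of repetitions exceed the length of
the input, with room for the few extra indices used later. The words arrive reversed on `t3` and
`t4`; a `false` pushed on top becomes the final `false` when they are poured out. -/
theorem load_spec {vx vy : V} (hx : vx ≠ nx) (hx' : vx ≠ ny) (hy : vy ≠ nx) (hy' : vy ≠ ny)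
    (hxy : vx ≠ vy) (hn : nx ≠ ny) (x y : List Bool) :
    ∃ t ≤ 4 * (x.length + y.length) + 7, Run (load vx vy nx ny)
      (conts (x.map Sum.inl ++ y.map Sum.inr) (fun _ => []))
      (conts [] (hold (inputLists vx vy nx ny x y)
        (inputAux [] [] (x.length + y.length + 5)))) t := by
  have s1 : Ex (pushB (.inl nx) false : StackProg (alphabet (Bool ⊕ Bool) (V ⊕ AuxStack)))
      (fun _ => []) (hold (update (fun _ => []) nx [0]) (inputAux [] [] 0)) 0 := by
    convert Ex.push (A := Bool ⊕ Bool) (B := fun _ => []) (Sum.inl nx) false using 1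
    have e : (fun _ : V ⊕ AuxStack => ([] : List Bool)) = hold (fun _ => []) (inputAux [] [] 0) := by
      funext s
      rcases s with s | s
      · simp [listCode]
      · cases s <;> simp [inputAux]
    rw [e, show [false] = listCode [0] from rfl, update_hold_inl]
  have s2 : Ex (pushB (.inl ny) false : StackProg (alphabet (Bool ⊕ Bool) (V ⊕ AuxStack)))
      (hold (update (fun _ => []) nx [0]) (inputAux [] [] 0)) (inputState nx ny [] [] 0 0 0) 0 := by
    convert Ex.push (A := Bool ⊕ Bool) (B := hold (update (fun _ => []) nx [0])
      (inputAux [] [] 0)) (Sum.inl ny) false using 1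
    have : false :: hold (update (fun _ => []) nx [0]) (inputAux [] [] 0) (Sum.inl ny) =
      listCode [0] := by simp [hn.symm, listCode]
    rw [this, update_hold_inl, inputState]
    congr 1
    funext s
    by_cases h : s = nx
    · subst h; simp [hn]
    · by_cases h' : s = ny
      · subst h'; simp [h]
      · simp [h, h']
  have s3 := fun r => push_nst (nx := nx) (ny := ny) [] [] r 0 0 (A := Bool ⊕ Bool)
  obtain ⟨T, hT, s4⟩ := inputLoop_spec hn x y [] [] 5 0 0
  have s5 := push_t3 (nx := nx) (ny := ny) (A := Bool ⊕ Bool) false (x.reverse ++ [])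
    (y.reverse ++ []) (5 + x.length + y.length) (0 + x.count false) (0 + y.count false)
  have s6 := push_t4 (nx := nx) (ny := ny) (A := Bool ⊕ Bool) false (false :: (x.reverse ++ []))
    (y.reverse ++ []) (5 + x.length + y.length) (0 + x.count false) (0 + y.count false)
  have s7 := Ex.pour (A := Bool ⊕ Bool) (B := inputState nx ny (false :: (x.reverse ++ []))
    (false :: (y.reverse ++ [])) (5 + x.length + y.length) (0 + x.count false)
    (0 + y.count false)) (x := Sum.inr t3) (y := Sum.inl vx) (by simp)
  set B1 := update (update (inputState nx ny (false :: (x.reverse ++ []))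
    (false :: (y.reverse ++ [])) (5 + x.length + y.length) (0 + x.count false)
    (0 + y.count false)) (Sum.inr t3) []) (Sum.inl vx) _ with hB1
  have s8 := Ex.pour (A := Bool ⊕ Bool) (B := B1) (x := Sum.inr t4) (y := Sum.inl vy) (by simp)
  have e : update (update B1 (Sum.inr t4) []) (Sum.inl vy)
      ((B1 (Sum.inr t4)).reverse ++ B1 (Sum.inl vy)) = hold (inputLists vx vy nx ny x y)
        (inputAux [] [] (x.length + y.length + 5)) := by
    funext s
    rcases s with s | s
    · simp only [hB1, inputState, inputAux, inputLists, hold_inl, hold_inr]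
      by_cases h1 : s = vx
      · subst h1
        simp [hx, hx', hxy, listCode_entries, inputAux, listCode_nil]
      · by_cases h2 : s = vy
        · subst h2
          simp [hy, hy', hxy.symm, listCode_entries, inputAux, listCode_nil]
        · simp [h1, h2]
    · cases s <;> simp [hB1, inputState, inputAux]
      omega
  rw [e] at s8
  have post := s5.seq (s6.seq (s7.seq s8))
  obtain ⟨t1, ht1, r1⟩ := s1 (x.map Sum.inl ++ y.map Sum.inr)
  obtain ⟨t2, ht2, r2⟩ := s2 (x.map Sum.inl ++ y.map Sum.inr)
  obtain ⟨t3, ht3, r3⟩ := s3 0 (x.map Sum.inl ++ y.map Sum.inr)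
  obtain ⟨t4, ht4, r4⟩ := s3 1 (x.map Sum.inl ++ y.map Sum.inr)
  obtain ⟨t5, ht5, r5⟩ := s3 2 (x.map Sum.inl ++ y.map Sum.inr)
  obtain ⟨t6, ht6, r6⟩ := s3 3 (x.map Sum.inl ++ y.map Sum.inr)
  obtain ⟨t7, ht7, r7⟩ := s3 4 (x.map Sum.inl ++ y.map Sum.inr)
  obtain ⟨t8, ht8, r8⟩ := post []
  refine ⟨_, ?_, r1.seq (r2.seq (r3.seq (r4.seq (r5.seq (r6.seq (r7.seq (s4.seq r8)))))))⟩
  have l1 : (inputState nx ny (false :: (x.reverse ++ [])) (false :: (y.reverse ++ []))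
      (5 + x.length + y.length) (0 + x.count false) (0 + y.count false)
      (Sum.inr AuxStack.t3)).length = x.length + 1 := by simp [inputState, inputAux]
  have l2 : (B1 (Sum.inr AuxStack.t4)).length = y.length + 1 := by
    simp [hB1, inputState, inputAux]
  rw [l1, l2] at ht8
  omega

end ArrProg

/-! ### Clearing the stacks before halting -/

namespace StackProg

open Function

variable {A X : Type} [DecidableEq X] {B : X → List Bool} {x : X}

/-- Empty a stack. -/
def clear (x : X) : StackProg (alphabet A X) :=
  loop (some x) (fun o : Option Bool => o.isSome) fun _ => skip

theorem Ex.clear : Ex (clear x : StackProg (alphabet A X)) B (update B x [])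
    (2 * (B x).length + 1) := fun w => by
  induction hs : B x generalizing B with
  | nil =>
    refine ⟨1, by simp, ?_⟩
    have : Run (StackProg.clear x : StackProg (alphabet A X)) (conts w B) _ 1 :=
      Run.loop_done (k := some x) (S := conts w B) (by simp [conts, hs])
    rw [update_conts_some] at this
    have h2 : (conts w B (some x)).tail = [] := by simp [conts, hs]
    rwa [h2] at this
  | cons b s ih =>
    obtain ⟨t, ht, hr⟩ := ih (B := update B x s) (by simp)
    refine ⟨0 + 2 + t, by simp at ht ⊢; omega, ?_⟩
    rw [update_idem] at hr
    refine Run.loop_go (k := some x) (S := conts w B) (by simp [conts, hs]) ?_ hr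
    have h3 : (conts w B (some x)).tail = s := by simp [conts, hs]
    rw [h3, update_conts_some]
    exact Run.skip _

/-- Empty several stacks. -/
def clearAll (l : List X) : StackProg (alphabet A X) := l.foldr (fun x c => seq (clear x) c) skip

theorem Ex.clearAll {D : ℕ} (l : List X) (h : ∀ x, (B x).length ≤ D) :
    ∃ B', Ex (clearAll l : StackProg (alphabet A X)) B B' (l.length * (2 * D + 1)) ∧
      (∀ x ∈ l, B' x = []) ∧ ∀ x ∉ l, B' x = B x := by
  induction l generalizing B with
  | nil => exact ⟨B, Ex.skip.mono (Nat.zero_le _), by simp, by simp⟩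
  | cons x l ih =>
    obtain ⟨B', h1, h2, h3⟩ := ih (B := update B x []) fun y => by
      by_cases hy : y = x
      · simp [hy]
      · simpa [hy] using h y
    refine ⟨B', ((Ex.clear (A := A) (B := B) (x := x)).seq h1).mono ?_, fun y hy => ?_,
      fun y hy => ?_⟩
    · have := h x
      have := Nat.add_one_mul l.length (2 * D + 1)
      rw [List.length_cons]
      omega
    · by_cases hl : y ∈ l
      · exact h2 y hl
      · rw [h3 y hl, (List.mem_cons.1 hy).resolve_right hl, update_self]
    · rw [List.mem_cons, not_or] at hy
      rw [h3 y hy.2, update_of_ne hy.1]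

end StackProg

/-! ### From array programs to polynomial-time machines -/

namespace ArrProg

open Function StackProg AuxStack Turing

variable {V : Type} [DecidableEq V]

omit [DecidableEq V] in
theorem length_hold {M : V → List ℕ} {S : V → ℕ → ℕ} {L N : ℕ} (h : Holds L M S) (hN : N ≤ L)
    (s : V ⊕ AuxStack) : (hold M (inputAux [] [] N) s).length ≤ L * (L + 1) := by
  rcases s with a | t
  · exact (length_listCode (h a).2.2).trans (Nat.mul_le_mul_right _ (h a).2.1)
  · have : L ≤ L * (L + 1) := Nat.le_mul_of_pos_right _ (by omega)
    cases t <;> simp [inputAux]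
    omega

/-- The arrays that present a pair of words. -/
def input (vx vy nx ny : V) (x y : List Bool) (a : V) (i : ℕ) : ℕ :=
  (inputLists vx vy nx ny x y a).getD i 0

theorem holds_input {vx vy nx ny : V} {x y : List Bool} {N : ℕ} (hN : x.length + y.length + 5 ≤ N) :
    Holds N (inputLists vx vy nx ny x y) (input vx vy nx ny x y) := by
  intro a
  refine ⟨fun _ => rfl, ?_⟩
  have hx := List.count_le_length (a := false) (l := x)
  have hy := List.count_le_length (a := false) (l := y)
  unfold inputLists
  split_ifs
  · exact ⟨by rw [length_entries]; omega, fun e he => (entries_le x e he).trans (by omega)⟩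
  · exact ⟨by rw [length_entries]; omega, fun e he => (entries_le y e he).trans (by omega)⟩
  · exact ⟨by simp; omega, by simp; omega⟩
  · exact ⟨by simp; omega, by simp; omega⟩
  · simp

/-- A program on arrays together with a program for its output computes a function in polynomial
time. -/
theorem polyTime_of_prog [Fintype V] (c : ArrProg V)
    (fin : StackProg (alphabet (Bool ⊕ Bool) (V ⊕ AuxStack))) (vx vy nx ny : V)
    (hd : [vx, vy, nx, ny].Nodup) (q : Polynomial ℕ) {α β : Type} {ea : α → List (Bool ⊕ Bool)}
    {eb : β → List Bool} {f : α → β}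
    (h : ∀ a, ∃ x y, ea a = pairCode (x, y) ∧ ∀ M L, x.length + y.length + 5 ≤ L →
      Holds L M (eval (x.length + y.length + 5) c (input vx vy nx ny x y)) →
      ∃ B', Ex fin (hold M (inputAux [] [] (x.length + y.length + 5))) B' (q.eval L) ∧
        B' (.inr out) = eb (f a) ∧ ∀ z, (B' z).length ≤ q.eval L) :
    Nonempty (TM2ComputableInPolyTime ea eb f) := by
  let l : List (V ⊕ AuxStack) := (Finset.univ.erase (.inr out)).toList
  -- The program starts with the bound `N` for its numbers and ends with the value of `b` at `N`.
  -- All times are polynomials in `N`, whence the composition with `X + 5` below.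
  let b : Polynomial ℕ := Polynomial.X + ops c
  let p : Polynomial ℕ := 4 * Polynomial.X + 7 +
    (ops c * (20 * (b + Polynomial.X + 2) ^ 2) + (q.comp b + (l.length : Polynomial ℕ) *
      (2 * q.comp b + 1)))
  refine polyTime_of_run (.seq (load vx vy nx ny) (.seq (compile c) (.seq fin (clearAll l)))) none
    (some (.inr out)) (Equiv.refl _) (Equiv.refl _) (p.comp (Polynomial.X + 5)) fun a => ?_
  obtain ⟨x, y, e, h1⟩ := h a
  have e1 : ea a = x.map Sum.inl ++ y.map Sum.inr := e
  simp only [List.nodup_cons, List.mem_cons, List.not_mem_nil, or_false, not_or, not_false_eq_true,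
    List.nodup_nil, and_true] at hd
  obtain ⟨⟨d1, d2, d3⟩, ⟨d4, d5⟩, d6⟩ := hd
  obtain ⟨t1, ht1, r1⟩ := load_spec (nx := nx) (ny := ny) (vx := vx) (vy := vy) d2 d3 d4 d5 d1 d6 x y
  set N := x.length + y.length + 5 with hN
  obtain ⟨M, s2, k2⟩ := compile_spec (A := Bool ⊕ Bool) (N := N) c (B := N + (ops c).eval N) N
    (inputLists vx vy nx ny x y) (input vx vy nx ny x y) (inputAux [] [] N)
    ⟨rfl, rfl, rfl, rfl⟩ rfl (holds_input hN.ge) le_rfl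
  obtain ⟨B', s3, k3, k4⟩ := h1 M (N + (ops c).eval N) (by omega) k2
  obtain ⟨B'', s4, k5, k6⟩ := Ex.clearAll (A := Bool ⊕ Bool) l k4
  obtain ⟨t2, ht2, r2⟩ := s2 []
  obtain ⟨t3, ht3, r3⟩ := s3 []
  obtain ⟨t4, ht4, r4⟩ := s4 []
  refine ⟨t1 + (t2 + (t3 + t4)), ?_, ?_⟩
  · have e2 : (ea a).length = x.length + y.length := by rw [e1]; simp
    have e3 : (Polynomial.X + 5 : Polynomial ℕ).eval (ea a).length = N := by
      rw [Polynomial.eval_add, Polynomial.eval_X, e2, hN, Polynomial.eval_ofNat]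
    rw [Polynomial.eval_comp, e3]
    simp only [p, b, Polynomial.eval_add, Polynomial.eval_mul, Polynomial.eval_pow,
      Polynomial.eval_comp, Polynomial.eval_X, Polynomial.eval_ofNat, Polynomial.eval_natCast,
      Polynomial.eval_one]
    unfold opCost at ht2
    simp only [Nat.cast_id]
    omega
  · have e3 : update (fun _ => []) none ((ea a).map
        (Equiv.refl (alphabet (Bool ⊕ Bool) (V ⊕ AuxStack) none)).symm) =
        conts (x.map Sum.inl ++ y.map Sum.inr) (fun _ : V ⊕ AuxStack => []) := by
      rw [e1]
      funext k
      cases k <;> simp [conts]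
    have e4 : conts [] B'' =
        update (fun _ => []) (some (Sum.inr out)) ((eb (f a)).map
          (Equiv.refl (alphabet (Bool ⊕ Bool) (V ⊕ AuxStack) (some (Sum.inr out)))).symm) := by
      funext k
      cases k with
      | none => simp [conts]
      | some z =>
        by_cases hz : z = Sum.inr out
        · subst hz
          simp [conts, k6 (.inr out) (by simp [l]), k3]
        · simp [conts, k5 z (by simp [l, hz]), hz]
    have r5 := r1.seq (r2.seq (r3.seq r4))
    rw [e4] at r5
    rw [e3]
    exact r5

/-- A program on arrays whose result is a list of numbers. -/
theorem polyTime_of_prog_list [Fintype V] (c : ArrProg V) (vx vy nx ny o len : V)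
    (hd : [vx, vy, nx, ny].Nodup) {α β : Type} {ea : α → List (Bool ⊕ Bool)}
    {eb : β → List Bool} {f : α → β}
    (h : ∀ a, ∃ x y, ea a = pairCode (x, y) ∧ eb (f a) = listCode ((List.range
      (eval (x.length + y.length + 5) c (input vx vy nx ny x y) len 0)).map
      (eval (x.length + y.length + 5) c (input vx vy nx ny x y) o))) :
    Nonempty (TM2ComputableInPolyTime ea eb f) := by
  refine polyTime_of_prog c (.seq (fetch len t2) (.seq (shift o) (pour (.inr t3) (.inr out))))
    vx vy nx ny hd (20 * (Polynomial.X + 1) ^ 2) fun a => ?_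
  obtain ⟨x, y, e, h1⟩ := h a
  refine ⟨x, y, e, fun M L hN hL => ?_⟩
  set N := x.length + y.length + 5
  set S := eval N c (input vx vy nx ny x y)
  obtain ⟨M1, s1, k1⟩ := exists_fetch (A := Bool ⊕ Bool) (t := t2) (u := inputAux [] [] N) hL
    (by omega) len rfl rfl (by simp)
  have s2 := shift_spec (A := Bool ⊕ Bool) (M := M1) (b := o) (p := []) (L := L)
    (u := update (inputAux [] [] N) t2 (List.replicate (S len 0) true)) (i := S len 0) (by simp)
    (by simp [inputAux, listCode]) (k1 o).2.2
  set M2 := update M1 o ((M1 o).drop (S len 0))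
  have e2 : update (update (update (inputAux [] [] N) t2 (List.replicate (S len 0) true)) t2 []) t3
      (listCode ([] ++ padTake (S len 0) (M1 o))).reverse =
      update (inputAux [] [] N) t3 (listCode (padTake (S len 0) (M1 o))).reverse := by
    rw [clean_update rfl]; rfl
  rw [e2] at s2
  have s3 := Ex.pour (A := Bool ⊕ Bool) (B := hold M2 (update (inputAux [] [] N) t3
    (listCode (padTake (S len 0) (M1 o))).reverse)) (x := Sum.inr t3) (y := Sum.inr out) (by simp)
  have k5 : 2 * (listCode (padTake (S len 0) (M1 o))).length + 1 ≤ 2 * (L * (L + 1)) + 1 :=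
    length_padTake_code (k1 o).2.2 (k1.le len)
  have e3 : hold M2 (update (inputAux [] [] N) t3
    (listCode (padTake (S len 0) (M1 o))).reverse) (Sum.inr t3) =
      (listCode (padTake (S len 0) (M1 o))).reverse := by simp
  have e4 : hold M2 (update (inputAux [] [] N) t3
    (listCode (padTake (S len 0) (M1 o))).reverse) (Sum.inr out) = [] := by simp [inputAux]
  rw [e3, e4, List.reverse_reverse, List.append_nil, List.length_reverse] at s3
  have e5 : (20 * (Polynomial.X + 1) ^ 2 : Polynomial ℕ).eval L = 20 * (L + 1) ^ 2 := by simp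
  rw [e5]
  refine ⟨_, (s1.seq (s2.seq s3)).mono ?_, ?_, fun z => ?_⟩
  · have := shift_cost (k1.le len)
    nlinarith
  · have e6 : ∀ (n : ℕ) (l : List ℕ), padTake n l = (List.range n).map fun i => l.getD i 0 := by
      intro n
      induction n with
      | zero => intro l; rfl
      | succ n ih =>
        intro l
        rw [padTake, ih, List.range_succ_eq_map, List.map_cons, List.map_map, headD_eq_getD]
        simp only [Function.comp_def, getD_tail]
    rw [update_self, h1, e6]
    simp only [(k1 o).1]
  · have key : (hold M2 (inputAux [] [] N) z).length ≤ L * (L + 1) := by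
      rcases z with a | t
      · by_cases ha : a = o
        · subst ha
          refine (length_listCode (L := L) (fun w hw => (k1 a).2.2 w ?_)).trans
            (Nat.mul_le_mul_right _ ?_)
          · simp only [M2, update_self] at hw
            exact List.mem_of_mem_drop hw
          · simp only [M2, update_self, List.length_drop]
            have := (k1 a).2.1
            omega
        · have := length_hold k1 (by omega : N ≤ L) (Sum.inl a)
          simpa [M2, ha] using this
      · exact length_hold k1 (by omega : N ≤ L) (Sum.inr t)
    by_cases hz : z = .inr out
    · subst hz
      rw [update_self]
      nlinarith
    · rw [update_of_ne hz]
      by_cases hz' : z = .inr t3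
      · subst hz'
        simp
      · rw [update_of_ne hz']
        rcases z with a | t
        · rw [hold_inl] at key ⊢
          nlinarith
        · rw [hold_inr] at key ⊢
          rw [update_of_ne (by simpa using hz')]
          nlinarith

/-- A program on arrays that decides a relation. -/
theorem polyTime_of_prog_bool [Fintype V] (c : ArrProg V) (vx vy nx ny r : V)
    (hd : [vx, vy, nx, ny].Nodup) {f : List Bool × List Bool → Bool}
    (h : ∀ x y, f (x, y) = true ↔
      0 < eval (x.length + y.length + 5) c (input vx vy nx ny x y) r 0) :
    Nonempty (TM2ComputableInPolyTime pairCode Computability.encodeBool f) := by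
  refine polyTime_of_prog c (caseB (.inl r) fun o => pushB (.inr out) (decide (o = some true)))
    vx vy nx ny hd (20 * (Polynomial.X + 1) ^ 2) fun a => ⟨a.1, a.2, rfl, fun M L hN hL => ?_⟩
  set N := a.1.length + a.2.length + 5
  have e5 : (20 * (Polynomial.X + 1) ^ 2 : Polynomial ℕ).eval L = 20 * (L + 1) ^ 2 := by simp
  rw [e5]
  refine ⟨_, (Ex.case (Ex.push _ _)).mono (by nlinarith : 0 + 1 ≤ _), ?_, fun z => ?_⟩
  · rw [update_self, update_of_ne (by simp), hold_inr]
    have h1 : (hold M (inputAux [] [] N) (.inl r)).head? = some true ↔ f a = true := by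
      rw [show f a = f (a.1, a.2) from rfl, h, ← hL.headD r, hold_inl]
      cases hM : M r with
      | nil => simp [listCode]
      | cons v l =>
        cases v with
        | zero => simp [listCode]
        | succ v => simp [listCode, List.replicate_succ]
    simp only [h1, Bool.decide_eq_true]
    rfl
  · have key := fun z => length_hold hL (by omega : N ≤ L) z
    by_cases hz : z = .inr out
    · subst hz
      have := key (.inr out)
      rw [update_self, update_of_ne (by simp), List.length_cons]
      nlinarith
    · rw [update_of_ne hz]
      by_cases hz' : z = .inl r
      · subst hz'
        have := key (.inl r)
        rw [update_self, List.length_tail]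
        have : (hold M (inputAux [] [] N) (.inl r)).length - 1 ≤ L * (L + 1) := by omega
        nlinarith
      · rw [update_of_ne hz']
        have := key z
        nlinarith

end ArrProg

/-! ### Programs with expressions -/

namespace ArrProg

open Function

/-- Expressions for numbers. -/
inductive Expr (V : Type) : Type
  | lit (n : ℕ) : Expr V
  | get (a : V) (e : Expr V) : Expr V
  | succ (e : Expr V) : Expr V

/-- Conditions. -/
inductive Cond (V : Type) : Type
  | le (e f : Expr V) : Cond V
  | and (p q : Cond V) : Cond V
  | not (p : Cond V) : Cond V

/-- Programs with expressions. -/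
inductive Cmd (V : Type) : Type
  | seq (c d : Cmd V) : Cmd V
  | set (a : V) (i e : Expr V) : Cmd V
  | ite (p : Cond V) (c d : Cmd V) : Cmd V
  | rep (c : Cmd V) : Cmd V

variable {V : Type}

/-- The value of an expression. -/
def Expr.val (S : V → ℕ → ℕ) : Expr V → ℕ
  | lit n => n
  | get a e => S a (e.val S)
  | succ e => e.val S + 1

/-- The truth value of a condition. -/
def Cond.test (S : V → ℕ → ℕ) : Cond V → Bool
  | le e f => decide (e.val S ≤ f.val S)
  | and p q => p.test S && q.test S
  | not p => !p.test S

/-- The implementation of an expression. -/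
def Expr.prog (k : Bool) : Expr V → ArrProg (V ⊕ Bool)
  | lit n => .seq (.zero (.inr k)) ((fun c => .seq c (.inc (.inr k)))^[n] .skip)
  | get a e => .seq (e.prog k) (.read (.inr k) (.inl a) (.inr k))
  | succ e => .seq (e.prog k) (.inc (.inr k))

/-- The implementation of a condition. -/
def Cond.prog : Cond V → ArrProg (V ⊕ Bool) → ArrProg (V ⊕ Bool) → ArrProg (V ⊕ Bool)
  | le e f, c, d => .seq (e.prog true) (.seq (f.prog false) (.ifLe (.inr true) (.inr false) c d))
  | and p q, c, d => p.prog (q.prog c d) d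
  | not p, c, d => p.prog d c

/-- The implementation of a program with expressions. -/
def Cmd.prog : Cmd V → ArrProg (V ⊕ Bool)
  | seq c d => .seq c.prog d.prog
  | set a i e => .seq (i.prog true) (.seq (e.prog false) (.write (.inl a) (.inr true) (.inr false)))
  | ite p c d => p.prog c.prog d.prog
  | rep c => .rep c.prog

/-- The variable `a`. -/
def Expr.var (a : V) : Expr V := .get a (.lit 0)

/-- Strict inequality. -/
def Cond.lt (e f : Expr V) : Cond V := .le (.succ e) f

/-- Equality. -/
def Cond.eq (e f : Expr V) : Cond V := .and (.le e f) (.le f e)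

/-- Disjunction. -/
def Cond.or (p q : Cond V) : Cond V := .not (.and (.not p) (.not q))

/-- Assign to a variable. -/
def Cmd.put (a : V) (e : Expr V) : Cmd V := .set a (.lit 0) e

/-- Do nothing. -/
def Cmd.nop (a : V) : Cmd V := .put a (.var a)

/-- Let `i` run from `0`. -/
def Cmd.for (i : V) (c : Cmd V) : Cmd V :=
  .seq (.put i (.lit 0)) (.rep (.seq c (.put i (.succ (.var i)))))

section Simp

variable {S : V → ℕ → ℕ}

@[simp]
theorem Expr.val_lit (n : ℕ) : (Expr.lit n : Expr V).val S = n := by rw [Expr.val]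

@[simp]
theorem Expr.val_get (a : V) (e : Expr V) : (Expr.get a e).val S = S a (e.val S) := by
  rw [Expr.val]

@[simp]
theorem Expr.val_succ (e : Expr V) : (Expr.succ e).val S = e.val S + 1 := by rw [Expr.val]

@[simp]
theorem Expr.val_var (a : V) : (Expr.var a).val S = S a 0 := by simp [Expr.var]

@[simp]
theorem Cond.test_le (e f : Expr V) : (Cond.le e f).test S = true ↔ e.val S ≤ f.val S := by
  simp [Cond.test]

@[simp]
theorem Cond.test_not (p : Cond V) : (Cond.not p).test S = true ↔ ¬ p.test S = true := by
  simp [Cond.test]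

@[simp]
theorem Cond.test_and (p q : Cond V) :
    (Cond.and p q).test S = true ↔ p.test S = true ∧ q.test S = true := by
  simp [Cond.test]

@[simp]
theorem Cond.test_or (p q : Cond V) :
    (Cond.or p q).test S = true ↔ p.test S = true ∨ q.test S = true := by
  simp only [Cond.or, test_not, test_and]
  tauto

@[simp]
theorem Cond.test_lt (e f : Expr V) : (Cond.lt e f).test S = true ↔ e.val S < f.val S := by
  simp only [Cond.lt, test_le, Expr.val_succ]
  omega

@[simp]
theorem Cond.test_eq (e f : Expr V) : (Cond.eq e f).test S = true ↔ e.val S = f.val S := by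
  simp only [Cond.eq, test_and, test_le]
  omega

end Simp

variable [DecidableEq V]

/-- The semantics of a program with expressions. -/
def Cmd.run (N : ℕ) : Cmd V → (V → ℕ → ℕ) → V → ℕ → ℕ
  | seq c d, S => d.run N (c.run N S)
  | set a i e, S => update S a (update (S a) (i.val S) (e.val S))
  | ite p c d, S => if p.test S then c.run N S else d.run N S
  | rep c, S => (c.run N)^[N] S

/-- An expression is a chain of operations, so one register suffices for it. There are two registers
because `le` and `set` need two values at the same time. -/
theorem Expr.eval_prog (N : ℕ) (k : Bool) (e : Expr V) (S : V ⊕ Bool → ℕ → ℕ) :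
    eval N (e.prog k) S =
      update S (.inr k) (update (S (.inr k)) 0 (e.val fun a => S (.inl a))) := by
  induction e with
  | lit n =>
    have h : ∀ S : V ⊕ Bool → ℕ → ℕ, eval N ((fun c => .seq c (.inc (.inr k)))^[n] .skip) S =
        update S (.inr k) (update (S (.inr k)) 0 (S (.inr k) 0 + n)) := by
      intro S
      induction n with
      | zero => simp [eval]
      | succ n ih =>
        rw [iterate_succ_apply']
        simp only [eval, ih]
        simp [add_assoc]
    simp [prog, eval, h, val]
  | get a e ih => simp [prog, eval, ih, val]
  | succ e ih => simp [prog, eval, ih, val]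

/-- A test overwrites the registers. The branch therefore starts from some other state `S'`, which
agrees with `S` on all arrays that a `Cmd` can see. -/
theorem Cond.eval_prog (N : ℕ) (p : Cond V) (c d : ArrProg (V ⊕ Bool)) (S : V ⊕ Bool → ℕ → ℕ) :
    ∃ S' : V ⊕ Bool → ℕ → ℕ, (fun a => S' (.inl a)) = (fun a => S (.inl a)) ∧
      eval N (p.prog c d) S =
        if p.test (fun a => S (.inl a)) then eval N c S' else eval N d S' := by
  induction p generalizing c d S with
  | le e f =>
    refine ⟨eval N (f.prog false) (eval N (e.prog true) S), ?_, ?_⟩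
    · simp [Expr.eval_prog]
    · simp [prog, eval, Expr.eval_prog, test]
  | and p q ihp ihq =>
    obtain ⟨S1, h1, k1⟩ := ihp (q.prog c d) d S
    obtain ⟨S2, h2, k2⟩ := ihq c d S1
    rw [h1] at k2 h2
    simp only [prog, test, k1, k2]
    by_cases hp : p.test (fun a => S (.inl a)) = true
    · exact ⟨S2, h2, by simp [hp]⟩
    · exact ⟨S1, h1, by simp [hp]⟩
  | not p ih =>
    obtain ⟨S1, h1, k1⟩ := ih d c S
    refine ⟨S1, h1, ?_⟩
    simp only [prog, test, k1]
    by_cases h : p.test (fun a => S (.inl a)) = true <;> simp [h]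

theorem Cmd.eval_prog (N : ℕ) (c : Cmd V) (S : V ⊕ Bool → ℕ → ℕ) :
    (fun a => eval N c.prog S (.inl a)) = c.run N fun a => S (.inl a) := by
  induction c generalizing S with
  | seq c d ihc ihd => simp only [prog, eval, run, ihd, ihc]
  | set a i e =>
    funext b
    simp only [prog, eval, run, Expr.eval_prog]
    by_cases h : b = a
    · subst h; simp
    · simp [h]
  | ite p c d ihc ihd =>
    obtain ⟨S1, h1, k1⟩ := p.eval_prog N c.prog d.prog S
    simp only [prog, run, k1]
    split_ifs
    · rw [ihc, h1]
    · rw [ihd, h1]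
  | rep c ih =>
    simp only [prog, run, eval]
    have h : ∀ m (S : V ⊕ Bool → ℕ → ℕ), (fun a => (eval N c.prog)^[m] S (.inl a)) =
        (c.run N)^[m] fun a => S (.inl a) := by
      intro m
      induction m with
      | zero => intro S; rfl
      | succ m ihm => intro S; rw [iterate_succ_apply, iterate_succ_apply, ihm, ih]
    exact h N S

/-! ### Loops -/

section Simp

variable {S : V → ℕ → ℕ} {N : ℕ}

@[simp] theorem Cmd.run_seq (c d : Cmd V) : (Cmd.seq c d).run N S = d.run N (c.run N S) := by
  rw [Cmd.run]

@[simp] theorem Cmd.run_set (a : V) (i e : Expr V) : (Cmd.set a i e).run N S =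
    update S a (update (S a) (i.val S) (e.val S)) := by rw [Cmd.run]

@[simp] theorem Cmd.run_put (a : V) (e : Expr V) : (Cmd.put a e).run N S =
    update S a (update (S a) 0 (e.val S)) := by simp [Cmd.put]

@[simp] theorem Cmd.run_nop (a : V) : (Cmd.nop a).run N S = S := by
  simp [Cmd.nop]

@[simp] theorem Cmd.run_ite (p : Cond V) (c d : Cmd V) : (Cmd.ite p c d).run N S =
    if p.test S then c.run N S else d.run N S := by rw [Cmd.run]

@[simp] theorem Cmd.run_rep (c : Cmd V) : (Cmd.rep c).run N S = (c.run N)^[N] S := by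
  rw [Cmd.run]

end Simp

/-- The state `S'` agrees with `S` except in the arrays `F`. -/
def Agree (F : List V) (S S' : V → ℕ → ℕ) : Prop := ∀ a ∉ F, S' a = S a

omit [DecidableEq V] in
theorem Agree.refl (F : List V) (S : V → ℕ → ℕ) : Agree F S S := fun _ _ => rfl

omit [DecidableEq V] in
theorem Agree.trans {F : List V} {S S' S'' : V → ℕ → ℕ} (h : Agree F S S') (h' : Agree F S' S'') :
    Agree F S S'' := fun a ha => (h' a ha).trans (h a ha)

omit [DecidableEq V] in
theorem Agree.mono {F F' : List V} {S S' : V → ℕ → ℕ} (h : Agree F S S') (hF : F ⊆ F') :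
    Agree F' S S' := fun a ha => h a fun h' => ha (hF h')

theorem Agree.update {F : List V} {S : V → ℕ → ℕ} {a : V} (ha : a ∈ F) (v : ℕ → ℕ) :
    Agree F S (update S a v) := fun b hb => update_of_ne (fun h => hb (by rwa [h])) _ _

/-- The rule for loop invariants; the body has to leave the counter as it found it. -/
theorem Cmd.for_spec {N : ℕ} {i : V} {c : Cmd V} {S : V → ℕ → ℕ} (P : ℕ → (V → ℕ → ℕ) → Prop)
    (h0 : P 0 (update S i (update (S i) 0 0)))
    (h : ∀ k < N, ∀ S, S i 0 = k → P k S → c.run N S i 0 = k ∧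
      P (k + 1) (update (c.run N S) i (update (c.run N S i) 0 (k + 1)))) :
    P N ((Cmd.for i c).run N S) ∧ (Cmd.for i c).run N S i 0 = N := by
  suffices H : ∀ m ≤ N, P m (((Cmd.seq c (.put i (.succ (.var i)))).run N)^[m]
      (update S i (update (S i) 0 0))) ∧ ((Cmd.seq c (.put i (.succ (.var i)))).run N)^[m]
      (update S i (update (S i) 0 0)) i 0 = m from H N le_rfl
  intro m
  induction m with
  | zero => intro _; exact ⟨h0, by simp⟩
  | succ m ih =>
    intro hm
    obtain ⟨h1, h2⟩ := ih (by omega)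
    obtain ⟨h3, h4⟩ := h m (by omega) _ h2 h1
    rw [iterate_succ_apply']
    simp only [run_seq, run_put, Expr.val_succ, Expr.val_var, h3]
    exact ⟨h4, by simp⟩

/-- Assign to entries of an array in a loop. -/
def Cmd.scatter (i t : V) (p : Cond V) (e f : Expr V) : Cmd V :=
  .for i (.ite p (.set t e f) (.nop t))

/-- The entries are not restricted, because this has to apply also to input words that encode
nothing. -/
theorem Cmd.scatter_agree {N : ℕ} {i t : V} (hit : i ≠ t) (p : Cond V) (e f : Expr V)
    (S : V → ℕ → ℕ) : Agree [i, t] S ((Cmd.scatter i t p e f).run N S) := by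
  refine (Cmd.for_spec (P := fun _ S' => Agree [i, t] S S') (Agree.update (by simp) _) ?_).1
  rintro k hk S' hi h1
  simp only [run_ite, run_set, run_nop]
  split_ifs
  · exact ⟨by simp [hit, hi],
      h1.trans ((Agree.update (by simp) _).trans (Agree.update (by simp) _))⟩
  · exact ⟨hi, h1.trans (Agree.update (by simp) _)⟩

/-- Injectivity of `E` prevents later rounds from overwriting earlier ones. With `E` a permutation
and `F` the identity, the loop tabulates the inverse permutation. -/
theorem Cmd.scatter_spec {N : ℕ} {i t : V} (hit : i ≠ t) {p : Cond V} {e f : Expr V}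
    {S : V → ℕ → ℕ} {P : ℕ → Prop} {E F : ℕ → ℕ}
    (hp : ∀ S', Agree [i, t] S S' → (p.test S' = true ↔ P (S' i 0)))
    (he : ∀ S', Agree [i, t] S S' → P (S' i 0) → e.val S' = E (S' i 0))
    (hf : ∀ S', Agree [i, t] S S' → P (S' i 0) → f.val S' = F (S' i 0))
    (hE : ∀ k < N, ∀ l < N, P k → P l → E k = E l → k = l) :
    Agree [i, t] S ((Cmd.scatter i t p e f).run N S) ∧
      (∀ k < N, P k → (Cmd.scatter i t p e f).run N S t (E k) = F k) ∧
      ∀ q, (∀ k < N, P k → E k ≠ q) → (Cmd.scatter i t p e f).run N S t q = S t q := by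
  refine (Cmd.for_spec (P := fun m S' => Agree [i, t] S S' ∧
      (∀ k < m, P k → S' t (E k) = F k) ∧
      ∀ q, (∀ k < m, P k → E k ≠ q) → S' t q = S t q) ?_ ?_).1
  · refine ⟨Agree.update (by simp) _, by simp, fun q _ => ?_⟩
    rw [update_of_ne hit.symm]
  · rintro k hk S' hi ⟨h1, h2, h3⟩
    have hp' := hp S' h1
    have he' := he S' h1
    have hf' := hf S' h1
    rw [hi] at hp' he' hf'
    by_cases hP : P k
    · simp only [run_ite, hp'.2 hP, if_true, run_set, he' hP, hf' hP]
      refine ⟨by simp [hit, hi], ?_, fun l hl hl' => ?_, fun q hq => ?_⟩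
      · exact h1.trans ((Agree.update (by simp) _).trans (Agree.update (by simp) _))
      · rw [update_of_ne hit.symm, update_self]
        by_cases hlk : l = k
        · subst hlk; simp
        · rw [update_of_ne fun hh => hlk (hE l (by omega) k hk hl' hP hh)]
          exact h2 l (by omega) hl'
      · rw [update_of_ne hit.symm, update_self, update_of_ne (hq k (by omega) hP).symm]
        exact h3 q fun l hl => hq l (by omega)
    · have : p.test S' = false := by simpa [hP] using hp'
      simp only [run_ite, this, Bool.false_eq_true, if_false, run_nop]
      refine ⟨hi, h1.trans (Agree.update (by simp) _), fun l hl hl' => ?_, fun q hq => ?_⟩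
      · rw [update_of_ne hit.symm]
        have : l ≠ k := fun h => hP (h ▸ hl')
        exact h2 l (by omega) hl'
      · rw [update_of_ne hit.symm]
        exact h3 q fun l hl => hq l (by omega)

/-- Set `r` if the condition `p` holds for some `i`. -/
def Cmd.search (i r : V) (p : Cond V) : Cmd V := .for i (.ite p (.put r (.lit 1)) (.nop r))

theorem Cmd.search_spec {N : ℕ} {i r : V} (hir : i ≠ r) {p : Cond V}
    {S : V → ℕ → ℕ} {P : ℕ → Prop}
    (hp : ∀ S', Agree [i, r] S S' → (p.test S' = true ↔ P (S' i 0))) :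
    Agree [i, r] S ((Cmd.search i r p).run N S) ∧
      ((Cmd.search i r p).run N S r 0 = 0 ↔ S r 0 = 0 ∧ ∀ k < N, ¬ P k) := by
  refine (Cmd.for_spec (P := fun m S' => Agree [i, r] S S' ∧
      (S' r 0 = 0 ↔ S r 0 = 0 ∧ ∀ k < m, ¬ P k)) ?_ ?_).1
  · exact ⟨Agree.update (by simp) _, by simp [hir.symm]⟩
  · rintro k hk S' hi ⟨h1, h2⟩
    have hp' := hp S' h1
    rw [hi] at hp'
    by_cases hP : P k
    · simp only [run_ite, hp'.2 hP, if_true, run_put]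
      refine ⟨by simp [hir, hi], ?_, ?_⟩
      · exact h1.trans ((Agree.update (by simp) _).trans (Agree.update (by simp) _))
      · simp only [update_of_ne hir.symm, update_self, Expr.val_lit, one_ne_zero, false_iff]
        exact fun h => h.2 k (by omega) hP
    · have : p.test S' = false := by simpa [hP] using hp'
      simp only [run_ite, this, Bool.false_eq_true, if_false, run_nop]
      refine ⟨hi, h1.trans (Agree.update (by simp) _), ?_⟩
      rw [update_of_ne hir.symm, h2]
      refine and_congr_right fun _ => ⟨fun h l hl => ?_, fun h l hl => h l (by omega)⟩
      rcases Nat.lt_succ_iff_lt_or_eq.1 hl with hl | rfl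
      · exact h l hl
      · exact hP

/-- Set `r` if the condition `p` holds for some `i` and `j`. -/
def Cmd.search₂ (i j r : V) (p : Cond V) : Cmd V := .for i (.search j r p)

theorem Cmd.search₂_spec {N : ℕ} {i j r : V} (hir : i ≠ r) (hij : i ≠ j) (hjr : j ≠ r) {p : Cond V}
    {S : V → ℕ → ℕ} {P : ℕ → ℕ → Prop}
    (hp : ∀ S', Agree [i, j, r] S S' → (p.test S' = true ↔ P (S' i 0) (S' j 0))) :
    Agree [i, j, r] S ((Cmd.search₂ i j r p).run N S) ∧
      ((Cmd.search₂ i j r p).run N S r 0 = 0 ↔ S r 0 = 0 ∧ ∀ k < N, ∀ l < N, ¬ P k l) := by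
  refine (Cmd.for_spec (P := fun m S' => Agree [i, j, r] S S' ∧
      (S' r 0 = 0 ↔ S r 0 = 0 ∧ ∀ k < m, ∀ l < N, ¬ P k l)) ?_ ?_).1
  · exact ⟨Agree.update (by simp) _, by simp [hir.symm]⟩
  · rintro k hk S' hi ⟨h1, h2⟩
    obtain ⟨h3, h4⟩ := Cmd.search_spec (N := N) hjr (p := p) (S := S') (P := P k) fun S'' hS => by
      rw [hp S'' (h1.trans (hS.mono (by simp))), hS i (by simp [hir, hij]), hi]
    have h5 := h3 i (by simp [hir, hij])
    refine ⟨by rw [h5, hi], h1.trans ((h3.mono (by simp)).trans (Agree.update (by simp) _)), ?_⟩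
    rw [update_of_ne hir.symm, h4, h2, and_assoc]
    refine and_congr_right fun _ => ⟨fun h l hl => ?_, fun h => ⟨fun l hl => h l (by omega),
      h k (by omega)⟩⟩
    rcases Nat.lt_succ_iff_lt_or_eq.1 hl with hl | rfl
    · exact h.1 l hl
    · exact h.2

end ArrProg

/-! ### The search as an array program -/

namespace ArrProg

open Function

/-- The arrays of the programs. -/
inductive Var : Type
  | x | y | nx | ny | pi | gg | pl | fa | fb | fk | m | h | md | b | r | i | j | pd | rv | sh | gq
  | o | bad
  deriving DecidableEq

instance : Fintype Var :=
  ⟨{.x, .y, .nx, .ny, .pi, .gg, .pl, .fa, .fb, .fk, .m, .h, .md, .b, .r, .i, .j, .pd, .rv, .sh,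
    .gq, .o, .bad}, fun v => by cases v <;> simp⟩

open Var ArrProg.Expr Cond Cmd

/-- Compute the next corner. -/
def nextPlaceProg : Cmd Var :=
  .seq (put b (lit 0)) (.for j (.ite (.and (.lt (var j) (var m))
    (.and (.lt (get gg (var h)) (get gg (get pl (var j)))) (.lt (var b) (get pl (var j)))))
    (put b (get pl (var j))) (nop b)))

/-- Test whether the last element is misplaced. -/
def misplacedProg : Cmd Var :=
  .seq (put r (lit 0)) (.search j r (.and (.lt (var j) (get pd (var m)))
    (.and (.lt (get pi (get pd (var m))) (get pi (var j)))
      (.lt (get gg (get pl (get pd (var m)))) (get gg (get pl (var j)))))))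

/-- The step of the search that finds the next corner. -/
def cornerProg : Cmd Var :=
  .seq nextPlaceProg (.seq (set fb (var m) (var b)) (.seq (set fk (var m) (lit 0))
    (.seq (put md (lit 1)) (.ite (.or (.eq (get pl (get pd (var m))) (var b))
        (.and (.lt (get pl (get pd (var m))) (var h))
          (.lt (get gg (get pl (get pd (var m)))) (get gg (var h)))))
      (.seq (set fa (var m) (var h)) (put h (get pl (get pd (var m)))))
      (set fa (var m) (get pl (get pd (var m))))))))

/-- The step of the search that compares the hole with the corner. -/
def holeProg : Cmd Var :=
  .ite (.eq (var h) (get fb (var m)))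
    (.seq (set pl (get pd (var m)) (get fa (var m))) (put md (lit 2)))
    (.seq (put m (get pd (var m))) (put md (lit 0)))

/-- The step of the search that tests the last element. -/
def testProg : Cmd Var :=
  .seq misplacedProg (.ite (.eq (var r) (lit 0))
    (.seq (.ite (.eq (get fk (succ (var m))) (lit 1)) (set pl (var m) (get fb (var m)))
        (nop m))
      (.seq (put h (get fb (var m))) (.seq (.ite (.eq (get fk (succ (var m))) (lit 0))
        (put md (lit 1)) (put md (lit 2))) (put m (succ (var m))))))
    (.seq (set fk (var m) (lit 1)) (.seq (put h (get pl (get pd (var m))))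
      (.seq (put m (get pd (var m))) (put md (lit 0))))))

/-- One step of the search. -/
def stepProg : Cmd Var :=
  .ite (.lt (var nx) (var m)) (nop m) (.ite (.eq (var md) (lit 0)) cornerProg
    (.ite (.eq (var md) (lit 1)) holeProg testProg))

/-- The search that the arrays represent. -/
def toSearch (S : Var → ℕ → ℕ) : Search := ⟨S pl, S fa, S fb, S fk, S m 0, S h 0, S md 0⟩

variable {N : ℕ} {S : Var → ℕ → ℕ}

theorem nextPlaceProg_spec (hm : S m 0 ≤ N) :
    Agree [b, j] S (nextPlaceProg.run N S) ∧
      nextPlaceProg.run N S b 0 = nextPlace (S gg) (S pl) (S m 0) (S h 0) := by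
  -- The running maximum over the elements inspected so far. The loop runs up to `N`, so membership
  -- in the first `m` elements is part of the filter.
  let Q := fun k => ((Finset.range k).filter fun q => q < S m 0 ∧ S gg (S h 0) < S gg (S pl q)).sup
    (S pl)
  have key := Cmd.for_spec (N := N) (i := j) (S := (put b (lit 0)).run N S)
    (c := .ite (.and (.lt (var j) (var m))
    (.and (.lt (get gg (var h)) (get gg (get pl (var j)))) (.lt (var b) (get pl (var j)))))
    (put b (get pl (var j))) (nop b)) (P := fun k S' => Agree [b, j] S S' ∧ S' b 0 = Q k) ?_ ?_
  · refine ⟨key.1.1, key.1.2.trans ?_⟩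
    unfold nextPlace
    refine congrArg (fun F : Finset ℕ => F.sup (S pl)) ?_
    refine Finset.ext fun q => ?_
    simp only [Finset.mem_filter, Finset.mem_range]
    constructor
    · rintro ⟨_, h1, h2⟩
      exact ⟨h1, h2⟩
    · rintro ⟨h1, h2⟩
      exact ⟨by omega, h1, h2⟩
  · refine ⟨(Agree.update (by simp) _).trans (Agree.update (by simp) _), by simp [Q]⟩
  · rintro k hk S' hj ⟨h1, h2⟩
    have e1 := h1 gg (by simp)
    have e2 := h1 pl (by simp)
    have e3 := h1 m (by simp)
    have e4 := h1 h (by simp)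
    have e5 : Q (k + 1) = if k < S m 0 ∧ S gg (S h 0) < S gg (S pl k) then S pl k ⊔ Q k else Q k := by
      simp only [Q, Finset.range_add_one, Finset.filter_insert]
      split_ifs
      · rw [Finset.sup_insert]
      · rfl
    simp only [run_ite, test_and, test_lt, val_var, val_get, hj, e1, e2, e3, e4, h2, run_put,
      run_nop]
    split_ifs with hc
    · refine ⟨by simp [hj], h1.trans ((Agree.update (by simp) _).trans (Agree.update (by simp) _)),
        ?_⟩
      rw [e5, if_pos ⟨hc.1, hc.2.1⟩, sup_eq_left.2 hc.2.2.le]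
      simp
    · refine ⟨hj, h1.trans (Agree.update (by simp) _), ?_⟩
      rw [update_of_ne (by simp), h2, e5]
      split_ifs with hc'
      · rw [sup_eq_right.2]
        by_contra hh
        exact hc ⟨hc'.1, hc'.2, by omega⟩
      · rfl

/-- Expressions know only successors, so `m - 1` is looked up in the table `pd`. -/
theorem misplacedProg_spec (hm : S m 0 ≤ N) (hp : S pd (S m 0) = S m 0 - 1) :
    Agree [r, j] S (misplacedProg.run N S) ∧
      (misplacedProg.run N S r 0 = 0 ↔ ¬ Misplaced (S gg) (S pi) (S pl) (S m 0)) := by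
  obtain ⟨h1, h2⟩ := Cmd.search_spec (N := N) (i := j) (r := r) (S := (put r (lit 0)).run N S)
    (p := .and (.lt (var j) (get pd (var m)))
    (.and (.lt (get pi (get pd (var m))) (get pi (var j)))
      (.lt (get gg (get pl (get pd (var m)))) (get gg (get pl (var j))))))
    (P := fun y => y < S m 0 - 1 ∧ S pi (S m 0 - 1) < S pi y ∧ S gg (S pl (S m 0 - 1)) < S gg (S pl y))
    (by simp) fun S' h => by
      have e1 := h gg (by simp)
      have e2 := h pl (by simp)
      have e3 := h m (by simp)
      have e4 := h pd (by simp)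
      have e5 := h pi (by simp)
      simp [e1, e2, e3, e4, e5, hp]
  refine ⟨(Agree.trans (Agree.update (by simp) _) (h1.mono (by simp))), h2.trans ?_⟩
  simp only [run_put, update_self, val_lit, true_and, Misplaced, not_exists, not_and]
  exact ⟨fun h y h1 h2 h3 => h y (by omega) h1 h2 h3, fun h y _ => h y⟩

/-- The arrays that the search changes. -/
def searchVars : List Var := [pl, fa, fb, fk, m, h, md, b, r, j]

theorem cornerProg_spec {n : ℕ} (hn : S m 0 ≤ n) (hm : S m 0 ≤ N) (hp : S pd (S m 0) = S m 0 - 1)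
    (h0 : S md 0 = 0) :
    Agree searchVars S (cornerProg.run N S) ∧
      toSearch (cornerProg.run N S) = searchStep n (S gg) (S pi) (toSearch S) := by
  obtain ⟨k1, k2⟩ := nextPlaceProg_spec hm
  have e : ∀ a, a ≠ b → a ≠ j → nextPlaceProg.run N S a = S a :=
    fun a h h' => k1 a (by simp [h, h'])
  simp only [cornerProg, run_seq]
  generalize nextPlaceProg.run N S = S1 at k1 k2 e
  have k3 : Agree searchVars S S1 := k1.mono (by simp [searchVars])
  simp only [run_set, run_put, run_ite, test_or, test_and, test_eq, test_lt, val_var, val_get,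
    val_lit, run_seq]
  have e1 := e m (by simp) (by simp)
  have e2 := e pl (by simp) (by simp)
  have e3 := e gg (by simp) (by simp)
  have e4 := e h (by simp) (by simp)
  have e5 := e pd (by simp) (by simp)
  have e6 := e fa (by simp) (by simp)
  have e7 := e fb (by simp) (by simp)
  have e8 := e fk (by simp) (by simp)
  constructor
  · refine k3.trans ?_
    split_ifs <;> intro a ha <;> simp [searchVars] at ha <;> simp [ha]
  · have hn' : ¬ n < S m 0 := by omega
    simp only [searchStep, toSearch, hn', if_false, h0, if_true]
    split_ifs <;> simp_all

theorem holeProg_spec {n : ℕ} (hn : S m 0 ≤ n) (hp : S pd (S m 0) = S m 0 - 1)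
    (h0 : S md 0 = 1) :
    Agree searchVars S (holeProg.run N S) ∧
      toSearch (holeProg.run N S) = searchStep n (S gg) (S pi) (toSearch S) := by
  simp only [holeProg, run_ite, test_eq, val_var, val_get, run_seq, run_set, run_put, val_lit]
  constructor
  · split_ifs <;> intro a ha <;> simp [searchVars] at ha <;> simp [ha]
  · have hn' : ¬ n < S m 0 := by omega
    simp only [searchStep, toSearch, hn', if_false, h0, one_ne_zero, if_true]
    split_ifs <;> simp [hp]

theorem testProg_spec {n : ℕ} (hn : S m 0 ≤ n) (hm : S m 0 ≤ N) (hp : S pd (S m 0) = S m 0 - 1)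
    (h0 : S md 0 ≠ 0) (h1 : S md 0 ≠ 1) :
    Agree searchVars S (testProg.run N S) ∧
      toSearch (testProg.run N S) = searchStep n (S gg) (S pi) (toSearch S) := by
  obtain ⟨k1, k2⟩ := misplacedProg_spec hm hp
  have e : ∀ a, a ≠ r → a ≠ j → misplacedProg.run N S a = S a :=
    fun a h h' => k1 a (by simp [h, h'])
  simp only [testProg, run_seq]
  generalize misplacedProg.run N S = S1 at k1 k2 e
  have k3 : Agree searchVars S S1 := k1.mono (by simp [searchVars])
  simp only [run_set, run_put, run_ite, test_eq, val_var, val_get, val_succ, run_nop,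
    val_lit, run_seq]
  have e1 := e m (by simp) (by simp)
  have e2 := e pl (by simp) (by simp)
  have e4 := e h (by simp) (by simp)
  have e5 := e pd (by simp) (by simp)
  have e6 := e fa (by simp) (by simp)
  have e7 := e fb (by simp) (by simp)
  have e8 := e fk (by simp) (by simp)
  constructor
  · refine k3.trans ?_
    split_ifs <;> intro a ha <;> simp [searchVars] at ha <;> simp [ha]
  · have hn' : ¬ n < S m 0 := by omega
    simp only [searchStep, toSearch, hn', if_false, h0, h1]
    by_cases hM : Misplaced (S gg) (S pi) (S pl) (S m 0)
    · have k4 : S1 r 0 ≠ 0 := fun hh => k2.1 hh hM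
      simp [hM, k4, e1, e2, e4, e5, e6, e7, e8, hp]
    · have k4 : S1 r 0 = 0 := k2.2 hM
      by_cases c1 : S fk (S m 0 + 1) = 1
      · simp [hM, k4, c1, e1, e2, e4, e6, e7, e8]
      · by_cases c2 : S fk (S m 0 + 1) = 0
        · simp [hM, k4, c2, e1, e2, e4, e6, e7, e8]
        · simp [hM, k4, c1, c2, e1, e2, e4, e6, e7, e8]

theorem stepProg_spec (hn : S nx 0 ≤ N) (hp : ∀ k ≤ N, S pd k = k - 1) :
    Agree searchVars S (stepProg.run N S) ∧
      toSearch (stepProg.run N S) = searchStep (S nx 0) (S gg) (S pi) (toSearch S) := by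
  simp only [stepProg, run_ite, test_lt, test_eq, val_var, val_lit, run_nop]
  split_ifs with h1 h2 h3
  · exact ⟨Agree.refl _ _, by simp [searchStep, toSearch, h1]⟩
  · exact cornerProg_spec (by omega) (by omega) (hp _ (by omega)) h2
  · exact holeProg_spec (by omega) (hp _ (by omega)) h3
  · exact testProg_spec (by omega) (by omega) (hp _ (by omega)) h2 h3

/-- The search. -/
def searchProg : Cmd Var := .rep (.rep (.rep (.rep (.rep stepProg))))

theorem searchProg_spec (hn : S nx 0 ≤ N) (hp : ∀ k ≤ N, S pd k = k - 1) :
    Agree searchVars S (searchProg.run N S) ∧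
      toSearch (searchProg.run N S) =
        (searchStep (S nx 0) (S gg) (S pi))^[N * (N * (N * (N * N)))] (toSearch S) := by
  have hr : ∀ c : Cmd Var, (Cmd.rep c).run N = (c.run N)^[N] := fun c => funext fun S => run_rep c
  -- Five nested loops amount to `N ^ 5` iterations of the step.
  rw [searchProg, hr, hr, hr, hr, hr, ← iterate_mul, ← iterate_mul, ← iterate_mul, ← iterate_mul]
  generalize N * (N * (N * (N * N))) = K
  induction K with
  | zero => exact ⟨Agree.refl _ _, rfl⟩
  | succ K ih =>
    obtain ⟨h1, h2⟩ := ih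
    rw [iterate_succ_apply', iterate_succ_apply', ← h2]
    generalize (stepProg.run N)^[K] S = S1 at h1
    have e1 := h1 nx (by simp [searchVars])
    have e2 := h1 gg (by simp [searchVars])
    have e3 := h1 pi (by simp [searchVars])
    have e4 := h1 pd (by simp [searchVars])
    obtain ⟨h3, h4⟩ := stepProg_spec (N := N) (S := S1) (by rw [e1]; exact hn)
      (by rw [e4]; exact hp)
    rw [e1, e2, e3] at h4
    exact ⟨h1.trans h3, h4⟩

end ArrProg

/-! ### Restriction to finitely many entries -/

/-- Two states of the search agree as far as the search depends on them, and contain places only. -/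
structure Search.Sim (n : ℕ) (c c' : Search) : Prop where
  pl : ∀ j < n, c'.pl j = c.pl j ∧ c.pl j < n
  fa : ∀ j ≤ n, c'.fa j = c.fa j ∧ c.fa j < n
  fb : ∀ j ≤ n, c'.fb j = c.fb j ∧ c.fb j < n
  fk : ∀ j ≤ n + 1, c'.fk j = c.fk j
  m : c'.m = c.m
  h : c'.h = c.h ∧ c.h < n
  md : c'.md = c.md

theorem sim_update {n k v : ℕ} {f f' : ℕ → ℕ} {P : ℕ → Prop}
    (h : ∀ j, P j → f' j = f j ∧ f j < n) (hv : v < n) :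
    ∀ j, P j → Function.update f' k v j = Function.update f k v j ∧
      Function.update f k v j < n := by
  intro j hj
  by_cases hk : j = k
  · subst hk; simpa using hv
  · simpa [hk] using h j hj

/-- The arrays agree with `g`, `π` and the ideal state on finitely many indices only. A step at a
level up to `n` looks at no others, and all places stay below `n`; the two searches thus take the
same branches. -/
theorem Search.Sim.step {n : ℕ} {g g' π π' : ℕ → ℕ} (hn : 0 < n) (hg : ∀ p < n, g' p = g p)
    (hπ : ∀ j < n, π' j = π j) {c c' : Search} (h : Search.Sim n c c') :
    Search.Sim n (searchStep n g π c) (searchStep n g' π' c') := by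
  by_cases hm : n < c.m
  · simpa [searchStep, hm, h.m] using h
  have hl : c.m - 1 < n := by omega
  have p1 := h.pl _ hl
  have gh := hg _ h.h.2
  have gl := hg _ p1.2
  have b1 := h.fb c.m (by omega)
  have a1 := h.fa c.m (by omega)
  have eb : nextPlace g' c'.pl c'.m c'.h = nextPlace g c.pl c.m c.h := by
    unfold nextPlace
    rw [h.m, h.h.1, gh]
    refine (Finset.sup_congr (Finset.filter_congr fun j hj => ?_) fun j hj => ?_)
    · rw [Finset.mem_range] at hj
      have := h.pl j (by omega)
      rw [this.1, hg _ this.2]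
    · rw [Finset.mem_filter, Finset.mem_range] at hj
      exact (h.pl j (by omega)).1
  have lb : nextPlace g c.pl c.m c.h < n := by
    unfold nextPlace
    rw [Finset.sup_lt_iff (by exact hn)]
    intro j hj
    rw [Finset.mem_filter, Finset.mem_range] at hj
    exact (h.pl j (by omega)).2
  have eM : Misplaced g' π' c'.pl c'.m ↔ Misplaced g π c.pl c.m := by
    unfold Misplaced
    rw [h.m, p1.1, gl, hπ _ hl]
    refine exists_congr fun y => and_congr_right fun hy => ?_
    have := h.pl y (by omega)
    rw [this.1, hg _ this.2, hπ y (by omega)]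
  have hk1 := h.fk (c.m + 1) (by omega)
  have hu : ∀ v, ∀ j ≤ n + 1, Function.update c'.fk c.m v j = Function.update c.fk c.m v j := by
    intro v j hj
    by_cases hk : j = c.m
    · subst hk; simp
    · simpa [hk] using h.fk j hj
  simp only [searchStep]
  rw [h.m, h.h.1] at eb
  rw [h.m] at eM ⊢
  simp only [hm, if_false, h.md, h.h.1, p1.1, gl, gh, eb, eM, hk1, b1.1, a1.1]
  split_ifs
  -- The cases in which only one of the two searches finds the last element misplaced contradict
  -- `eM`.
  all_goals try exact absurd (eM.2 (by assumption)) (by assumption)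
  all_goals try exact absurd (eM.1 (by assumption)) (by assumption)
  all_goals constructor
  all_goals try simp only [true_and]
  all_goals first
    | exact h.pl
    | exact h.fa
    | exact h.fb
    | exact h.fk
    | exact hu _
    | exact h.h.2
    | exact p1.2
    | exact b1.2
    | exact sim_update h.pl b1.2
    | exact sim_update h.pl a1.2
    | exact sim_update h.fa h.h.2
    | exact sim_update h.fa p1.2
    | exact sim_update h.fb lb

theorem Search.Sim.iterate {n : ℕ} {g g' π π' : ℕ → ℕ} (hn : 0 < n) (hg : ∀ p < n, g' p = g p)
    (hπ : ∀ j < n, π' j = π j) {c c' : Search} (h : Search.Sim n c c') (i : ℕ) :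
    Search.Sim n ((searchStep n g π)^[i] c) ((searchStep n g' π')^[i] c') := by
  induction i with
  | zero => exact h
  | succ i ih =>
    rw [Function.iterate_succ_apply', Function.iterate_succ_apply']
    exact ih.step hn hg hπ

namespace ArrProg

open Function Var

/-- The state of the arrays before the search. -/
structure Ready (N n : ℕ) (g π : ℕ → ℕ) (S : Var → ℕ → ℕ) : Prop where
  lt : n + 2 ≤ N
  nx : S nx 0 = n
  pd : ∀ k ≤ N, S pd k = k - 1
  gg : ∀ p < n, S gg p = g p
  pi : ∀ j < n, S pi j = π j
  pl : ∀ j < n, S pl j = j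
  fa : ∀ j ≤ n, S fa j = 0
  fb : ∀ j ≤ n, S fb j = 0
  fk : ∀ j ≤ n + 1, S fk j = 2
  m : S m 0 = 1
  h : S h 0 = 0
  md : S md 0 = 2

/-- The number of steps is of degree four in `n`; one further factor and `n + 2 ≤ N` absorb the
constants. -/
theorem steps_le {N n : ℕ} (h : n + 2 ≤ N) :
    n * (4 * ((n + 1) * (n * n)) + 1) ≤ N * (N * (N * (N * N))) := by
  obtain ⟨d, rfl⟩ := Nat.exists_eq_add_of_le h
  have : (n + 2) * ((n + 2) * ((n + 2) * ((n + 2) * (n + 2)))) ≤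
    (n + 2 + d) * ((n + 2 + d) * ((n + 2 + d) * ((n + 2 + d) * (n + 2 + d)))) := by gcongr
  refine le_trans ?_ this
  ring_nf
  nlinarith [Nat.zero_le (n ^ 2), Nat.zero_le (n ^ 3), Nat.zero_le (n ^ 4), Nat.zero_le (n ^ 5)]

theorem searchProg_result {N n : ℕ} {g π : ℕ → ℕ} {S : Var → ℕ → ℕ} (hg : Injective g)
    (h : Ready N n g π S) : Agree searchVars S (searchProg.run N S) ∧
      ∀ j < n, searchProg.run N S pl j = can g π n (Finset.range n) j := by
  obtain ⟨h1, h2⟩ := searchProg_spec (N := N) (S := S) (by rw [h.nx]; have := h.lt; omega) h.pd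
  refine ⟨h1, fun j hj => ?_⟩
  have h3 := search_result (π := π) hg (steps_le h.lt) j hj
  have h4 : Search.Sim n searchStart (toSearch S) := by
    refine ⟨fun j hj => ⟨h.pl j hj, hj⟩, fun j hj => ⟨h.fa j hj, by simp [searchStart]; omega⟩,
      fun j hj => ⟨h.fb j hj, by simp [searchStart]; omega⟩, h.fk, h.m,
      ⟨h.h, by simp [searchStart]; omega⟩, h.md⟩
  have h5 := (h4.iterate (by omega) h.gg h.pi (N * (N * (N * (N * N))))).pl j hj
  rw [← h3, ← h5.1, ← h.nx, ← h2]
  rfl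

end ArrProg

/-! ### Tables and initial values -/

namespace ArrProg

open Function Var ArrProg.Expr Cond Cmd

/-- The condition that always holds. -/
def Cond.tt : Cond Var := .le (lit 0) (lit 0)

@[simp]
theorem Cond.test_tt (S : Var → ℕ → ℕ) : Cond.tt.test S = true := by simp [Cond.tt]

/-- Tabulate the functions `n - 1 - l` and `n + l`. -/
def tableProg : Cmd Var :=
  .seq (set sh (lit 0) (var nx)) (.seq (set rv (lit 0) (get pd (var nx)))
    (.for i (.seq (set sh (succ (var i)) (succ (get sh (var i))))
      (set rv (succ (var i)) (get pd (get rv (var i)))))))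

/-- Prepare the search. -/
def prepProg : Cmd Var :=
  .seq (scatter i pd .tt (succ (var i)) (var i)) (.seq tableProg
    (.seq (scatter i pi (.lt (var i) (var nx)) (get x (var i)) (var i))
    (.seq (scatter i pl .tt (var i) (var i)) (.seq (scatter i fk .tt (var i) (lit 2))
    (.seq (put m (lit 1)) (.seq (put h (lit 0)) (put md (lit 2))))))))

variable {N n : ℕ} {S : Var → ℕ → ℕ}

theorem tableProg_spec (hn : S nx 0 ≤ N) (hp : ∀ k ≤ N, S pd k = k - 1) :
    Agree [i, rv, sh] S (tableProg.run N S) ∧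
      ∀ l ≤ N, tableProg.run N S sh l = S nx 0 + l ∧ tableProg.run N S rv l = S nx 0 - 1 - l := by
  simp only [tableProg, run_seq]
  refine (Cmd.for_spec (N := N) (P := fun k S' => Agree [i, rv, sh] S S' ∧
    ∀ l ≤ k, S' sh l = S nx 0 + l ∧ S' rv l = S nx 0 - 1 - l) ?_ ?_).1
  · refine ⟨fun a ha => ?_, fun l hl => ?_⟩
    · simp at ha
      simp [ha]
    · obtain rfl : l = 0 := by omega
      simp [hp _ hn]
  · rintro k hk S' hi ⟨h1, h2⟩
    have e1 := h1 pd (by simp)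
    obtain ⟨e2, e3⟩ := h2 k le_rfl
    simp only [run_seq, run_set, val_succ, val_var, hi, val_get]
    refine ⟨by simp [hi], fun a ha => ?_, fun l hl => ?_⟩
    · rw [← h1 a ha]
      simp at ha
      simp [ha]
    · rcases Nat.lt_succ_iff_lt_or_eq.1 (Nat.lt_succ_iff.2 hl) with hl | rfl
      · have hl' : l ≠ k + 1 := by omega
        simpa [hl', hi] using h2 l (by omega)
      · simp only [ne_eq, reduceCtorEq, not_false_eq_true, update_of_ne, update_self, hi, e1, e2, e3,
          hp (S nx 0 - 1 - k) (by omega)]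
        omega

/-- The effect of the preparations on the arrays. -/
structure Prepared (N n : ℕ) (X : ℕ → ℕ) (S : Var → ℕ → ℕ) : Prop where
  pd : ∀ k ≤ N, S pd k = k - 1
  sh : ∀ l ≤ N, S sh l = n + l
  rv : ∀ l ≤ N, S rv l = n - 1 - l
  pi : (∀ k < n, ∀ l < n, X k = X l → k = l) → ∀ k < n, S pi (X k) = k
  pl : ∀ k < N, S pl k = k
  fk : ∀ k < N, S fk k = 2
  m : S m 0 = 1
  h : S h 0 = 0
  md : S md 0 = 2

/-- The arrays that the preparations change. -/
def prepVars : List Var := [i, pd, rv, sh, pi, pl, fk, m, h, md]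

/-- All tables except `pi` are correct for any input. The entries of `pi` invert `X` and make sense
only if `X` is injective below `n`, so this part of `Prepared` is conditional. -/
theorem prepProg_spec (hn : S nx 0 ≤ N) (h0 : S pd 0 = 0) :
    Agree prepVars S (prepProg.run N S) ∧ Prepared N (S nx 0) (S x) (prepProg.run N S) := by
  simp only [prepProg, run_seq]
  obtain ⟨a1, b1, c1⟩ := scatter_spec (N := N) (S := S) (i := i) (t := pd) (p := .tt)
    (e := succ (var i)) (f := var i) (P := fun _ => True) (E := fun k => k + 1) (F := id) (by simp)
    (by simp) (by simp) (by simp) (fun k _ l _ _ _ h => by simpa using h)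
  set S1 := (scatter i pd .tt (succ (var i)) (var i)).run N S
  have p1 : ∀ k ≤ N, S1 pd k = k - 1 := by
    rintro (_ | k) hk
    · rw [c1 0 (by simp), h0]
    · exact b1 k (by omega) trivial
  have n1 := a1 nx (by simp)
  obtain ⟨a2, b2⟩ := tableProg_spec (N := N) (S := S1) (by rw [n1]; exact hn) p1
  set S2 := tableProg.run N S1
  rw [n1] at b2
  have n2 := (a2 nx (by simp)).trans n1
  have x2 := (a2 x (by simp)).trans (a1 x (by simp))
  set S3 := (scatter i pi (.lt (var i) (var nx)) (get x (var i)) (var i)).run N S2 with hS3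
  have a3 : Agree [i, pi] S2 S3 ∧ ((∀ k < S nx 0, ∀ l < S nx 0, S x k = S x l → k = l) →
      ∀ k < S nx 0, S3 pi (S x k) = k) := by
    refine ⟨scatter_agree (by simp) _ _ _ _, fun hx k hk => ?_⟩
    refine (scatter_spec (N := N) (S := S2) (i := i) (t := pi) (P := fun k => k < S nx 0)
      (E := S x) (F := id) (by simp) (fun S' h => ?_) (fun S' h _ => ?_) (by simp)
      (fun k _ l _ hk hl => hx k hk l hl)).2.1 k (by omega) hk
    · simp [h nx (by simp), n2]
    · simp [h x (by simp), x2]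
  obtain ⟨a4, b4, c4⟩ := scatter_spec (N := N) (S := S3) (i := i) (t := pl) (p := .tt)
    (e := var i) (f := var i) (P := fun _ => True) (E := id) (F := id) (by simp)
    (by simp) (by simp) (by simp) (fun k _ l _ _ _ h => by simpa using h)
  set S4 := (scatter i pl .tt (var i) (var i)).run N S3
  obtain ⟨a5, b5, c5⟩ := scatter_spec (N := N) (S := S4) (i := i) (t := fk) (p := .tt)
    (e := var i) (f := lit 2) (P := fun _ => True) (E := id) (F := fun _ => 2) (by simp)
    (by simp) (by simp) (by simp) (fun k _ l _ _ _ h => by simpa using h)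
  set S5 := (scatter i fk .tt (var i) (lit 2)).run N S4
  have a6 : Agree prepVars S S5 := (a1.mono (by simp [prepVars])).trans
    ((a2.mono (by simp [prepVars])).trans ((a3.1.mono (by simp [prepVars])).trans
    ((a4.mono (by simp [prepVars])).trans (a5.mono (by simp [prepVars])))))
  simp only [run_put, val_lit]
  refine ⟨fun a ha => ?_, ?_⟩
  · rw [← a6 a ha]
    simp [prepVars] at ha
    simp [ha]
  · constructor
    · simpa [a5 pd (by simp), a4 pd (by simp), a3.1 pd (by simp), a2 pd (by simp)] using p1
    · simpa [a5 sh (by simp), a4 sh (by simp), a3.1 sh (by simp)] using fun l hl => (b2 l hl).1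
    · simpa [a5 rv (by simp), a4 rv (by simp), a3.1 rv (by simp)] using fun l hl => (b2 l hl).2
    · simpa [a5 pi (by simp), a4 pi (by simp)] using a3.2
    · simpa [a5 pl (by simp)] using b4
    · simpa using b5
    · simp
    · simp
    · simp

end ArrProg

/-! ### The injection -/

section Injection

variable {n : ℕ}

/-- A permutation of `Fin n` as a function on all natural numbers. -/
def permExtend (τ : Equiv.Perm (Fin n)) (p : ℕ) : ℕ := if h : p < n then τ ⟨p, h⟩ else p

theorem permExtend_of_lt (τ : Equiv.Perm (Fin n)) {p : ℕ} (h : p < n) : permExtend τ p = τ ⟨p, h⟩ := by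
  simp [permExtend, h]

@[simp]
theorem permExtend_coe (τ : Equiv.Perm (Fin n)) (i : Fin n) : permExtend τ i = τ i := by
  simp [permExtend]

/-- The extension by the identity, not by a constant, is what makes the function injective on all of
`ℕ`, as the lemmas on `can` require. -/
theorem permExtend_injective (τ : Equiv.Perm (Fin n)) : Function.Injective (permExtend τ) := by
  intro p q h
  by_cases hp : p < n
  · by_cases hq : q < n
    · rw [permExtend_of_lt τ hp, permExtend_of_lt τ hq] at h
      have := τ.injective (Fin.ext h)
      simpa using this
    · rw [permExtend_of_lt τ hp] at h
      simp only [permExtend, hq, dif_neg, not_false_eq_true] at h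
      have := (τ ⟨p, hp⟩).isLt
      omega
  · by_cases hq : q < n
    · rw [permExtend_of_lt τ hq] at h
      simp only [permExtend, hp, dif_neg, not_false_eq_true] at h
      have := (τ ⟨q, hq⟩).isLt
      omega
    · simpa [permExtend, hp, hq] using h

/-- The place of a value in the canonical placement. -/
noncomputable def place (σ τ : Equiv.Perm (Fin n)) (v : ℕ) : ℕ :=
  can (permExtend τ.symm) (permExtend σ.symm) n (Finset.range n) v

variable (σ τ : Equiv.Perm (Fin n))

theorem place_lt {v : ℕ} (hv : v < n) : place σ τ v < n :=
  Finset.mem_range.1 (can_mem (permExtend_injective _) (Finset.card_range n) v hv)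

theorem place_inj {v w : ℕ} (hv : v < n) (hw : w < n) (h : place σ τ v = place σ τ w) : v = w := by
  rcases lt_trichotomy v w with hlt | rfl | hlt
  · exact absurd h.symm (can_inj (permExtend_injective _) (Finset.card_range n) w hw v hlt)
  · rfl
  · exact absurd h (can_inj (permExtend_injective _) (Finset.card_range n) v hv w hlt)

/-- The first linear extension. -/
noncomputable def firstExt : Equiv.Perm (Fin n) :=
  Equiv.ofBijective (fun i => ⟨place σ τ (σ i), place_lt σ τ (σ i).isLt⟩)
    (Finite.injective_iff_bijective.1 fun i j h =>
      σ.injective (Fin.ext (place_inj σ τ (σ i).isLt (σ j).isLt (by simpa using h))))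

@[simp]
theorem firstExt_apply (i : Fin n) : (firstExt σ τ i : ℕ) = place σ τ (σ i) := rfl

/-- The second linear extension. -/
noncomputable def secondExt : Equiv.Perm (Fin n) :=
  (Fin.revPerm.trans (firstExt σ τ)).trans τ.symm

theorem secondExt_apply (i : Fin n) : secondExt σ τ i = τ.symm (firstExt σ τ i.rev) := rfl

theorem permExtend_place (i : Fin n) :
    permExtend τ.symm (place σ τ (σ i)) = τ.symm (firstExt σ τ i) := by
  rw [← firstExt_apply, permExtend_coe]

/-- Suppose that `i ≺ j` but `σ j` lies lower than `σ i`. As the larger value it then lies to the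
right, by `can_linear`; so `σ i` is above and to the left of it, and `can_valid` forces `j ≤ i`. -/
theorem firstExt_mem : firstExt σ τ ∈ linExts (permPoset σ) n := by
  rintro i j ⟨h1, h2⟩
  have h2' : (σ i : ℕ) < σ j := h2
  by_contra hc
  have hlt : place σ τ (σ j) < place σ τ (σ i) := by
    have h3 : (firstExt σ τ j : ℕ) ≤ firstExt σ τ i := not_lt.1 hc
    refine lt_of_le_of_ne h3 fun h4 => ?_
    have := place_inj σ τ (σ j).isLt (σ i).isLt h4
    omega
  have h3 := can_linear (π := permExtend σ.symm) (permExtend_injective τ.symm) (Finset.card_range n) _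
    (σ j).isLt _ h2' hlt
  have h4 := can_valid (π := permExtend σ.symm) (permExtend_injective τ.symm) (Finset.card_range n) _
    (σ i).isLt _ (σ j).isLt hlt h3
  rw [permExtend_coe, permExtend_coe, Equiv.symm_apply_apply, Equiv.symm_apply_apply] at h4
  exact absurd h1 (not_lt.2 h4)

/-- The argument for `firstExt_mem` with abscissae in place of heights: if the larger value lay to
the left of the smaller one, it could not be below it by `can_linear`, hence would be above it, and
`can_valid` would contradict the reversed order of the indices. -/
theorem secondExt_mem : secondExt σ τ ∈ linExts (permPoset (reversal σ)) n := by
  rintro i j ⟨h1, h2⟩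
  have h2' : (σ i.rev : ℕ) < σ j.rev := h2
  have h1' : (j.rev : Fin n) < i.rev := Fin.rev_lt_rev.2 h1
  rw [secondExt_apply, secondExt_apply]
  by_contra hc
  have e1 := permExtend_place σ τ i.rev
  have e2 := permExtend_place σ τ j.rev
  have hlt : permExtend τ.symm (place σ τ (σ j.rev)) < permExtend τ.symm (place σ τ (σ i.rev)) := by
    rw [e1, e2]
    have h3 : (τ.symm (firstExt σ τ j.rev) : ℕ) ≤ τ.symm (firstExt σ τ i.rev) := by simpa using hc
    refine lt_of_le_of_ne h3 fun h4 => ?_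
    have := (firstExt σ τ).injective (τ.symm.injective (Fin.ext h4))
    exact absurd h1' (by rw [this]; exact lt_irrefl _)
  have h5 : place σ τ (σ i.rev) < place σ τ (σ j.rev) := by
    by_contra h6
    rcases lt_or_eq_of_le (not_lt.1 h6) with h6 | h6
    · have := can_linear (π := permExtend σ.symm) (permExtend_injective τ.symm) (Finset.card_range n) _
        (σ j.rev).isLt _ h2' h6
      exact absurd this (not_lt.2 hlt.le)
    · have := place_inj σ τ (σ j.rev).isLt (σ i.rev).isLt h6
      omega
  have h4 := can_valid (π := permExtend σ.symm) (permExtend_injective τ.symm) (Finset.card_range n) _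
    (σ j.rev).isLt _ (σ i.rev).isLt h5 hlt
  rw [permExtend_coe, permExtend_coe, Equiv.symm_apply_apply, Equiv.symm_apply_apply] at h4
  exact absurd h1' (not_lt.2 h4)

/-- The injection from permutations to pairs of linear extensions. -/
noncomputable def pairOfPerm (n : ℕ) (σ τ : Equiv.Perm (Fin n)) :
    linExts (permPoset σ) n × linExts (permPoset (reversal σ)) n :=
  (⟨firstExt σ τ, firstExt_mem σ τ⟩, ⟨secondExt σ τ, secondExt_mem σ τ⟩)

/-- The permutation that a pair of linear extensions determines. -/
def permOfPair (f g : Equiv.Perm (Fin n)) : Equiv.Perm (Fin n) :=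
  (g.symm.trans Fin.revPerm).trans f

theorem permOfPair_symm_apply (f g : Equiv.Perm (Fin n)) (i : Fin n) :
    (permOfPair f g).symm (f i) = g i.rev := by
  simp [permOfPair]

/-- The second extension is by definition `τ⁻¹` after the first one, read backwards. This determines
`τ`, and nothing about the placement enters. -/
theorem permOfPair_exts : permOfPair (firstExt σ τ) (secondExt σ τ) = τ := by
  ext i
  simp [permOfPair, secondExt]

theorem pairOfPerm_injective : Function.Injective (pairOfPerm n σ) := by
  intro τ τ' h
  have h1 : firstExt σ τ = firstExt σ τ' := congrArg (fun p => p.1.1) h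
  have h2 : secondExt σ τ = secondExt σ τ' := congrArg (fun p => p.2.1) h
  rw [← permOfPair_exts σ τ, h1, h2, permOfPair_exts]

/-- Only `permOfPair f g` can be a preimage, and for it the second component agrees as soon as the
first one does. A single computation of `firstExt` thus decides membership in the range. -/
theorem mem_range_pairOfPerm (f : linExts (permPoset σ) n)
    (g : linExts (permPoset (reversal σ)) n) :
    (f, g) ∈ Set.range (pairOfPerm n σ) ↔ firstExt σ (permOfPair f.1 g.1) = f.1 := by
  constructor
  · rintro ⟨τ, h⟩
    have h1 : firstExt σ τ = f.1 := congrArg (fun p => p.1.1) h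
    have h2 : secondExt σ τ = g.1 := congrArg (fun p => p.2.1) h
    rw [← h1, ← h2, permOfPair_exts]
  · intro h
    refine ⟨permOfPair f.1 g.1, Prod.ext (Subtype.ext h) (Subtype.ext ?_)⟩
    ext i
    change (secondExt σ (permOfPair f.1 g.1) i : ℕ) = _
    rw [secondExt_apply, h, permOfPair_symm_apply, Fin.rev_rev]

theorem eta_eq : eta σ = ((Set.range (pairOfPerm n σ))ᶜ.ncard : ℤ) := by
  classical
  have h1 := Set.ncard_add_ncard_compl (Set.range (pairOfPerm n σ))
  have h2 : (Set.range (pairOfPerm n σ)).ncard = n.factorial := by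
    rw [← Set.image_univ, Set.ncard_image_of_injective _ (pairOfPerm_injective σ),
      Set.ncard_univ, Nat.card_perm, Nat.card_fin]
  rw [h2, Nat.card_prod, Nat.card_coe_set_eq, Nat.card_coe_set_eq] at h1
  unfold eta numLinExts
  have h3 : ((n.factorial + (Set.range (pairOfPerm n σ))ᶜ.ncard : ℕ) : ℤ) = _ := congrArg _ h1
  push_cast at h3
  linarith

end Injection

/-! ### Counting -/

/-- All permutations of `Fin n` have the same sum of entries. The code of a pair is therefore twice
as long as that of `σ`, which explains the bound `2 * X` for witnesses. -/
theorem length_permCode {n : ℕ} (σ τ : Equiv.Perm (Fin n)) :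
    (permCode σ).length = (permCode τ).length := by
  have h : ∀ σ : Equiv.Perm (Fin n), (permCode σ).length = ∑ i : Fin n, ((i : ℕ) + 1) := by
    intro σ
    rw [← Equiv.sum_comp σ, permCode, listCode, List.length_flatMap, ← List.sum_ofFn]
    simp [List.map_ofFn, Function.comp_def]
  rw [h, h]

theorem etaWord_eq_ncard (w : List Bool) :
    etaWord w = {y : List Bool | y.length ≤ (2 * Polynomial.X : Polynomial ℕ).eval w.length ∧
      ∃ (n : ℕ) (σ : Equiv.Perm (Fin n)) (f : linExts (permPoset σ) n)
        (g : linExts (permPoset (reversal σ)) n),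
        (f, g) ∉ Set.range (pairOfPerm n σ) ∧ w = permCode σ ∧ y = permPairCode f.1 g.1}.ncard := by
  by_cases hw : ∃ s, allPermCode s = w
  · obtain ⟨⟨n, σ⟩, rfl⟩ := hw
    change etaWord (permCode σ) = _
    rw [etaWord_permCode, eta_eq, Int.toNat_natCast]
    have hinj : Function.Injective fun p : linExts (permPoset σ) n ×
        linExts (permPoset (reversal σ)) n => permPairCode p.1.1 p.2.1 := by
      rintro ⟨f, g⟩ ⟨f', g'⟩ h
      have := permPairCode_injective h
      simp only [Sigma.mk.injEq, heq_eq_eq, Prod.mk.injEq, true_and] at this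
      exact Prod.ext (Subtype.ext this.1) (Subtype.ext this.2)
    rw [← Set.ncard_image_of_injective _ hinj]
    congr 1
    ext y
    constructor
    · rintro ⟨⟨f, g⟩, h, rfl⟩
      refine ⟨?_, n, σ, f, g, h, rfl, rfl⟩
      change (permPairCode f.1 g.1).length ≤ Polynomial.eval (permCode σ).length _
      rw [permPairCode, List.length_append, length_permCode f.1 σ, length_permCode g.1 σ]
      simp
      omega
    · rintro ⟨_, m, σ', f, g, h, h1, rfl⟩
      have h2 := allPermCode_injective (a₁ := ⟨n, σ⟩) (a₂ := ⟨m, σ'⟩) h1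
      cases h2
      exact ⟨(f, g), h, rfl⟩
  · rw [etaWord, Function.extend_apply' _ _ _ hw]
    have : ∀ (n : ℕ) (σ : Equiv.Perm (Fin n)), w ≠ permCode σ := fun n σ h => hw ⟨⟨n, σ⟩, h.symm⟩
    simp [this]

/-! ### The program for the injection -/

namespace ArrProg

open Function Var ArrProg.Expr Cond Cmd

/-- The arrays contain the permutation `σ`. -/
structure HasPerm (N n : ℕ) (σ : Equiv.Perm (Fin n)) (S : Var → ℕ → ℕ) : Prop where
  lt : n + 2 ≤ N
  len : S nx 0 = n
  perm : ∀ k : Fin n, S x k = σ k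
  zero : ∀ a ∉ [x, y, nx, ny], S a = fun _ => 0

variable {N n : ℕ} {S S' : Var → ℕ → ℕ} {σ τ : Equiv.Perm (Fin n)}

theorem HasPerm.prepared (h : HasPerm N n σ S) :
    Agree prepVars S (prepProg.run N S) ∧ Prepared N n (S .x) (prepProg.run N S) := by
  have := prepProg_spec (N := N) (S := S) (by rw [h.len]; have := h.lt; omega)
    (by rw [h.zero pd (by simp)])
  rwa [h.len] at this

theorem HasPerm.ready (h : HasPerm N n σ S)
    (hS : Agree [i, gq, gg] (prepProg.run N S) S') (hg : ∀ k : Fin n, S' gg k = τ.symm k) :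
    Ready N n (permExtend τ.symm) (permExtend σ.symm) S' := by
  obtain ⟨h1, h2⟩ := h.prepared
  have hl := h.lt
  constructor
  · exact h.lt
  · rw [hS nx (by simp), h1 nx (by simp [prepVars]), h.len]
  · rw [hS pd (by simp)]; exact h2.pd
  · intro p hp
    rw [permExtend_of_lt _ hp, ← hg ⟨p, hp⟩]
  · intro j hj
    rw [hS pi (by simp), permExtend_of_lt _ hj]
    have h3 := h2.pi (fun k hk l hl e => by
      have e' : (σ ⟨k, hk⟩ : ℕ) = σ ⟨l, hl⟩ := by rw [← h.perm, ← h.perm]; exact e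
      simpa using σ.injective (Fin.ext e')) _ (σ.symm ⟨j, hj⟩).isLt
    rwa [h.perm, Equiv.apply_symm_apply] at h3
  · intro j hj
    rw [hS pl (by simp)]; exact h2.pl j (by omega)
  · intro j hj
    rw [hS fa (by simp), h1 fa (by simp [prepVars]), h.zero fa (by simp)]
  · intro j hj
    rw [hS fb (by simp), h1 fb (by simp [prepVars]), h.zero fb (by simp)]
  · intro j hj
    rw [hS fk (by simp)]; exact h2.fk j (by omega)
  · rw [hS m (by simp)]; exact h2.m
  · rw [hS .h (by simp)]; exact h2.h
  · rw [hS md (by simp)]; exact h2.md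

/-- The program for the pair of linear extensions of a permutation. -/
def pairProg : Cmd Var :=
  .seq prepProg (.seq (scatter i gg (.lt (var i) (var nx)) (get y (var i)) (var i))
    (.seq searchProg (.seq (scatter i o (.lt (var i) (var nx)) (var i) (get pl (get x (var i))))
    (.seq (scatter i o (.lt (var i) (var nx)) (get sh (var i))
      (get gg (get pl (get x (get rv (var i)))))) (put b (get sh (var nx)))))))

/-- The two extensions are written one behind the other into `o`. The tables `sh` and `rv` provide
the indices `n + k` and `n - 1 - k` for the second one, which is `τ⁻¹` of the place of `σ (n - 1 -
k)`. -/
theorem pairProg_spec (h : HasPerm N n σ S) (hy : ∀ k : Fin n, S y k = τ k) :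
    pairProg.run N S b 0 = n + n ∧ (∀ k : Fin n, pairProg.run N S o k = firstExt σ τ k) ∧
      ∀ k : Fin n, pairProg.run N S o (n + k) = secondExt σ τ k := by
  have hl := h.lt
  simp only [pairProg, run_seq]
  obtain ⟨a1, p1⟩ := h.prepared
  have hr := fun S' => h.ready (τ := τ) (S' := S')
  set S1 := prepProg.run N S
  have n1 : S1 nx 0 = n := by rw [a1 nx (by simp [prepVars]), h.len]
  have y1 : S1 y = S y := a1 y (by simp [prepVars])
  -- This loop inverts `τ`, so that `gg` gives the abscissa of the point at each height.
  obtain ⟨a2, b2, -⟩ := scatter_spec (N := N) (S := S1) (i := i) (t := gg)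
    (p := .lt (var i) (var nx)) (e := get y (var i)) (f := var i) (P := fun k => k < n)
    (E := S y) (F := id) (by simp) (fun S' h => by simp [h nx (by simp), n1])
    (fun S' h _ => by simp [h y (by simp), y1]) (by simp)
    (fun k _ l _ hk hl e => by
      have e' : (τ ⟨k, hk⟩ : ℕ) = τ ⟨l, hl⟩ := by rw [← hy, ← hy]; exact e
      simpa using τ.injective (Fin.ext e'))
  set S2 := (scatter i gg (.lt (var i) (var nx)) (get y (var i)) (var i)).run N S1
  have g2 : ∀ k : Fin n, S2 gg k = τ.symm k := by
    intro k
    have := b2 (τ.symm k) (by omega) (τ.symm k).isLt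
    rwa [hy, Equiv.apply_symm_apply] at this
  obtain ⟨a3, b3⟩ := searchProg_result (permExtend_injective _)
    (hr S2 (a2.mono (by simp)) g2)
  set S3 := searchProg.run N S2
  have n3 : S3 nx 0 = n := by rw [a3 nx (by simp [searchVars]), a2 nx (by simp), n1]
  have x3 : S3 x = S x := by
    rw [a3 x (by simp [searchVars]), a2 x (by simp), a1 x (by simp [prepVars])]
  have g3 : S3 gg = S2 gg := a3 gg (by simp [searchVars])
  have s3 : S3 sh = S1 sh := by rw [a3 sh (by simp [searchVars]), a2 sh (by simp)]
  have r3 : S3 rv = S1 rv := by rw [a3 rv (by simp [searchVars]), a2 rv (by simp)]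
  have pl3 : ∀ k : Fin n, S3 pl (S x k) = firstExt σ τ k := by
    intro k
    rw [h.perm, b3 _ (σ k).isLt]
    rfl
  obtain ⟨a4, b4, -⟩ := scatter_spec (N := N) (S := S3) (i := i) (t := o)
    (p := .lt (var i) (var nx)) (e := var i) (f := get pl (get x (var i))) (P := fun k => k < n)
    (E := id) (F := fun k => S3 pl (S x k)) (by simp) (fun S' h => by simp [h nx (by simp), n3])
    (by simp) (fun S' h _ => by simp [h pl (by simp), h x (by simp), x3])
    (fun k _ l _ hk hl e => e)
  set S4 := (scatter i o (.lt (var i) (var nx)) (var i) (get pl (get x (var i)))).run N S3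
  obtain ⟨a5, b5, c5⟩ := scatter_spec (N := N) (S := S4) (i := i) (t := o)
    (p := .lt (var i) (var nx)) (e := get sh (var i))
    (f := get gg (get pl (get x (get rv (var i))))) (P := fun k => k < n)
    (E := fun k => S1 sh k) (F := fun k => S2 gg (S3 pl (S x (S1 rv k)))) (by simp)
    (fun S' h => by simp [h nx (by simp), a4 nx (by simp), n3])
    (fun S' h _ => by simp [h sh (by simp), a4 sh (by simp), s3])
    (fun S' h _ => by
      simp [h gg (by simp), a4 gg (by simp), g3, h pl (by simp), a4 pl (by simp), h x (by simp),
        a4 x (by simp), x3, h rv (by simp), a4 rv (by simp), r3])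
    (fun k _ l _ hk hl e => by
      rw [p1.sh k (by omega), p1.sh l (by omega)] at e
      omega)
  set S5 := (scatter i o (.lt (var i) (var nx)) (get sh (var i))
    (get gg (get pl (get x (get rv (var i)))))).run N S4
  have n5 : S5 nx 0 = n := by rw [a5 nx (by simp), a4 nx (by simp), n3]
  have s5 : S5 sh = S1 sh := by rw [a5 sh (by simp), a4 sh (by simp), s3]
  simp only [run_put, update_self, val_get, val_var, n5, s5, ne_eq, reduceCtorEq,
    not_false_eq_true, update_of_ne]
  refine ⟨p1.sh n (by omega), fun k => ?_, fun k => ?_⟩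
  · rw [c5 k fun l hl hl' => by rw [p1.sh l (by omega)]; omega]
    exact (b4 k (by omega) k.isLt).trans (pl3 k)
  · have h1 := b5 k (by omega) k.isLt
    rw [p1.sh k (by omega), p1.rv k (by omega)] at h1
    have h2 : n - 1 - (k : ℕ) = (k.rev : Fin n) := by rw [Fin.val_rev]; omega
    rw [h1, h2, pl3, g2, secondExt_apply]

end ArrProg

/-! ### The program for the complement of the range -/

namespace ArrProg

open Function Var ArrProg.Expr Cond Cmd

/-- The numbers `X` and `Y` violate, at `k` and `l`, the conditions for a permutation and two
linear extensions. -/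
def Violates (n : ℕ) (X Y : ℕ → ℕ) (k l : ℕ) : Prop :=
  n ≤ X k ∨ n ≤ Y k ∨ n ≤ Y (n + k) ∨ (k < l ∧ (X k = X l ∨ Y k = Y l ∨ Y (n + k) = Y (n + l) ∨
    (X k < X l ∧ Y l ≤ Y k) ∨ (X (n - 1 - k) < X (n - 1 - l) ∧ Y (n + l) ≤ Y (n + k))))

/-- The test for `Violates`. -/
def violates : Cond Var :=
  .or (.le (var nx) (get x (var i))) (.or (.le (var nx) (get y (var i)))
    (.or (.le (var nx) (get gq (var i))) (.and (.lt (var i) (var j))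
      (.or (.eq (get x (var i)) (get x (var j))) (.or (.eq (get y (var i)) (get y (var j)))
        (.or (.eq (get gq (var i)) (get gq (var j)))
          (.or (.and (.lt (get x (var i)) (get x (var j))) (.le (get y (var j)) (get y (var i))))
            (.and (.lt (get x (get rv (var i))) (get x (get rv (var j))))
              (.le (get gq (var j)) (get gq (var i)))))))))))

/-- The program that checks the input. -/
def checkProg : Cmd Var :=
  .seq (.ite (.and (.eq (get x (var nx)) (lit 0)) (.and (.eq (var ny) (get sh (var nx)))
      (.eq (get y (var ny)) (lit 0)))) (nop bad) (put bad (lit 1)))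
    (.search₂ i j bad (.and (.and (.lt (var i) (var nx)) (.lt (var j) (var nx))) violates))

/-- The program that decides whether a word encodes a pair outside the range of the injection. -/
def relProg : Cmd Var :=
  .seq prepProg (.seq (scatter i gq (.lt (var i) (var nx)) (var i) (get y (get sh (var i))))
    (.seq (scatter i gg (.lt (var i) (var nx)) (get y (var i)) (get gq (get rv (var i))))
    (.seq searchProg (.seq checkProg (.seq (put b (lit 0))
    (.seq (.search i b (.and (.lt (var i) (var nx))
      (.not (.eq (get pl (get x (var i))) (get y (var i))))))
    (.ite (.and (.eq (var bad) (lit 0)) (.not (.eq (var b) (lit 0)))) (put r (lit 1))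
      (put r (lit 0)))))))))

variable {N n : ℕ} {S S' : Var → ℕ → ℕ}

/-- All checks succeed. -/
def Valid (n : ℕ) (X Y : ℕ → ℕ) (ny : ℕ) : Prop :=
  X n = 0 ∧ ny = n + n ∧ Y (n + n) = 0 ∧ ∀ k < n, ∀ l < n, ¬ Violates n X Y k l

/-- The conditions tested before the double loop say that the words are list codes, their last
decoded entries being `0`, and that the second list is twice as long as the first. -/
theorem checkProg_spec (hl : n + 2 ≤ N) (hn : S nx 0 = n) (hs : S sh n = n + n)
    (hr : ∀ k < n, S rv k = n - 1 - k) (hq : ∀ k < n, S gq k = S y (n + k)) (hb : S bad 0 = 0) :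
    Agree [i, j, bad] S (checkProg.run N S) ∧
      (checkProg.run N S bad 0 = 0 ↔ Valid n (S x) (S y) (S ny 0)) := by
  simp only [checkProg, run_seq]
  set S1 := (Cmd.ite (.and (.eq (get x (var nx)) (lit 0)) (.and (.eq (var ny) (get sh (var nx)))
      (.eq (get y (var ny)) (lit 0)))) (nop bad) (put bad (lit 1))).run N S with hS1
  have h1 : Agree [i, j, bad] S S1 ∧
      (S1 bad 0 = 0 ↔ S x n = 0 ∧ S ny 0 = n + n ∧ S y (n + n) = 0) := by
    rw [hS1]
    simp only [run_ite, test_and, test_eq, val_get, val_var, val_lit, run_nop, run_put, hn, hs]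
    split_ifs with hc
    · refine ⟨Agree.refl _ _, by simp only [hb, true_iff]; exact ⟨hc.1, hc.2.1, hc.2.1 ▸ hc.2.2⟩⟩
    · refine ⟨Agree.update (by simp) _, ?_⟩
      simp only [update_self, one_ne_zero, false_iff]
      exact fun h => hc ⟨h.1, h.2.1, h.2.1 ▸ h.2.2⟩
  obtain ⟨a1, b1⟩ := h1
  obtain ⟨a2, b2⟩ := search₂_spec (N := N) (S := S1) (i := i) (j := j) (r := bad)
    (p := .and (.and (.lt (var i) (var nx)) (.lt (var j) (var nx))) violates)
    (P := fun k l => (k < n ∧ l < n) ∧ Violates n (S x) (S y) k l) (by simp) (by simp) (by simp)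
    (fun S' h => by
      have h' := a1.trans h
      simp only [violates, test_and, test_or, test_lt, test_le, test_eq, val_var, val_get,
        h' nx (by simp), h' x (by simp), h' y (by simp), h' gq (by simp), h' rv (by simp), hn]
      refine and_congr_right fun hh => ?_
      rw [hr _ hh.1, hr _ hh.2, hq _ hh.1, hq _ hh.2, Violates])
  refine ⟨a1.trans a2, b2.trans ?_⟩
  rw [b1, Valid]
  constructor
  · rintro ⟨⟨h1, h2, h3⟩, h4⟩
    exact ⟨h1, h2, h3, fun k hk l hl hv => h4 k (by omega) l (by omega) ⟨⟨hk, hl⟩, hv⟩⟩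
  · rintro ⟨h1, h2, h3, h4⟩
    exact ⟨⟨h1, h2, h3⟩, fun k _ l _ hv => h4 k hv.1.1 l hv.1.2 hv.2⟩

/-- On words that encode nothing, the search still runs, on meaningless arrays. Its verdict is
therefore an unspecified `Q`, which acquires a meaning only if the arrays contain permutations;
otherwise `Valid` already rejects. -/
theorem relProg_spec (hl : n + 2 ≤ N) (hn : S nx 0 = n)
    (hz : ∀ a ∉ [Var.x, .y, .nx, .ny], S a = fun _ => 0) :
    ∃ Q : Prop, (0 < relProg.run N S r 0 ↔ Valid n (S x) (S y) (S ny 0) ∧ Q) ∧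
      ∀ σ f g : Equiv.Perm (Fin n), (∀ k : Fin n, S x k = σ k) → (∀ k : Fin n, S y k = f k) →
        (∀ k : Fin n, S y (n + k) = g k) → (Q ↔ firstExt σ (permOfPair f g) ≠ f) := by
  simp only [relProg, run_seq]
  obtain ⟨a1, p1⟩ := prepProg_spec (N := N) (S := S) (by omega) (by rw [hz pd (by simp)])
  have hr : ∀ {σ τ : Equiv.Perm (Fin n)} {S'}, (∀ k : Fin n, S x k = σ k) → _ := fun {σ τ S'} h =>
    HasPerm.ready (N := N) (S := S) (S' := S') (σ := σ) (τ := τ) ⟨hl, hn, h, hz⟩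
  rw [hn] at p1
  set S1 := prepProg.run N S
  have n1 : S1 nx 0 = n := by rw [a1 nx (by simp [prepVars]), hn]
  have x1 : S1 x = S x := a1 x (by simp [prepVars])
  have y1 : S1 y = S y := a1 y (by simp [prepVars])
  obtain ⟨a2, b2, -⟩ := scatter_spec (N := N) (S := S1) (i := i) (t := gq)
    (p := .lt (var i) (var nx)) (e := var i) (f := get y (get sh (var i))) (P := fun k => k < n)
    (E := id) (F := fun k => S y (S1 sh k)) (by simp) (fun S' h => by simp [h nx (by simp), n1])
    (by simp) (fun S' h _ => by simp [h y (by simp), y1, h sh (by simp)]) (fun k _ l _ _ _ e => e)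
  set S2 := (scatter i gq (.lt (var i) (var nx)) (var i) (get y (get sh (var i)))).run N S1
  have q2 : ∀ k < n, S2 gq k = S y (n + k) := by
    intro k hk
    have := b2 k (by omega) hk
    rwa [p1.sh k (by omega)] at this
  have a3 := scatter_agree (N := N) (i := i) (t := gg) (by simp) (.lt (var i) (var nx))
    (get y (var i)) (get gq (get rv (var i))) S2
  have b3 := fun h1 h2 h3 h4 => (scatter_spec (N := N) (S := S2) (i := i) (t := gg)
    (p := .lt (var i) (var nx)) (e := get y (var i)) (f := get gq (get rv (var i)))
    (P := fun k => k < n) (E := S y) (F := fun k => S2 gq (S1 rv k)) (by simp) h1 h2 h3 h4).2.1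
  replace b3 := b3 (fun S' h => by simp [h nx (by simp), a2 nx (by simp), n1])
    (fun S' h _ => by simp [h y (by simp), a2 y (by simp), y1])
    (fun S' h _ => by simp [h gq (by simp), h rv (by simp), a2 rv (by simp)])
  set S3 := (scatter i gg (.lt (var i) (var nx)) (get y (var i)) (get gq (get rv (var i)))).run N S2
  have a13 : Agree [i, gq, gg] S1 S3 := (a2.mono (by simp)).trans (a3.mono (by simp))
  have n3 : S3 nx 0 = n := by rw [a13 nx (by simp), n1]
  have a4 := (searchProg_spec (N := N) (S := S3) (by omega)
    (by rw [a13 pd (by simp)]; exact p1.pd)).1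
  have b4 := fun {σ τ : Equiv.Perm (Fin n)} (h : ∀ k : Fin n, S x k = σ k) h' =>
    (searchProg_result (permExtend_injective _) (hr (τ := τ) h a13 h')).2
  set S4 := searchProg.run N S3
  have x4 : S4 x = S x := by rw [a4 x (by simp [searchVars]), a13 x (by simp), x1]
  have y4 : S4 y = S y := by rw [a4 y (by simp [searchVars]), a13 y (by simp), y1]
  have n4 : S4 nx 0 = n := by rw [a4 nx (by simp [searchVars]), n3]
  have ny4 : S4 ny = S ny := by
    rw [a4 ny (by simp [searchVars]), a13 ny (by simp), a1 ny (by simp [prepVars])]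
  obtain ⟨a5, b5⟩ := checkProg_spec (N := N) (S := S4) hl n4
    (by rw [a4 sh (by simp [searchVars]), a13 sh (by simp), p1.sh n (by omega)])
    (fun k hk => by rw [a4 rv (by simp [searchVars]), a13 rv (by simp), p1.rv k (by omega)])
    (fun k hk => by rw [a4 gq (by simp [searchVars]), a3 gq (by simp), q2 k hk, y4])
    (by rw [a4 bad (by simp [searchVars]), a13 bad (by simp), a1 bad (by simp [prepVars]),
      hz bad (by simp)])
  rw [x4, y4, ny4] at b5
  set S5 := checkProg.run N S4
  have x5 : S5 x = S x := by rw [a5 x (by simp), x4]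
  have y5 : S5 y = S y := by rw [a5 y (by simp), y4]
  have n5 : S5 nx 0 = n := by rw [a5 nx (by simp), n4]
  have pl5 : S5 pl = S4 pl := a5 pl (by simp)
  set S6 := (put b (lit 0)).run N S5 with hS6
  have a6 : Agree [b] S5 S6 := by
    rw [hS6, run_put]
    exact Agree.update (by simp) _
  have b6 : S6 b 0 = 0 := by simp [hS6]
  obtain ⟨a7, b7⟩ := search_spec (N := N) (S := S6) (i := i) (r := b)
    (p := .and (.lt (var i) (var nx)) (.not (.eq (get pl (get x (var i))) (get y (var i)))))
    (P := fun k => k < n ∧ S4 pl (S x k) ≠ S y k) (by simp) (fun S' h => by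
      have h' := (a6.mono (by simp : [b] ⊆ [i, b])).trans h
      simp only [test_and, test_lt, test_not, test_eq, val_var, val_get, h' nx (by simp),
        h' x (by simp), h' y (by simp), h' pl (by simp), n5, x5, y5, pl5])
  set S7 := (Cmd.search i b (.and (.lt (var i) (var nx))
      (.not (.eq (get pl (get x (var i))) (get y (var i)))))).run N S6
  have c7 : S7 bad 0 = S5 bad 0 := by rw [a7 bad (by simp), a6 bad (by simp)]
  refine ⟨S7 b 0 ≠ 0, ?_, fun σ f g hx hf hg => ?_⟩
  · rw [← b5, ← c7]
    simp only [run_ite, run_put, test_and, test_not, test_eq, val_var, val_lit]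
    split_ifs with hc <;> simp [hc]
  -- The program puts `g (rev k)` at the height `f k`, which is precisely the inverse of `permOfPair
  -- f g`; neither `τ` nor the inverse of `g` has to be computed.
  · have g3 : ∀ k : Fin n, S3 gg k = (permOfPair f g).symm k := by
      intro k
      have h1 := b3 (fun k _ l _ hk hl e => by
        have e' : (f ⟨k, hk⟩ : ℕ) = f ⟨l, hl⟩ := by rw [← hf, ← hf]; exact e
        simpa using f.injective (Fin.ext e')) (f.symm k) (by omega) (f.symm k).isLt
      have h2 : n - 1 - (f.symm k : ℕ) = ((f.symm k).rev : Fin n) := by rw [Fin.val_rev]; omega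
      rw [hf, Equiv.apply_symm_apply, p1.rv _ (by omega), h2, q2 _ (Fin.isLt _), hg] at h1
      rw [h1]
      simp [permOfPair]
    have h4 : ∀ k : Fin n, S4 pl (S x k) = firstExt σ (permOfPair f g) k := by
      intro k
      rw [hx, b4 hx g3 _ (σ k).isLt]
      rfl
    rw [ne_eq, b7, ne_eq, not_iff_not]
    constructor
    · rintro ⟨-, h5⟩
      ext k
      rw [← h4, ← hf]
      by_contra h6
      exact h5 k (by omega) ⟨k.isLt, h6⟩
    · intro h5
      refine ⟨b6, fun k _ hk => hk.2 ?_⟩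
      have h6 := h4 ⟨k, hk.1⟩
      rw [h5, ← hf] at h6
      exact h6

end ArrProg

/-! ### The two polynomial-time statements -/

namespace ArrProg

open Function Var ArrProg.Cmd

/-- The contents of the arrays at the start, for the words `u` and `v`. -/
def start (u v : List Bool) (a : Var) : ℕ → ℕ :=
  input (V := Var ⊕ Bool) (.inl x) (.inl y) (.inl nx) (.inl ny) u v (.inl a)

theorem start_x (u v : List Bool) (k : ℕ) : start u v x k = (entries u).getD k 0 := by
  simp [start, input, inputLists]

theorem start_y (u v : List Bool) (k : ℕ) : start u v y k = (entries v).getD k 0 := by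
  simp [start, input, inputLists]

theorem start_nx (u v : List Bool) : start u v nx 0 = u.count false := by
  simp [start, input, inputLists]

theorem start_ny (u v : List Bool) : start u v ny 0 = v.count false := by
  simp [start, input, inputLists]

theorem start_zero (u v : List Bool) : ∀ a ∉ [x, y, nx, ny], start u v a = fun _ => 0 := by
  intro a ha
  simp only [List.mem_cons, List.not_mem_nil, or_false, not_or] at ha
  ext k
  simp [start, input, inputLists, ha]

theorem eval_prog_start (N : ℕ) (c : Cmd Var) (u v : List Bool) (a : Var) :
    eval N c.prog (input (.inl x) (.inl y) (.inl nx) (.inl ny) u v) (.inl a) =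
      c.run N (start u v) a :=
  congrFun (Cmd.eval_prog N c _) a

theorem entries_permCode {n : ℕ} (σ : Equiv.Perm (Fin n)) :
    entries (permCode σ) = List.ofFn (fun k => (σ k : ℕ)) ++ [0] :=
  entries_listCode _

theorem permPairCode_eq {n : ℕ} (f g : Equiv.Perm (Fin n)) : permPairCode f g =
    listCode (List.ofFn (fun k => (f k : ℕ)) ++ List.ofFn fun k => (g k : ℕ)) :=
  (listCode_append _ _).symm

theorem count_permCode {n : ℕ} (σ : Equiv.Perm (Fin n)) : (permCode σ).count false = n := by
  have := length_entries (permCode σ)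
  rw [entries_permCode] at this
  simpa using this.symm

theorem getD_ofFn_append {n : ℕ} (F : Fin n → ℕ) (l : List ℕ) (k : Fin n) :
    (List.ofFn F ++ l).getD k 0 = F k := by
  rw [List.getD_append _ _ _ _ (by simp), List.getD_eq_getElem _ _ (by simp), List.getElem_ofFn]

theorem getD_ofFn_append_add {n : ℕ} (F : Fin n → ℕ) (l : List ℕ) (k : ℕ) :
    (List.ofFn F ++ l).getD (n + k) 0 = l.getD k 0 := by
  rw [List.getD_append_right _ _ _ _ (by simp)]
  simp

theorem getD_ofFn_append_self {n : ℕ} (F : Fin n → ℕ) (l : List ℕ) :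
    (List.ofFn F ++ l).getD n 0 = l.getD 0 0 :=
  getD_ofFn_append_add F l 0

theorem eq_ofFn_append {n : ℕ} {l : List ℕ} (hl : l.length = n + 1) (h0 : l.getD n 0 = 0)
    {F : Fin n → ℕ} (h : ∀ k : Fin n, l.getD k 0 = F k) : l = List.ofFn F ++ [0] := by
  refine List.ext_getElem (by simp [hl]) fun k h1 h2 => ?_
  rw [← List.getD_eq_getElem _ 0 h1, ← List.getD_eq_getElem _ 0 h2]
  rcases Nat.lt_succ_iff_lt_or_eq.1 (hl ▸ h1 : k < n + 1) with hk | rfl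
  · rw [h ⟨k, hk⟩, getD_ofFn_append _ _ ⟨k, hk⟩]
  · rw [h0, getD_ofFn_append_self]
    rfl

/-- Cancelling the final `false` that decoding has added. -/
theorem eq_listCode {w : List Bool} {l : List ℕ} (h : entries w = l ++ [0]) : w = listCode l := by
  have h1 := listCode_entries w
  rw [h, listCode_append] at h1
  exact (List.append_cancel_right h1).symm

theorem polyTime_pairOfPerm : Nonempty (Turing.TM2ComputableInPolyTime
    (fun s : Σ n : ℕ, Equiv.Perm (Fin n) × Equiv.Perm (Fin n) =>
      pairCode (permCode s.2.1, permCode s.2.2))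
    (fun t : Σ n : ℕ, Equiv.Perm (Fin n) × Equiv.Perm (Fin n) => permPairCode t.2.1 t.2.2)
    (fun s => ⟨s.1, (pairOfPerm s.1 s.2.1 s.2.2).1.1, (pairOfPerm s.1 s.2.1 s.2.2).2.1⟩)) := by
  refine polyTime_of_prog_list pairProg.prog (.inl x) (.inl y) (.inl nx) (.inl ny) (.inl o) (.inl b)
    (by simp) ?_
  rintro ⟨n, σ, τ⟩
  refine ⟨permCode σ, permCode τ, rfl, ?_⟩
  rw [eval_prog_start, eval_prog_start]
  have hc := List.count_le_length (a := false) (l := permCode σ)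
  rw [count_permCode] at hc
  obtain ⟨h1, h2, h3⟩ := pairProg_spec (N := (permCode σ).length + (permCode τ).length + 5) (σ := σ)
    (τ := τ) (S := start (permCode σ) (permCode τ))
    ⟨by omega, by rw [start_nx, count_permCode],
      fun k => by rw [start_x, entries_permCode, getD_ofFn_append], start_zero _ _⟩
    fun k => by rw [start_y, entries_permCode, getD_ofFn_append]
  rw [h1]
  change permPairCode (firstExt σ τ) (secondExt σ τ) = _
  rw [permPairCode_eq, List.range_add, List.map_append]
  congr 2
  · rw [← List.map_coe_finRange_eq_range, List.map_map, List.ofFn_eq_map]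
    exact List.map_congr_left fun k _ => (h2 k).symm
  · rw [← List.map_coe_finRange_eq_range, List.map_map, List.map_map, List.ofFn_eq_map]
    exact List.map_congr_left fun k _ => (h3 k).symm

/-- Distinct values below `n` form a permutation. -/
theorem exists_perm {n : ℕ} {X : ℕ → ℕ} (h : ∀ k < n, X k < n)
    (hX : ∀ k < n, ∀ l < n, k < l → X k ≠ X l) :
    ∃ σ : Equiv.Perm (Fin n), ∀ k : Fin n, X k = σ k := by
  have hi : Injective fun k : Fin n => (⟨X k, h k k.isLt⟩ : Fin n) := by
    intro k l e
    have e' : X k = X l := congrArg Fin.val e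
    rcases lt_trichotomy k l with h1 | h1 | h1
    · exact absurd e' (hX k k.isLt l l.isLt h1)
    · exact h1
    · exact absurd e'.symm (hX l l.isLt k k.isLt h1)
  exact ⟨Equiv.ofBijective _ (Finite.injective_iff_bijective.1 hi), fun k => rfl⟩

/-- The instances `k = l` of the test bound the entries, and the instances `k < l` give distinctness
and the order conditions. The decoded numbers therefore form three permutations, of which the last
two are linear extensions. -/
theorem valid_iff {u v : List Bool} {n : ℕ} (hn : u.count false = n) :
    Valid n (start u v x) (start u v y) (start u v ny 0) ↔
      ∃ σ : Equiv.Perm (Fin n), ∃ f ∈ linExts (permPoset σ) n,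
        ∃ g ∈ linExts (permPoset (reversal σ)) n, u = permCode σ ∧ v = permPairCode f g := by
  constructor
  · rintro ⟨h1, h2, h3, h4⟩
    simp only [Violates, not_or, not_and, not_le] at h4
    obtain ⟨σ, hσ⟩ := exists_perm (n := n) (X := start u v x)
      (fun k hk => (h4 k hk k hk).1) fun k hk l hl h => ((h4 k hk l hl).2.2.2 h).1
    obtain ⟨f, hf⟩ := exists_perm (n := n) (X := start u v y)
      (fun k hk => (h4 k hk k hk).2.1) fun k hk l hl h => ((h4 k hk l hl).2.2.2 h).2.1
    obtain ⟨g, hg⟩ := exists_perm (n := n) (X := fun k => start u v y (n + k))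
      (fun k hk => (h4 k hk k hk).2.2.1) fun k hk l hl h => ((h4 k hk l hl).2.2.2 h).2.2.1
    refine ⟨σ, f, fun k l h => ?_, g, fun k l h => ?_, eq_listCode ?_, ?_⟩
    · have := ((h4 k k.isLt l l.isLt).2.2.2 h.1).2.2.2.1
      rw [hσ, hσ, hf, hf] at this
      exact this h.2
    · have := ((h4 k k.isLt l l.isLt).2.2.2 h.1).2.2.2.2
      have e : ∀ k : Fin n, n - 1 - (k : ℕ) = (k.rev : ℕ) := fun k => by rw [Fin.val_rev]; omega
      rw [e, e, hσ, hσ] at this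
      have h5 := this h.2
      rw [show start u v y (n + k) = g k from hg k, show start u v y (n + l) = g l from hg l] at h5
      exact h5
    · exact eq_ofFn_append (by rw [length_entries, hn]) (by rw [← start_x u v, h1])
        fun k => by rw [← start_x u v, hσ]
    · rw [permPairCode_eq]
      apply eq_listCode
      rw [← List.ofFn_fin_append]
      refine eq_ofFn_append (by rw [length_entries, ← start_ny u v, h2])
        (by rw [← start_y u v, h3]) fun k => ?_
      rw [← start_y u v]
      refine Fin.addCases (fun k => ?_) (fun k => ?_) k
      · simp [hf]
      · rw [Fin.append_right]
        exact hg k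
  · rintro ⟨σ, f, hf, g, hg, rfl, rfl⟩
    have e1 : ∀ k : Fin n, start (permCode σ) (permPairCode f g) x k = σ k := fun k => by
      rw [start_x, entries_permCode, getD_ofFn_append]
    have e2 : ∀ k : Fin n, start (permCode σ) (permPairCode f g) y k = f k := fun k => by
      rw [start_y, permPairCode_eq, entries_listCode, List.append_assoc, getD_ofFn_append]
    have e3 : ∀ k : Fin n, start (permCode σ) (permPairCode f g) y (n + k) = g k := fun k => by
      rw [start_y, permPairCode_eq, entries_listCode, List.append_assoc, getD_ofFn_append_add,
        getD_ofFn_append]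
    refine ⟨?_, ?_, ?_, fun k hk l hl => ?_⟩
    · rw [start_x, entries_permCode, getD_ofFn_append_self]
      rfl
    · rw [start_ny, permPairCode, List.count_append, count_permCode, count_permCode]
    · rw [start_y, permPairCode_eq, entries_listCode, List.append_assoc, getD_ofFn_append_add,
        getD_ofFn_append_self]
      rfl
    · lift k to Fin n using hk
      lift l to Fin n using hl
      have e : ∀ k : Fin n, n - 1 - (k : ℕ) = (k.rev : ℕ) := fun k => by rw [Fin.val_rev]; omega
      rw [Violates, e1, e1, e2, e2, e3, e3, e, e, e1, e1]
      rintro (h | h | h | ⟨h, h' | h' | h' | ⟨h1, h2⟩ | ⟨h1, h2⟩⟩)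
      · omega
      · omega
      · omega
      · exact h.ne (congrArg Fin.val (σ.injective (Fin.ext h')))
      · exact h.ne (congrArg Fin.val (f.injective (Fin.ext h')))
      · exact h.ne (congrArg Fin.val (g.injective (Fin.ext h')))
      · exact absurd (hf k l ⟨h, h1⟩) (not_lt.2 h2)
      · exact absurd (hg k l ⟨h, h1⟩) (not_lt.2 h2)

/-- The size can only be the number of letters `false` in the first word. For this `n`, `Valid`
finds the permutations, and `Q` decides whether the pair is outside the range. -/
theorem polyTimeRel_compl_range : PolyTimeRel fun u v => ∃ (n : ℕ) (σ : Equiv.Perm (Fin n))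
    (f : linExts (permPoset σ) n) (g : linExts (permPoset (reversal σ)) n),
    (f, g) ∉ Set.range (pairOfPerm n σ) ∧ u = permCode σ ∧ v = permPairCode f.1 g.1 := by
  classical
  refine ⟨fun p => decide (∃ (n : ℕ) (σ : Equiv.Perm (Fin n)) (f : linExts (permPoset σ) n)
    (g : linExts (permPoset (reversal σ)) n), (f, g) ∉ Set.range (pairOfPerm n σ) ∧
      p.1 = permCode σ ∧ p.2 = permPairCode f.1 g.1), polyTime_of_prog_bool relProg.prog (.inl x) (.inl y) (.inl nx) (.inl ny)
    (.inl r) (by simp) fun u v => ?_, fun u v => decide_eq_true_iff⟩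
  have hc := List.count_le_length (a := false) (l := u)
  obtain ⟨Q, h1, h2⟩ := relProg_spec (N := u.length + v.length + 5) (S := start u v)
    (n := u.count false) (by omega) (start_nx u v) (start_zero u v)
  rw [eval_prog_start, h1, decide_eq_true_iff]
  have key : ∀ {n : ℕ} (σ f g : Equiv.Perm (Fin n)) (hf : f ∈ linExts (permPoset σ) n)
      (hg : g ∈ linExts (permPoset (reversal σ)) n), u = permCode σ → v = permPairCode f g →
      (Q ↔ (⟨f, hf⟩, ⟨g, hg⟩) ∉ Set.range (pairOfPerm n σ)) := by
    rintro n σ f g hf hg rfl rfl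
    rw [count_permCode] at h2
    rw [h2 σ f g, mem_range_pairOfPerm]
    · intro k
      rw [start_x, entries_permCode, getD_ofFn_append]
    · intro k
      rw [start_y, permPairCode_eq, entries_listCode, List.append_assoc, getD_ofFn_append]
    · intro k
      rw [start_y, permPairCode_eq, entries_listCode, List.append_assoc, getD_ofFn_append_add,
        getD_ofFn_append]
  constructor
  · rintro ⟨n, σ, ⟨f, hf⟩, ⟨g, hg⟩, h, hu, hv⟩
    have hn : u.count false = n := (congrArg (List.count false) hu).trans (count_permCode σ)
    refine ⟨?_, (key σ f g hf hg hu hv).2 h⟩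
    rw [hn, valid_iff hn]
    exact ⟨σ, f, hf, g, hg, hu, hv⟩
  · rintro ⟨h, hq⟩
    obtain ⟨σ, f, hf, g, hg, hu, hv⟩ := (valid_iff rfl).1 h
    exact ⟨_, σ, ⟨f, hf⟩, ⟨g, hg⟩, (key σ f g hf hg hu hv).1 hq, hu, hv⟩

end ArrProg

theorem theoremt :
    (∀ (n : ℕ) (σ : Equiv.Perm (Fin n)), 0 ≤ eta σ) ∧
    InSharpP etaWord ∧
    ∃ β : (n : ℕ) → (σ : Equiv.Perm (Fin n)) → Equiv.Perm (Fin n) →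
        linExts (permPoset σ) n × linExts (permPoset (reversal σ)) n,
      (∀ (n : ℕ) (σ : Equiv.Perm (Fin n)), Function.Injective (β n σ)) ∧
      Nonempty (Turing.TM2ComputableInPolyTime
        (fun s : Σ n : ℕ, Equiv.Perm (Fin n) × Equiv.Perm (Fin n) =>
          pairCode (permCode s.2.1, permCode s.2.2))
        (fun t : Σ n : ℕ, Equiv.Perm (Fin n) × Equiv.Perm (Fin n) =>
          permPairCode t.2.1 t.2.2)
        (fun s => ⟨s.1, (β s.1 s.2.1 s.2.2).1.1, (β s.1 s.2.1 s.2.2).2.1⟩)) ∧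
      PolyTimeRel (fun x y => ∃ (n : ℕ) (σ : Equiv.Perm (Fin n))
        (f : linExts (permPoset σ) n) (g : linExts (permPoset (reversal σ)) n),
        (f, g) ∉ Set.range (β n σ) ∧ x = permCode σ ∧ y = permPairCode f.1 g.1) ∧
      ∀ (n : ℕ) (σ : Equiv.Perm (Fin n)), eta σ = ((Set.range (β n σ))ᶜ.ncard : ℤ) := by
  refine ⟨fun n σ => ?_, ⟨2 * Polynomial.X, _, ArrProg.polyTimeRel_compl_range, etaWord_eq_ncard⟩,
    pairOfPerm, fun n => pairOfPerm_injective, ArrProg.polyTime_pairOfPerm,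
    ArrProg.polyTimeRel_compl_range, fun n => eta_eq⟩
  rw [eta_eq]
  exact Nat.cast_nonneg _
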